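/- All manifolds are smooth, Hausdorff, second countable and without boundary; all maps, forms and functions are smooth; indices $i,j,k$ run from $1$ to $n$, $a$ from $0$ to $n$, and repeated indices are summed. **Definitions.** A *generalized Finsler structure* on a manifold $M^{n+1}$ is a connected manifold $\Sigma^{2n+1}$ with an immersion $\iota:\Sigma\to TM$ that is transverse to the orbits of scalar multiplication on $TM$, such that $\pi\circ\iota:\Sigma\to M$ is a submersion whose (non-empty) fibers $\Sigma_x=\iota^{-1}(T_xM)$ are connected and such that each $\iota_x:\Sigma_x\to T_xM$ is an immersed hypersurface that is locally strictly convex towards $0_x$. The latter means: for $u\in\Sigma_x$ let $u^*\in T_x^*M$ be the covector whose kernel is the hyperplane tangent to $\iota_x(\Sigma_x)$ at $\iota(u)$ and with $u^*(\iota(u))=1$; then $u^*\bigl((\iota_x\circ c)''(0)\bigr)<0$ for each curve $c$ in $\Sigma_x$ with $c(0)=u$, $c'(0)\neq0$. The *Hilbert form* of $(\Sigma,\iota)$ is the $1$-form on $\Sigma$ with value $(\pi\circ\iota)^*(u^*)$ at $u$. A coframing $(\omega_0,\dots,\omega_n,\theta_{01},\dots,\theta_{0n})$ of an open set $U\subset\Sigma$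 is *adapted* if $\omega_0$ is the Hilbert form, each $\omega_i$ vanishes when pulled back to the fibers $\Sigma_x$, and, with $\theta_{i0}=-\theta_{0i}$, $$d\omega_0=-\theta_{0j}\wedge\omega_j,\qquad d\omega_i=-\theta_{i0}\wedge\omega_0-\theta_{ij}\wedge\omega_j-I_{ijk}\,\theta_{0k}\wedge\omega_j \tag{$*$}$$ for some (necessarily unique) $1$-forms $\theta_{ij}=-\theta_{ji}$, its *connection forms*, and functions $I_{ijk}=I_{jik}$ on $U$. The adapted coframings are the local sections of an $O(n)$-structure $F\to\Sigma$, the *canonical $O(n)$-structure* of $(\Sigma,\iota)$, a submanifold of the coframe bundle of $\Sigma$. The *tautological forms* $\omega_a,\theta_{0i}$ on $F$ are those of the coframe bundle; the *connection forms* $\theta_{ij}$ on $F$ are the $1$-forms whose pullback by each adapted coframing is the family of connection forms of that coframing. **Proposition.** Let $X$ be a manifold of dimension at least $2n+1$ with pointwise linearly independent $1$-forms $\omega_0,\dots,\omega_n,\theta_{01},\dots,\theta_{0n}$ for which $(*)$ holds for some $1$-forms $\theta_{ij}=-\theta_{ji}$ and some functions $I_{ijk}=I_{jik}=I_{ikj}$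 on $X$. Let $\tau:X\to M^{n+1}$ and $\psi:X\to\Sigma^{2n+1}$ be submersions with connected fibers, $\psi$ onto and $\Sigma$ connected, such that the fibers of $\tau$ and of $\psi$ are, respectively, the leaves of the Frobenius systems generated by $\{\omega_0,\dots,\omega_n\}$ and by $\{\omega_0,\dots,\omega_n,\theta_{01},\dots,\theta_{0n}\}$. Then there is an immersion $\iota:\Sigma\to TM$ that defines a generalized Finsler structure on $M$ and satisfies $\pi\circ\iota\circ\psi=\tau$, and there is a smooth map $\phi:X\to F$ into its canonical $O(n)$-structure, covering $\psi$, such that the connection forms on $F$ exist and $\phi$ pulls back the tautological forms and the connection forms on $F$ to the given forms $\omega_a$, $\theta_{0i}$ and $\theta_{ij}$ on $X$. -/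

import Mathlib

open scoped Manifold ContDiff

/-! ### Differential 1-forms on manifolds -/

/-- A (not necessarily smooth) 1-form on an `N`-manifold `X`. -/
abbrev OneForm (N : ℕ) (X : Type*) [TopologicalSpace X]
    [ChartedSpace (EuclideanSpace ℝ (Fin N)) X] : Type _ :=
  ∀ x : X, TangentSpace (𝓡 N) x →L[ℝ] ℝ

namespace OneForm

variable {N : ℕ} {X : Type*} [TopologicalSpace X] [ChartedSpace (EuclideanSpace ℝ (Fin N)) X]

/-- The 1-form `α` is smooth on `U`, as a section of the cotangent bundle. -/
def SmoothOn [IsManifold (𝓡 N) ∞ X] (α : OneForm N X) (U : Set X) : Prop :=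
  ContMDiffOn (𝓡 N) ((𝓡 N).prod 𝓘(ℝ, EuclideanSpace ℝ (Fin N) →L[ℝ] ℝ)) ∞
    (fun x => (⟨x, α x⟩ : Bundle.TotalSpace (EuclideanSpace ℝ (Fin N) →L[ℝ] ℝ)
      (fun y : X => TangentSpace (𝓡 N) y →L[ℝ] Bundle.Trivial X ℝ y))) U

/-- The 1-form `α` read in the chart centred at `x`: its pullback by the inverse of that chart. -/
noncomputable def inChart (α : OneForm N X) (x : X) (y : EuclideanSpace ℝ (Fin N)) :
    EuclideanSpace ℝ (Fin N) →L[ℝ] ℝ :=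
  (α ((extChartAt (𝓡 N) x).symm y)).comp
    (mfderiv 𝓘(ℝ, EuclideanSpace ℝ (Fin N)) (𝓡 N) (extChartAt (𝓡 N) x).symm y)

/-- The exterior derivative `(dα)_x (v, w)`, computed in the chart centred at `x`; the convention is
`dα (V, W) = V (α W) - W (α V) - α [V, W]`. -/
noncomputable def d (α : OneForm N X) (x : X) (v w : TangentSpace (𝓡 N) x) : ℝ :=
  extDeriv
    (fun y => ContinuousAlternatingMap.ofSubsingleton ℝ (EuclideanSpace ℝ (Fin N)) ℝ (0 : Fin 1)
      (α.inChart x y))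
    (extChartAt (𝓡 N) x x)
    ![mfderiv (𝓡 N) 𝓘(ℝ, EuclideanSpace ℝ (Fin N)) (extChartAt (𝓡 N) x) x v,
      mfderiv (𝓡 N) 𝓘(ℝ, EuclideanSpace ℝ (Fin N)) (extChartAt (𝓡 N) x) x w]

/-- The wedge product of two 1-forms, `(α ∧ β)_x (v, w)`. -/
noncomputable def wedge (α β : OneForm N X) (x : X) (v w : TangentSpace (𝓡 N) x) : ℝ :=
  α x v * β x w - α x w * β x v

end OneForm

/-! ### The Finsler structure equations -/

/-- Forms `ω_0, …, ω_n`, `θ_{01}, …, θ_{0n}`, `θ_{ij}` and functions `I_{ijk}` on a manifold. -/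
structure FinslerForms (n N : ℕ) (X : Type*) [TopologicalSpace X]
    [ChartedSpace (EuclideanSpace ℝ (Fin N)) X] where
  /-- `ω_0, …, ω_n` -/
  omega : Fin (n + 1) → OneForm N X
  /-- `θ_{01}, …, θ_{0n}` -/
  theta : Fin n → OneForm N X
  /-- `θ_{ij}` for `1 ≤ i, j ≤ n` -/
  conn : Fin n → Fin n → OneForm N X
  /-- `I_{ijk}` for `1 ≤ i, j, k ≤ n` -/
  tor : Fin n → Fin n → Fin n → X → ℝ

/-- The space in which the coframes `(ω_0, …, ω_n, θ_{01}, …, θ_{0n})` take their values. -/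
abbrev CoframeValue (n : ℕ) : Type := Fin (n + 1) ⊕ Fin n → ℝ

namespace FinslerForms

variable {n N : ℕ} {X : Type*} [TopologicalSpace X] [ChartedSpace (EuclideanSpace ℝ (Fin N)) X]

/-- The vector-valued 1-form `(ω_0, …, ω_n, θ_{01}, …, θ_{0n})` at `x`. -/
noncomputable def coframe (f : FinslerForms n N X) (x : X) : TangentSpace (𝓡 N) x →L[ℝ] CoframeValue n :=
  ContinuousLinearMap.pi (Sum.elim (fun a => f.omega a x) (fun i => f.theta i x))

/-- The structure equations at `x` (with `θ_{i0} = -θ_{0i}`):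
`dω_0 = - θ_{0j} ∧ ω_j` and
`dω_i = - θ_{i0} ∧ ω_0 - θ_{ij} ∧ ω_j - I_{ijk} θ_{0k} ∧ ω_j`. -/
def StructureEquationsAt (f : FinslerForms n N X) (x : X) : Prop :=
  (∀ v w : TangentSpace (𝓡 N) x,
    (f.omega 0).d x v w = - ∑ j, (f.theta j).wedge (f.omega j.succ) x v w) ∧
  ∀ (i : Fin n) (v w : TangentSpace (𝓡 N) x),
    (f.omega i.succ).d x v w =
      (f.theta i).wedge (f.omega 0) x v w
      - ∑ j, (f.conn i j).wedge (f.omega j.succ) x v w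
      - ∑ j, ∑ k, f.tor i j k x * (f.theta k).wedge (f.omega j.succ) x v w

/-- On the set `U`, the forms and functions in `f` are smooth, the `ω_a` and `θ_{0i}` are pointwise
linearly independent, `θ_{ij} = -θ_{ji}`, `I_{ijk} = I_{jik}`, and the structure equations hold. -/
structure IsFinslerOn [IsManifold (𝓡 N) ∞ X] (f : FinslerForms n N X) (U : Set X) : Prop where
  smooth_omega : ∀ a, (f.omega a).SmoothOn U
  smooth_theta : ∀ i, (f.theta i).SmoothOn U
  smooth_conn : ∀ i j, (f.conn i j).SmoothOn U
  smooth_tor : ∀ i j k, ContMDiffOn (𝓡 N) 𝓘(ℝ) ∞ (f.tor i j k) U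
  linearIndependent : ∀ x ∈ U,
    LinearIndependent ℝ (Sum.elim (fun a => f.omega a x) (fun i => f.theta i x))
  conn_skew : ∀ x ∈ U, ∀ i j, f.conn i j x = - f.conn j i x
  tor_symm : ∀ x ∈ U, ∀ i j k, f.tor i j k x = f.tor j i k x
  structureEquations : ∀ x ∈ U, f.StructureEquationsAt x

end FinslerForms

/-! ### Generalized Finsler structures -/

section GeneralizedFinsler

variable {n : ℕ}
  {M : Type*} [TopologicalSpace M] [ChartedSpace (EuclideanSpace ℝ (Fin (n + 1))) M]
  [IsManifold (𝓡 (n + 1)) ∞ M]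
  {S : Type*} [TopologicalSpace S] [ChartedSpace (EuclideanSpace ℝ (Fin (2 * n + 1))) S]

/-- For `p ∈ T_xM`, the canonical map `T_xM → T_p(TM)`: the differential at `p` of the inclusion
of the vector space `T_xM` into `TM`. -/
noncomputable def verticalLift (p : TangentBundle (𝓡 (n + 1)) M) :
    TangentSpace (𝓡 (n + 1)) p.proj →L[ℝ] TangentSpace (𝓡 (n + 1)).tangent p :=
  mfderiv 𝓘(ℝ, EuclideanSpace ℝ (Fin (n + 1))) (𝓡 (n + 1)).tangent
    (fun v : EuclideanSpace ℝ (Fin (n + 1)) => (⟨p.proj, v⟩ : TangentBundle (𝓡 (n + 1)) M)) p.snd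

/-- For `u ∈ Σ` lying over `x ∈ M`, the tangent space at `ι u` of the image of the fiber
`Σ_x = ι⁻¹(T_xM)`, as a subspace of `T_xM`. -/
noncomputable def indicatrixTangent (ι : S → TangentBundle (𝓡 (n + 1)) M) (u : S) :
    Submodule ℝ (TangentSpace (𝓡 (n + 1)) (ι u).proj) :=
  (LinearMap.range
    (mfderiv (𝓡 (2 * n + 1)) (𝓡 (n + 1)).tangent ι u).toLinearMap).comap
    (verticalLift (ι u)).toLinearMap

/-- `l` is the covector `u*`: its kernel is the tangent space at `ι u` of `ι(Σ_x) ⊆ T_xM`, and it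
takes the value `1` on the vector `ι u`. -/
def IsDualCovector (ι : S → TangentBundle (𝓡 (n + 1)) M) (u : S)
    (l : TangentSpace (𝓡 (n + 1)) (ι u).proj →L[ℝ] ℝ) : Prop :=
  LinearMap.ker l.toLinearMap = indicatrixTangent ι u ∧ l (ι u).snd = 1

/-- `ι : Σ → TM` is a generalized Finsler structure on the `(n+1)`-manifold `M`. -/
structure IsGeneralizedFinslerStructure (ι : S → TangentBundle (𝓡 (n + 1)) M) : Prop where
  connected : ConnectedSpace S
  /-- `ι` is an immersion -/
  smooth : ContMDiff (𝓡 (2 * n + 1)) (𝓡 (n + 1)).tangent ∞ ι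
  immersion : ∀ u, Function.Injective (mfderiv (𝓡 (2 * n + 1)) (𝓡 (n + 1)).tangent ι u)
  /-- `ι` is transverse to the orbits of scalar multiplication: as `Σ` has codimension one, this
  says that the image of the differential of `ι` misses the radial vector at `ι u` -/
  radiallyTransverse : ∀ u, verticalLift (ι u) (ι u).snd ∉
    Set.range (mfderiv (𝓡 (2 * n + 1)) (𝓡 (n + 1)).tangent ι u)
  /-- `π ∘ ι` is a submersion -/
  submersion : ∀ u, Function.Surjective
    (mfderiv (𝓡 (2 * n + 1)) (𝓡 (n + 1)) (fun s => (ι s).proj) u)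
  /-- the fibers of `π ∘ ι` (those that are not empty) are connected -/
  fibers : ∀ x : M, IsPreconnected {u | (ι u).proj = x}
  /-- each hypersurface `ι_x : Σ_x → T_xM` is locally strictly convex towards the origin: every
  regular curve on it accelerates at time `0`, relative to its tangent hyperplane, to the side on
  which the origin lies (the curve `t ↦ ι (c t)` stays in a single tangent space, so its second
  derivative there makes sense) -/
  convex : ∀ c : ℝ → S, ContMDiff 𝓘(ℝ) (𝓡 (2 * n + 1)) ∞ c →
    (∀ t, (ι (c t)).proj = (ι (c 0)).proj) →
    mfderiv 𝓘(ℝ) (𝓡 (2 * n + 1)) c 0 (1 : ℝ) ≠ 0 →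
    ∀ l, IsDualCovector ι (c 0) l →
      l (iteratedDeriv (F := EuclideanSpace ℝ (Fin (n + 1))) 2 (fun t => (ι (c t)).snd) 0) < 0

/-! ### The canonical `O(n)`-structure -/

/-- `α` is the value at `u` of the Hilbert form of `ι`, i.e. `(π ∘ ι)^*(u*)`. -/
def IsHilbertFormAt (ι : S → TangentBundle (𝓡 (n + 1)) M) (u : S)
    (α : TangentSpace (𝓡 (2 * n + 1)) u →L[ℝ] ℝ) : Prop :=
  ∃ l, IsDualCovector ι u l ∧
    ∀ w, α w = l (mfderiv (𝓡 (2 * n + 1)) (𝓡 (n + 1)) (fun s => (ι s).proj) u w)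

variable [IsManifold (𝓡 (2 * n + 1)) ∞ S]

/-- `(ω_0, …, ω_n, θ_{01}, …, θ_{0n})` is an adapted coframing of `Σ` on `U`: `ω_0` is the Hilbert
form, the `ω_i` vanish when pulled back to the fibers `Σ_x`, and the structure equations hold with
the connection forms `θ_{ij}` and some functions `I_{ijk}`. -/
structure IsAdaptedOn (ι : S → TangentBundle (𝓡 (n + 1)) M)
    (f : FinslerForms n (2 * n + 1) S) (U : Set S) : Prop where
  finsler : f.IsFinslerOn U
  hilbert : ∀ u ∈ U, IsHilbertFormAt ι u (f.omega 0 u)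
  semibasic : ∀ u ∈ U, ∀ w : TangentSpace (𝓡 (2 * n + 1)) u,
    mfderiv (𝓡 (2 * n + 1)) (𝓡 (n + 1)) (fun s => (ι s).proj) u w = 0 →
    ∀ i : Fin n, f.omega i.succ u w = 0

/-- The total space of the smooth vector bundle over `Σ` with fiber `Hom(T_uΣ, ℝ^{2n+1})`; the
coframe bundle of `Σ` is an open subset of it. -/
abbrev CoframeBundle (n : ℕ) (S : Type*) [TopologicalSpace S]
    [ChartedSpace (EuclideanSpace ℝ (Fin (2 * n + 1))) S] : Type _ :=
  Bundle.TotalSpace (EuclideanSpace ℝ (Fin (2 * n + 1)) →L[ℝ] CoframeValue n)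
    (fun u : S => TangentSpace (𝓡 (2 * n + 1)) u →L[ℝ] Bundle.Trivial S (CoframeValue n) u)

/-- The model with corners of the manifold `CoframeBundle n S`. -/
noncomputable abbrev coframeModel (n : ℕ) :=
  (𝓡 (2 * n + 1)).prod 𝓘(ℝ, EuclideanSpace ℝ (Fin (2 * n + 1)) →L[ℝ] CoframeValue n)

/-- A coframing of `Σ`, as a section of the coframe bundle. -/
noncomputable def FinslerForms.toSection (f : FinslerForms n (2 * n + 1) S) (u : S) : CoframeBundle n S :=
  ⟨u, f.coframe u⟩

/-- The canonical `O(n)`-structure `F → Σ` of `ι`, as a submanifold of the coframe bundle: its local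
sections are the adapted coframings, so it consists of all their values. -/
def structureBundle (ι : S → TangentBundle (𝓡 (n + 1)) M) : Set (CoframeBundle n S) :=
  {p | ∃ (U : Set S) (f : FinslerForms n (2 * n + 1) S),
    IsOpen U ∧ p.proj ∈ U ∧ IsAdaptedOn ι f U ∧ f.toSection p.proj = p}

/-- The tautological forms `(ω_0, …, ω_n, θ_{01}, …, θ_{0n})` on the coframe bundle. -/
noncomputable def tautologicalForm (p : CoframeBundle n S)
    (ξ : TangentSpace (coframeModel n) p) : CoframeValue n :=
  p.snd (mfderiv (coframeModel n) (𝓡 (2 * n + 1))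
    (fun q : CoframeBundle n S => q.proj) p ξ)

/-- `Θ` restricts to the connection forms `θ_{ij}` on `F`: its pullback by each local section of `F`,
i.e. by each adapted coframing, is the family of connection forms of that coframing. The vectors
tangent to local sections of `F` span the tangent spaces of `F`, so this determines `Θ` on `F`. -/
def IsConnectionForm (ι : S → TangentBundle (𝓡 (n + 1)) M)
    (Θ : Fin n → Fin n → ∀ p : CoframeBundle n S, TangentSpace (coframeModel n) p →L[ℝ] ℝ) :
    Prop :=
  ∀ (U : Set S) (f : FinslerForms n (2 * n + 1) S), IsOpen U → IsAdaptedOn ι f U →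
    ∀ u ∈ U, ∀ (i j : Fin n) (w : TangentSpace (𝓡 (2 * n + 1)) u),
      Θ i j (f.toSection u)
        (mfderiv (𝓡 (2 * n + 1)) (coframeModel n) f.toSection u w) = f.conn i j u w

end GeneralizedFinsler

/-! Along the fibers of `ψ` the structure equations leave only a rotation. On a vector `v` killed by
all `ω_a` and `θ_{0i}` they give `dω_0(v, ·) = 0` and `dω_i(v, ·) = -θ_{ij}(v) ω_j`. As `θ_{ij}` is
skew and the fibers are connected, `ω_0` and `∑ ω_i²` descend to `S`. The map `τ` descends to `p : S
→ M` (`exists_descent`), and the image in `TM` of a vector with `ω_0 = 1` and `ω_i = 0` depends only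
on the point `s` of `S` (`exists_field`). This image `V(s)` defines `ι(s) = (p(s), V(s))`.

The geometry of `ι` is local on `S`, where sections of `ψ` pull the given forms back to coframings
compatible with `p` and `V` (`IsFrameOn`). Let `P_a` be the image under `dp` of the vector dual to
`ω_a`, so that `P_0 = V` and `dp = ∑ P_a ω_a`. Symmetry of second derivatives, tested on a vector
`v` tangent to a fiber of `p`, gives `dP_0(v) = -θ_{0i}(v) P_i` and `dP_k(v) ≡ θ_{0k}(v) P_0` modulo
`P_1, …, P_n` (`eventually_fderiv_frameInChart`). Hence the indicatrix has tangent hyperplane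
spanned by the `P_i`, transverse to the radial vector `P_0`; the covector `u*` is dual to `P_0` in
the frame, so the Hilbert form is `ω_0`; and a curve `c` in a fiber has `u*((V ∘ c)'') = -∑
θ_{0i}(c')²`, which is negative because the `θ_{0i}` form a coframe of the fiber.

The map `φ` sends `x` to the linear map through which the coframe at `x` factors over `dψ`. Along a
section of `ψ` it is the pulled-back adapted coframing, so it takes values in `F` and respects the
tautological forms.

For the connection forms to exist on `F`, their value at a point must depend only on the tangent
vector of the section used to compute it. Comparing `dω_0` and then `dω_i` shows that two adapted
coframings have the same `∑ ω_i²` (`sum_sq_eq`). If they also agree at a point, their first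
derivatives there differ by a skew matrix of forms, and Cartan's lemma says that the connection
forms differ by exactly that matrix (`conn_eq_sub`). Finally, a vector on `X` that is not vertical
for `ψ` is tangent to a section, where the connection forms are prescribed, and a vertical vector is
a difference of two such vectors. -/

open Bundle

/-! ### Smoothness and derivatives read in charts -/

section ChartDerivatives

variable {N : ℕ} {X : Type*} [TopologicalSpace X] [ChartedSpace (EuclideanSpace ℝ (Fin N)) X]
  [IsManifold (𝓡 N) ∞ X]

omit [IsManifold (𝓡 N) ∞ X] in
theorem extChartAt_target_mem_nhds_self (x₀ : X) {y : EuclideanSpace ℝ (Fin N)}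
    (hy : y ∈ (extChartAt (𝓡 N) x₀).target) : (extChartAt (𝓡 N) x₀).target ∈ nhds y :=
  (isOpen_extChartAt_target x₀).mem_nhds hy

theorem contMDiffAt_extChartAt_symm {x₀ : X} {y : EuclideanSpace ℝ (Fin N)}
    (hy : y ∈ (extChartAt (𝓡 N) x₀).target) :
    ContMDiffAt 𝓘(ℝ, EuclideanSpace ℝ (Fin N)) (𝓡 N) ∞ (extChartAt (𝓡 N) x₀).symm y :=
  (contMDiffOn_extChartAt_symm x₀).contMDiffAt (extChartAt_target_mem_nhds_self x₀ hy)

theorem mdifferentiableAt_extChartAt_symm {x₀ : X} {y : EuclideanSpace ℝ (Fin N)}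
    (hy : y ∈ (extChartAt (𝓡 N) x₀).target) :
    MDifferentiableAt 𝓘(ℝ, EuclideanSpace ℝ (Fin N)) (𝓡 N) (extChartAt (𝓡 N) x₀).symm y :=
  (contMDiffAt_extChartAt_symm hy).mdifferentiableAt (by simp)

theorem mfderiv_extChartAt_symm_apply_mfderiv {x₀ x : X}
    (hx : x ∈ (extChartAt (𝓡 N) x₀).source) (v : TangentSpace (𝓡 N) x) :
    mfderiv 𝓘(ℝ, EuclideanSpace ℝ (Fin N)) (𝓡 N) (extChartAt (𝓡 N) x₀).symm
      (extChartAt (𝓡 N) x₀ x)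
      (mfderiv (𝓡 N) 𝓘(ℝ, EuclideanSpace ℝ (Fin N)) (extChartAt (𝓡 N) x₀) x v) = v := by
  have h := mfderivWithin_extChartAt_symm_comp_mfderiv_extChartAt' (I := 𝓡 N) hx
  have h2 := congrArg (fun L => L v) h
  rw [ModelWithCorners.range_eq_univ, mfderivWithin_univ] at h2
  exact h2

theorem mfderiv_extChartAt_symm_self (x : X) (v : EuclideanSpace ℝ (Fin N)) :
    mfderiv 𝓘(ℝ, EuclideanSpace ℝ (Fin N)) (𝓡 N) (extChartAt (𝓡 N) x).symm
      (extChartAt (𝓡 N) x x) v = v := by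
  have h := mfderivWithin_range_extChartAt_symm (I := 𝓡 N) (x := x)
  have h2 := congrArg (fun L => L v) h
  rw [ModelWithCorners.range_eq_univ, mfderivWithin_univ] at h2
  exact h2

/-- Smoothness of a map into the bundle `Hom(TX, V)`, read in a chart. -/
theorem contMDiffAt_hom_trivial_iff {V : Type*} [NormedAddCommGroup V] [NormedSpace ℝ V]
    {EY HY Y : Type*} [NormedAddCommGroup EY] [NormedSpace ℝ EY] [TopologicalSpace HY]
    {IY : ModelWithCorners ℝ EY HY} [TopologicalSpace Y] [ChartedSpace HY Y]
    (F : Y → TotalSpace (EuclideanSpace ℝ (Fin N) →L[ℝ] V)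
      (fun y : X => TangentSpace (𝓡 N) y →L[ℝ] Trivial X V y)) (y₀ : Y) :
    ContMDiffAt IY ((𝓡 N).prod 𝓘(ℝ, EuclideanSpace ℝ (Fin N) →L[ℝ] V)) ∞ F y₀ ↔
      ContMDiffAt IY (𝓡 N) ∞ (fun y => (F y).proj) y₀ ∧
      ContMDiffAt (M' := EuclideanSpace ℝ (Fin N) →L[ℝ] V)
        IY 𝓘(ℝ, EuclideanSpace ℝ (Fin N) →L[ℝ] V) ∞
        (fun y => (((F y).snd : EuclideanSpace ℝ (Fin N) →L[ℝ] V).comp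
          (mfderiv 𝓘(ℝ, EuclideanSpace ℝ (Fin N)) (𝓡 N) (extChartAt (𝓡 N) (F y₀).proj).symm
            (extChartAt (𝓡 N) (F y₀).proj (F y).proj) :
              EuclideanSpace ℝ (Fin N) →L[ℝ] EuclideanSpace ℝ (Fin N)))) y₀ := by
  rw [contMDiffAt_hom_bundle]
  refine and_congr_right fun hF => ?_
  refine Filter.EventuallyEq.contMDiffAt_iff ?_
  have hc : ∀ᶠ y in nhds y₀, (F y).proj ∈ (chartAt (EuclideanSpace ℝ (Fin N)) (F y₀).proj).source :=
    hF.continuousAt.eventually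
      ((chartAt _ (F y₀).proj).open_source.mem_nhds (mem_chart_source _ _))
  filter_upwards [hc] with y hy
  ext v
  simp only [ContinuousLinearMap.inCoordinates]
  rw [TangentBundle.symmL_trivializationAt hy]
  simp

end ChartDerivatives

section ChartReading

variable {N : ℕ} {X : Type*} [TopologicalSpace X] [ChartedSpace (EuclideanSpace ℝ (Fin N)) X]
  [IsManifold (𝓡 N) ∞ X]

/-- Smoothness of a section of `Hom(TX, V)`, read in a chart. -/
theorem contMDiffAt_hom_section_iff {V : Type*} [NormedAddCommGroup V] [NormedSpace ℝ V]
    (A : ∀ x : X, TangentSpace (𝓡 N) x →L[ℝ] V) (x₀ : X) :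
    ContMDiffAt (𝓡 N) ((𝓡 N).prod 𝓘(ℝ, EuclideanSpace ℝ (Fin N) →L[ℝ] V)) ∞
      (fun x => (⟨x, A x⟩ : TotalSpace (EuclideanSpace ℝ (Fin N) →L[ℝ] V)
        (fun y : X => TangentSpace (𝓡 N) y →L[ℝ] Trivial X V y))) x₀ ↔
    ContDiffAt (F := EuclideanSpace ℝ (Fin N) →L[ℝ] V) ℝ ∞
      (fun y => ((A ((extChartAt (𝓡 N) x₀).symm y) : EuclideanSpace ℝ (Fin N) →L[ℝ] V).comp
        (mfderiv 𝓘(ℝ, EuclideanSpace ℝ (Fin N)) (𝓡 N) (extChartAt (𝓡 N) x₀).symm y :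
          EuclideanSpace ℝ (Fin N) →L[ℝ] EuclideanSpace ℝ (Fin N))))
      (extChartAt (𝓡 N) x₀ x₀) := by
  rw [contMDiffAt_hom_trivial_iff]
  constructor
  · rintro ⟨-, h⟩
    rw [← contMDiffAt_iff_contDiffAt]
    have hs := contMDiffAt_extChartAt_symm (mem_extChartAt_target (I := 𝓡 N) x₀)
    have h' := ContMDiffAt.comp_of_eq (x := extChartAt (𝓡 N) x₀ x₀) h hs
      (extChartAt_to_inv (I := 𝓡 N) x₀)
    refine h'.congr_of_eventuallyEq ?_
    filter_upwards [extChartAt_target_mem_nhds_self x₀ (mem_extChartAt_target x₀)] with y hy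
    let A' : EuclideanSpace ℝ (Fin N) →L[ℝ] V := A ((extChartAt (𝓡 N) x₀).symm y)
    let B (z : EuclideanSpace ℝ (Fin N)) : EuclideanSpace ℝ (Fin N) →L[ℝ] EuclideanSpace ℝ (Fin N) :=
      mfderiv 𝓘(ℝ, EuclideanSpace ℝ (Fin N)) (𝓡 N) (extChartAt (𝓡 N) x₀).symm z
    exact congrArg (fun z => A'.comp (B z)) ((extChartAt (𝓡 N) x₀).right_inv hy).symm
  · intro h
    refine ⟨contMDiffAt_id, ?_⟩
    rw [← contMDiffAt_iff_contDiffAt] at h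
    have h' := ContMDiffAt.comp x₀ h (contMDiffAt_extChartAt (n := ∞) (I := 𝓡 N) (x := x₀))
    refine h'.congr_of_eventuallyEq ?_
    filter_upwards [extChartAt_source_mem_nhds (I := 𝓡 N) x₀] with y hy
    let A' (z : X) : EuclideanSpace ℝ (Fin N) →L[ℝ] V := A z
    let B : EuclideanSpace ℝ (Fin N) →L[ℝ] EuclideanSpace ℝ (Fin N) :=
      mfderiv 𝓘(ℝ, EuclideanSpace ℝ (Fin N)) (𝓡 N) (extChartAt (𝓡 N) x₀).symm
        (extChartAt (𝓡 N) x₀ y)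
    exact congrArg (fun z => (A' z).comp B) ((extChartAt (𝓡 N) x₀).left_inv hy).symm

end ChartReading

/-! ### Exterior derivatives of 1-forms and their pullbacks to normed spaces -/

theorem extDeriv_ofSubsingleton_apply {E : Type*} [NormedAddCommGroup E] [NormedSpace ℝ E]
    {β : E → E →L[ℝ] ℝ} {y : E} (hβ : DifferentiableAt ℝ β y) (v w : E) :
    extDeriv (fun y => ContinuousAlternatingMap.ofSubsingleton ℝ E ℝ (0 : Fin 1) (β y)) y ![v, w] =
      fderiv ℝ β y v w - fderiv ℝ β y w v := by
  have hd' : DifferentiableAt ℝ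
      (fun y => ContinuousAlternatingMap.ofSubsingleton ℝ E ℝ (0 : Fin 1) (β y)) y :=
    (ContinuousAlternatingMap.ofSubsingletonLIE (𝕜 := ℝ) (E := E)
      (F := ℝ) (0 : Fin 1)).toContinuousLinearEquiv.differentiableAt.comp _ hβ
  have e : ∀ v w : E, fderiv ℝ (fun y => β y v) y w = fderiv ℝ β y w v := by
    intro v w
    rw [(hβ.hasFDerivAt.clm_apply (hasFDerivAt_const v _)).fderiv]; simp
  rw [extDeriv_apply hd', Fin.sum_univ_two, ← e, ← e]
  simp [Fin.removeNth, sub_eq_add_neg]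

namespace OneForm

variable {N : ℕ} {X : Type*} [TopologicalSpace X] [ChartedSpace (EuclideanSpace ℝ (Fin N)) X]
  {E : Type*} [NormedAddCommGroup E] [NormedSpace ℝ E]

/-- The pullback of a 1-form by a map from a normed space, as a field of covectors. -/
noncomputable def pullE (α : OneForm N X) (G : E → X) (y : E) : E →L[ℝ] ℝ :=
  (α (G y)).comp (mfderiv 𝓘(ℝ, E) (𝓡 N) G y)

theorem pullE_apply (α : OneForm N X) (G : E → X) (y v : E) :
    α.pullE G y v = α (G y) (mfderiv 𝓘(ℝ, E) (𝓡 N) G y v) := rfl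

/-- Smoothness of a 1-form at a point, read in the chart centred there. -/
def SmoothAt (α : OneForm N X) (x : X) : Prop :=
  ContDiffAt ℝ ∞ (α.inChart x) (extChartAt (𝓡 N) x x)

variable [IsManifold (𝓡 N) ∞ X]

theorem smoothOn_iff {α : OneForm N X} {U : Set X} (hU : IsOpen U) :
    α.SmoothOn U ↔ ∀ x ∈ U, α.SmoothAt x := by
  have key : ∀ x, ContMDiffAt (𝓡 N) ((𝓡 N).prod 𝓘(ℝ, EuclideanSpace ℝ (Fin N) →L[ℝ] ℝ)) ∞
      (fun x => (⟨x, α x⟩ : TotalSpace (EuclideanSpace ℝ (Fin N) →L[ℝ] ℝ)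
      (fun y : X => TangentSpace (𝓡 N) y →L[ℝ] Bundle.Trivial X ℝ y))) x ↔ α.SmoothAt x :=
    fun x => contMDiffAt_hom_section_iff (V := ℝ) α x
  constructor
  · intro h x hx
    exact (key x).1 (h.contMDiffAt (hU.mem_nhds hx))
  · intro h x hx
    exact ((key x).2 (h x hx)).contMDiffWithinAt

/-- The chart centred at `x` has the identity as its differential at `x`, so no Jacobian enters and
only the skew-symmetrized derivative of the local expression remains. -/
theorem d_eq {α : OneForm N X} {x : X} (h : α.SmoothAt x)
    (v w : TangentSpace (𝓡 N) x) :
    α.d x v w = fderiv ℝ (α.inChart x) (extChartAt (𝓡 N) x x) v w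
      - fderiv ℝ (α.inChart x) (extChartAt (𝓡 N) x x) w v := by
  have hd : DifferentiableAt ℝ (α.inChart x) (extChartAt (𝓡 N) x x) :=
    h.differentiableAt (by simp)
  let D : EuclideanSpace ℝ (Fin N) →L[ℝ] EuclideanSpace ℝ (Fin N) :=
    mfderiv (𝓡 N) 𝓘(ℝ, EuclideanSpace ℝ (Fin N)) (extChartAt (𝓡 N) x) x
  have hD : D = ContinuousLinearMap.id ℝ _ := mfderiv_extChartAt_self
  refine (extDeriv_ofSubsingleton_apply hd (D v) (D w)).trans ?_
  rw [hD]; rfl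

theorem inChart_apply_mfderiv (α : OneForm N X) {x₀ x : X}
    (hx : x ∈ (extChartAt (𝓡 N) x₀).source) (v : TangentSpace (𝓡 N) x) :
    α.inChart x₀ (extChartAt (𝓡 N) x₀ x)
      (mfderiv (𝓡 N) 𝓘(ℝ, EuclideanSpace ℝ (Fin N)) (extChartAt (𝓡 N) x₀) x v) = α x v := by
  let a (z : X) : EuclideanSpace ℝ (Fin N) →L[ℝ] ℝ := α z
  have h1 := mfderiv_extChartAt_symm_apply_mfderiv hx v
  have h2 := (extChartAt (𝓡 N) x₀).left_inv hx
  exact (congrArg (a _) h1).trans (congrArg (fun z => a z v) h2)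

/-- Smoothness of `α` is known in the fixed chart at `G y₀`, whereas the pullback refers to no
chart. Factoring through that chart gives a composite of maps between normed spaces, which can be
differentiated. -/
theorem pullE_eventuallyEq (α : OneForm N X) {G : E → X} {y₀ : E}
    (hG : ContMDiffAt 𝓘(ℝ, E) (𝓡 N) ∞ G y₀) :
    α.pullE G =ᶠ[nhds y₀] fun y => (α.inChart (G y₀) (extChartAt (𝓡 N) (G y₀) (G y))).comp
      (fderiv ℝ (fun z => extChartAt (𝓡 N) (G y₀) (G z)) y) := by
  have h1 : ∀ᶠ y in nhds y₀, ContMDiffAt 𝓘(ℝ, E) (𝓡 N) 1 G y :=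
    (contMDiffAt_iff_contMDiffAt_nhds (by simp)).1 (hG.of_le (by simp : (1 : WithTop ℕ∞) ≤ ∞))
  filter_upwards [h1, hG.continuousAt.eventually (extChartAt_source_mem_nhds (I := 𝓡 N) (G y₀))]
    with y hy hs
  have hs' : G y ∈ (chartAt (EuclideanSpace ℝ (Fin N)) (G y₀)).source := by
    rwa [extChartAt_source] at hs
  ext v
  have hd : fderiv ℝ (fun z => extChartAt (𝓡 N) (G y₀) (G z)) y v =
      mfderiv (𝓡 N) 𝓘(ℝ, EuclideanSpace ℝ (Fin N)) (extChartAt (𝓡 N) (G y₀)) (G y)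
        (mfderiv 𝓘(ℝ, E) (𝓡 N) G y v) := by
    rw [← mfderiv_eq_fderiv]
    exact congrArg (fun L => L v) (mfderiv_comp y (mdifferentiableAt_extChartAt hs')
      (hy.mdifferentiableAt one_ne_zero))
  rw [ContinuousLinearMap.comp_apply, hd]
  exact (α.inChart_apply_mfderiv hs _).symm

omit [IsManifold (𝓡 N) ∞ X] in
theorem contDiffAt_extChartAt_comp {G : E → X} {y₀ : E}
    (hG : ContMDiffAt 𝓘(ℝ, E) (𝓡 N) ∞ G y₀) :
    ContDiffAt ℝ ∞ (fun z => extChartAt (𝓡 N) (G y₀) (G z)) y₀ := by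
  rw [← contMDiffAt_iff_contDiffAt]
  exact (contMDiffAt_extChartAt (n := ∞) (I := 𝓡 N) (x := G y₀)).comp y₀ hG

theorem contDiffAt_pullE {α : OneForm N X} {G : E → X} {y₀ : E}
    (hG : ContMDiffAt 𝓘(ℝ, E) (𝓡 N) ∞ G y₀) (hα : α.SmoothAt (G y₀)) :
    ContDiffAt ℝ ∞ (α.pullE G) y₀ := by
  refine ContDiffAt.congr_of_eventuallyEq ?_ (α.pullE_eventuallyEq hG)
  have hH := contDiffAt_extChartAt_comp hG
  exact (ContDiffAt.comp (f := fun z => extChartAt (𝓡 N) (G y₀) (G z)) y₀ hα hH).clm_comp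
    (hH.fderiv_right (by simp))

/-- The exterior derivative commutes with pullback. -/
theorem d_pullE {α : OneForm N X} {G : E → X} {y₀ : E}
    (hG : ContMDiffAt 𝓘(ℝ, E) (𝓡 N) ∞ G y₀) (hα : α.SmoothAt (G y₀)) (v w : E) :
    fderiv ℝ (α.pullE G) y₀ v w - fderiv ℝ (α.pullE G) y₀ w v =
      α.d (G y₀) (mfderiv 𝓘(ℝ, E) (𝓡 N) G y₀ v) (mfderiv 𝓘(ℝ, E) (𝓡 N) G y₀ w) := by
  have hH := contDiffAt_extChartAt_comp hG
  set H : E → EuclideanSpace ℝ (Fin N) := fun z => extChartAt (𝓡 N) (G y₀) (G z) with hHdef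
  set a := α.inChart (G y₀)
  have hH1 : DifferentiableAt ℝ H y₀ := hH.differentiableAt (by simp)
  have hH2 : DifferentiableAt ℝ (fderiv ℝ H) y₀ :=
    (hH.fderiv_right (m := 1) (by norm_cast)).differentiableAt (by simp)
  have ha : DifferentiableAt ℝ a (H y₀) := hα.differentiableAt (by simp)
  -- The second derivative of the map is symmetric and cancels on skew-symmetrization, which is why
  -- `d` commutes with pullback.
  have hsymm : ∀ v w, fderiv ℝ (fderiv ℝ H) y₀ v w = fderiv ℝ (fderiv ℝ H) y₀ w v :=
    fun v w => (hH.isSymmSndFDerivAt (by simpa using ENat.LEInfty.out)) v w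
  have hcomp : fderiv ℝ (fun y => a (H y)) y₀ = (fderiv ℝ a (H y₀)).comp (fderiv ℝ H y₀) :=
    fderiv_comp y₀ ha hH1
  have hval : ∀ v w, fderiv ℝ (α.pullE G) y₀ v w =
      fderiv ℝ a (H y₀) (fderiv ℝ H y₀ v) (fderiv ℝ H y₀ w) +
        a (H y₀) (fderiv ℝ (fderiv ℝ H) y₀ v w) := by
    intro v w
    rw [(α.pullE_eventuallyEq hG).fderiv_eq]
    have := fderiv_clm_comp (c := fun y => a (H y)) (ha.comp y₀ hH1) hH2
    erw [this]
    simp [hcomp, add_comm]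
  have hDH : ∀ v, fderiv ℝ H y₀ v = mfderiv 𝓘(ℝ, E) (𝓡 N) G y₀ v := by
    intro v
    rw [← mfderiv_eq_fderiv]
    have h := congrArg (fun L => L v) (mfderiv_comp y₀
      (mdifferentiableAt_extChartAt (I := 𝓡 N) (mem_chart_source _ (G y₀)))
      (hG.mdifferentiableAt (by simp)))
    rw [mfderiv_extChartAt_self] at h
    exact h
  rw [hval, hval, hsymm v w, hDH, hDH, d_eq hα]
  ring_nf
  rfl

end OneForm

/-! ### Pullback of 1-forms between manifolds -/

namespace OneForm

variable {N N' : ℕ} {X : Type*} [TopologicalSpace X] [ChartedSpace (EuclideanSpace ℝ (Fin N)) X]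
  {Y : Type*} [TopologicalSpace Y] [ChartedSpace (EuclideanSpace ℝ (Fin N')) Y]

/-- The pullback of a 1-form by a map of manifolds. -/
noncomputable def pullback (α : OneForm N X) (σ : Y → X) : OneForm N' Y :=
  fun y => (α (σ y)).comp (mfderiv (𝓡 N') (𝓡 N) σ y)

variable [IsManifold (𝓡 N) ∞ X] [IsManifold (𝓡 N') ∞ Y]

theorem inChart_pullback_eventuallyEq (α : OneForm N X) {σ : Y → X} {y : Y}
    (hσ : ContMDiffAt (𝓡 N') (𝓡 N) ∞ σ y) :
    (α.pullback σ).inChart y =ᶠ[nhds (extChartAt (𝓡 N') y y)]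
      α.pullE (σ ∘ (extChartAt (𝓡 N') y).symm) := by
  have h1 : ∀ᶠ y' in nhds y, ContMDiffAt (𝓡 N') (𝓡 N) 1 σ y' :=
    (contMDiffAt_iff_contMDiffAt_nhds (by simp)).1 (hσ.of_le (by simp : (1 : WithTop ℕ∞) ≤ ∞))
  have hc := (continuousAt_extChartAt_symm (I := 𝓡 N') y)
  rw [ContinuousAt, extChartAt_to_inv] at hc
  filter_upwards [hc.eventually h1,
    extChartAt_target_mem_nhds_self y (mem_extChartAt_target (I := 𝓡 N') y)] with z hz ht
  have := mfderiv_comp z (hz.mdifferentiableAt one_ne_zero) (mdifferentiableAt_extChartAt_symm ht)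
  ext v
  rw [pullE_apply, this]
  rfl

omit [IsManifold (𝓡 N) ∞ X] in
theorem contMDiffAt_comp_extChartAt_symm {σ : Y → X} {y : Y}
    (hσ : ContMDiffAt (𝓡 N') (𝓡 N) ∞ σ y) :
    ContMDiffAt 𝓘(ℝ, EuclideanSpace ℝ (Fin N')) (𝓡 N) ∞ (σ ∘ (extChartAt (𝓡 N') y).symm)
      (extChartAt (𝓡 N') y y) :=
  ContMDiffAt.comp_of_eq hσ (contMDiffAt_extChartAt_symm (mem_extChartAt_target y))
    (extChartAt_to_inv (I := 𝓡 N') y)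

omit [IsManifold (𝓡 N) ∞ X] in
theorem SmoothAt.congr_point {α : OneForm N X} {x x' : X} (h : α.SmoothAt x) (hx : x' = x) :
    α.SmoothAt x' := hx ▸ h

theorem smoothAt_pullback {α : OneForm N X} {σ : Y → X} {y : Y}
    (hσ : ContMDiffAt (𝓡 N') (𝓡 N) ∞ σ y) (hα : α.SmoothAt (σ y)) :
    (α.pullback σ : OneForm N' Y).SmoothAt y :=
  (contDiffAt_pullE (contMDiffAt_comp_extChartAt_symm hσ)
    (hα.congr_point (by simp))).congr_of_eventuallyEq (α.inChart_pullback_eventuallyEq hσ)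

omit [IsManifold (𝓡 N) ∞ X] in
theorem d_congr (α : OneForm N X) {x x' : X} (hx : x' = x)
    {v w v' w' : EuclideanSpace ℝ (Fin N)} (hv : v' = v) (hw : w' = w) :
    α.d x' v' w' = α.d x v w := by subst hx hv hw; rfl

theorem d_pullback {α : OneForm N X} {σ : Y → X} {y : Y}
    (hσ : ContMDiffAt (𝓡 N') (𝓡 N) ∞ σ y) (hα : α.SmoothAt (σ y))
    (v w : TangentSpace (𝓡 N') y) :
    (α.pullback σ).d y v w =
      α.d (σ y) (mfderiv (𝓡 N') (𝓡 N) σ y v) (mfderiv (𝓡 N') (𝓡 N) σ y w) := by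
  rw [d_eq (smoothAt_pullback hσ hα), (α.inChart_pullback_eventuallyEq hσ).fderiv_eq]
  refine (d_pullE (contMDiffAt_comp_extChartAt_symm hσ) (hα.congr_point (by simp)) v w).trans ?_
  have key : ∀ v : EuclideanSpace ℝ (Fin N'),
      mfderiv 𝓘(ℝ, EuclideanSpace ℝ (Fin N')) (𝓡 N) (σ ∘ (extChartAt (𝓡 N') y).symm)
        (extChartAt (𝓡 N') y y) v = mfderiv (𝓡 N') (𝓡 N) σ y v := by
    intro v
    have h := congrArg (fun L => L v) (mfderiv_comp_of_eq (x := extChartAt (𝓡 N') y y)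
      (hσ.mdifferentiableAt (by simp)) (mdifferentiableAt_extChartAt_symm
        (mem_extChartAt_target (I := 𝓡 N') y)) (extChartAt_to_inv (I := 𝓡 N') y))
    refine h.trans ?_
    let D (z : Y) : EuclideanSpace ℝ (Fin N') →L[ℝ] EuclideanSpace ℝ (Fin N) :=
      mfderiv (𝓡 N') (𝓡 N) σ z
    exact (congrArg (D _) (mfderiv_extChartAt_symm_self y v)).trans
      (congrArg (fun z => D z v) (extChartAt_to_inv (I := 𝓡 N') y))
  exact α.d_congr (by simp) (key v) (key w)

end OneForm

/-! ### Pullback of the Finsler structure equations -/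

namespace FinslerForms

variable {n N N' : ℕ} {X : Type*} [TopologicalSpace X] [ChartedSpace (EuclideanSpace ℝ (Fin N)) X]
  {Y : Type*} [TopologicalSpace Y] [ChartedSpace (EuclideanSpace ℝ (Fin N')) Y]

/-- The pullback of the forms and functions in `f` by a map of manifolds. -/
noncomputable def pullback (f : FinslerForms n N X) (σ : Y → X) : FinslerForms n N' Y where
  omega a := (f.omega a).pullback σ
  theta i := (f.theta i).pullback σ
  conn i j := (f.conn i j).pullback σ
  tor i j k := f.tor i j k ∘ σ

/-- A relation among the restricted functionals lifts to all of `E`, since the `l i` cannot tell a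
vector of `E` from a suitable one in the range of `R`. -/
theorem linearIndependent_comp_of_range_sup_ker {E E' ι : Type*} [AddCommGroup E] [Module ℝ E]
    [AddCommGroup E'] [Module ℝ E'] [TopologicalSpace E] [TopologicalSpace E']
    {l : ι → E →L[ℝ] ℝ} (hl : LinearIndependent ℝ l) (R : E' →L[ℝ] E)
    (hR : ∀ v : E, ∃ w, ∀ i, l i v = l i (R w)) :
    LinearIndependent ℝ (fun i => (l i).comp R) := by
  rw [linearIndependent_iff'] at hl ⊢
  intro s c hc
  refine hl s c ?_
  ext v
  obtain ⟨w, hw⟩ := hR v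
  have := congrArg (fun L => L w) hc
  simpa [hw] using this

variable [IsManifold (𝓡 N) ∞ X] [IsManifold (𝓡 N') ∞ Y]

/-- All conditions but linear independence are natural under pullback. Independence comes from
`hspan`: the image of `dσ` and the common kernel of the coframe span the tangent space. -/
theorem IsFinslerOn.pullback {f : FinslerForms n N X} {W : Set X} (hf : f.IsFinslerOn W)
    (hW : IsOpen W) {σ : Y → X} {U : Set Y} (hU : IsOpen U)
    (hσ : ContMDiffOn (𝓡 N') (𝓡 N) ∞ σ U) (hmaps : Set.MapsTo σ U W)
    (hspan : ∀ y ∈ U, ∀ v : TangentSpace (𝓡 N) (σ y), ∃ w : TangentSpace (𝓡 N') y,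
      (∀ a, f.omega a (σ y) v = f.omega a (σ y) (mfderiv (𝓡 N') (𝓡 N) σ y w)) ∧
      ∀ i, f.theta i (σ y) v = f.theta i (σ y) (mfderiv (𝓡 N') (𝓡 N) σ y w)) :
    (f.pullback σ : FinslerForms n N' Y).IsFinslerOn U := by
  have hσ' : ∀ y ∈ U, ContMDiffAt (𝓡 N') (𝓡 N) ∞ σ y := fun y hy => hσ.contMDiffAt (hU.mem_nhds hy)
  have hsm : ∀ α : OneForm N X, α.SmoothOn W → (α.pullback σ : OneForm N' Y).SmoothOn U := by
    intro α hα
    rw [OneForm.smoothOn_iff hU]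
    rw [OneForm.smoothOn_iff hW] at hα
    exact fun y hy => OneForm.smoothAt_pullback (hσ' y hy) (hα _ (hmaps hy))
  refine ⟨fun a => hsm _ (hf.smooth_omega a), fun i => hsm _ (hf.smooth_theta i),
    fun i j => hsm _ (hf.smooth_conn i j), fun i j k => (hf.smooth_tor i j k).comp hσ hmaps,
    ?_, ?_, ?_, ?_⟩
  · intro y hy
    have h := linearIndependent_comp_of_range_sup_ker (hf.linearIndependent _ (hmaps hy))
      (mfderiv (𝓡 N') (𝓡 N) σ y) (by
        intro v
        obtain ⟨w, h1, h2⟩ := hspan y hy v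
        exact ⟨w, by rintro (a | i); exacts [h1 a, h2 i]⟩)
    convert h using 1
    ext (a | i) <;> rfl
  · intro y hy i j
    change ((f.conn i j (σ y)).comp _) = -((f.conn j i (σ y)).comp _)
    rw [hf.conn_skew _ (hmaps hy) i j]
    rfl
  · exact fun y hy i j k => hf.tor_symm _ (hmaps hy) i j k
  · intro y hy
    have hom : ∀ a, (f.omega a).SmoothAt (σ y) := fun a =>
      (OneForm.smoothOn_iff hW).1 (hf.smooth_omega a) _ (hmaps hy)
    obtain ⟨h1, h2⟩ := hf.structureEquations _ (hmaps hy)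
    refine ⟨fun v w => ?_, fun i v w => ?_⟩
    · exact (OneForm.d_pullback (hσ' y hy) (hom 0) v w).trans (h1 _ _)
    · exact (OneForm.d_pullback (hσ' y hy) (hom i.succ) v w).trans (h2 i _ _)

end FinslerForms

/-! ### Submersions: normal form and local sections -/

section Submersions

variable {N K : ℕ} {X : Type*} [TopologicalSpace X] [ChartedSpace (EuclideanSpace ℝ (Fin N)) X]
  {S : Type*} [TopologicalSpace S] [ChartedSpace (EuclideanSpace ℝ (Fin K)) S]

/-- Charts in which the map `ψ` becomes the projection `(a, b) ↦ a`. -/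
structure SubmersionCharts (ψ : X → S) (F : Type) [NormedAddCommGroup F] [NormedSpace ℝ F] where
  dom : OpenPartialHomeomorph X (EuclideanSpace ℝ (Fin K) × F)
  cod : OpenPartialHomeomorph S (EuclideanSpace ℝ (Fin K))
  dom_smooth : ContMDiffOn (𝓡 N) 𝓘(ℝ, EuclideanSpace ℝ (Fin K) × F) ∞ dom dom.source
  dom_symm_smooth : ContMDiffOn 𝓘(ℝ, EuclideanSpace ℝ (Fin K) × F) (𝓡 N) ∞ dom.symm dom.target
  cod_smooth : ContMDiffOn (𝓡 K) 𝓘(ℝ, EuclideanSpace ℝ (Fin K)) ∞ cod cod.source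
  cod_symm_smooth : ContMDiffOn 𝓘(ℝ, EuclideanSpace ℝ (Fin K)) (𝓡 K) ∞ cod.symm cod.target
  mapsTo : ∀ x ∈ dom.source, ψ x ∈ cod.source
  cod_apply : ∀ x ∈ dom.source, cod (ψ x) = (dom x).1

theorem Manifold.IsSubmersion.exists_submersionCharts {ψ : X → S}
    (hψ : Manifold.IsSubmersion (𝓡 N) (𝓡 K) ∞ ψ) (x₀ : X) :
    ∃ (F : Type) (_ : NormedAddCommGroup F) (_ : NormedSpace ℝ F)
      (c : SubmersionCharts (N := N) (K := K) ψ F), x₀ ∈ c.dom.source := by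
  obtain ⟨F, hF1, hF2, h⟩ := hψ
  have hx := h x₀
  refine ⟨F, hF1, hF2, ⟨hx.domChart.transHomeomorph hx.equiv.toHomeomorph, hx.codChart,
    ?_, ?_, ?_, ?_, ?_, ?_⟩, ?_⟩
  · have h1 := contMDiffOn_of_mem_maximalAtlas hx.domChart_mem_maximalAtlas
    exact (hx.equiv.contDiff (n := ∞)).contMDiff.comp_contMDiffOn h1
  · have h1 := contMDiffOn_symm_of_mem_maximalAtlas hx.domChart_mem_maximalAtlas
    exact h1.comp (hx.equiv.symm.contDiff (n := ∞)).contMDiff.contMDiffOn (fun y hy => hy)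
  · exact contMDiffOn_of_mem_maximalAtlas hx.codChart_mem_maximalAtlas
  · exact contMDiffOn_symm_of_mem_maximalAtlas hx.codChart_mem_maximalAtlas
  · exact fun x hx' => hx.source_subset_preimage_source hx'
  · intro x hx'
    change x ∈ hx.domChart.source at hx'
    have ht : hx.domChart x ∈ (hx.domChart.extend (𝓡 N)).target := by
      simpa using hx.domChart.map_source hx'
    have hw := hx.writtenInCharts ht
    simp only [Function.comp_apply, OpenPartialHomeomorph.extend_coe,
      OpenPartialHomeomorph.extend_coe_symm, modelWithCornersSelf_coe_symm,
      modelWithCornersSelf_coe, id, hx.domChart.left_inv hx'] at hw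
    exact hw
  · exact hx.mem_domChart_source

namespace SubmersionCharts

variable {ψ : X → S} {F : Type} [NormedAddCommGroup F] [NormedSpace ℝ F]
  (c : SubmersionCharts (N := N) (K := K) ψ F)

theorem contMDiffAt_dom_symm {y : EuclideanSpace ℝ (Fin K) × F} (hy : y ∈ c.dom.target) :
    ContMDiffAt 𝓘(ℝ, EuclideanSpace ℝ (Fin K) × F) (𝓡 N) ∞ c.dom.symm y :=
  c.dom_symm_smooth.contMDiffAt (c.dom.open_target.mem_nhds hy)

theorem map_symm {y : EuclideanSpace ℝ (Fin K) × F} (hy : y ∈ c.dom.target) :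
    y.1 ∈ c.cod.target ∧ ψ (c.dom.symm y) = c.cod.symm y.1 := by
  have h1 := c.dom.map_target hy
  have h2 := c.mapsTo _ h1
  have h3 := c.cod_apply _ h1
  rw [c.dom.right_inv hy] at h3
  rw [← h3]
  exact ⟨c.cod.map_source h2, (c.cod.left_inv h2).symm⟩

theorem mfderiv_symm (hψ : ContMDiff (𝓡 N) (𝓡 K) ∞ ψ)
    {y : EuclideanSpace ℝ (Fin K) × F} (hy : y ∈ c.dom.target)
    (v : EuclideanSpace ℝ (Fin K) × F) :
    mfderiv (𝓡 N) (𝓡 K) ψ (c.dom.symm y)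
      (mfderiv 𝓘(ℝ, EuclideanSpace ℝ (Fin K) × F) (𝓡 N) c.dom.symm y v) =
    mfderiv 𝓘(ℝ, EuclideanSpace ℝ (Fin K)) (𝓡 K) c.cod.symm y.1 v.1 := by
  have h1 := mfderiv_comp y ((hψ _).mdifferentiableAt (by simp))
    ((c.contMDiffAt_dom_symm hy).mdifferentiableAt (by simp))
  have hcod : MDifferentiableAt 𝓘(ℝ, EuclideanSpace ℝ (Fin K)) (𝓡 K) c.cod.symm y.1 :=
    (c.cod_symm_smooth.contMDiffAt
      (c.cod.open_target.mem_nhds (c.map_symm hy).1)).mdifferentiableAt (by simp)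
  have h2 : HasMFDerivAt 𝓘(ℝ, EuclideanSpace ℝ (Fin K) × F) 𝓘(ℝ, EuclideanSpace ℝ (Fin K))
      (Prod.fst : EuclideanSpace ℝ (Fin K) × F → _) y
      (ContinuousLinearMap.fst ℝ (EuclideanSpace ℝ (Fin K)) F) :=
    hasFDerivAt_fst.hasMFDerivAt
  have h3 := (hcod.hasMFDerivAt.comp y h2).mfderiv
  have he : ψ ∘ c.dom.symm =ᶠ[nhds y] c.cod.symm ∘ Prod.fst := by
    filter_upwards [c.dom.open_target.mem_nhds hy] with z hz
    exact (c.map_symm hz).2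
  have h4 := he.mfderiv_eq (I := 𝓘(ℝ, EuclideanSpace ℝ (Fin K) × F)) (I' := 𝓡 K)
  let T (L : EuclideanSpace ℝ (Fin K) × F →L[ℝ] EuclideanSpace ℝ (Fin K)) := L v
  exact (congrArg T h1).symm.trans ((congrArg T h4).trans (congrArg T h3))

theorem mfderiv_symm_surjective {y : EuclideanSpace ℝ (Fin K) × F} (hy : y ∈ c.dom.target) :
    Function.Surjective
      (mfderiv 𝓘(ℝ, EuclideanSpace ℝ (Fin K) × F) (𝓡 N) c.dom.symm y) := by
  have h : c.dom.MDifferentiable (𝓡 N) 𝓘(ℝ, EuclideanSpace ℝ (Fin K) × F) :=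
    ⟨c.dom_smooth.mdifferentiableOn (by simp), c.dom_symm_smooth.mdifferentiableOn (by simp)⟩
  exact h.symm.mfderiv_surjective hy

theorem mfderiv_cod_symm_surjective {a : EuclideanSpace ℝ (Fin K)} (ha : a ∈ c.cod.target) :
    Function.Surjective (mfderiv 𝓘(ℝ, EuclideanSpace ℝ (Fin K)) (𝓡 K) c.cod.symm a) := by
  have h : c.cod.MDifferentiable (𝓡 K) 𝓘(ℝ, EuclideanSpace ℝ (Fin K)) :=
    ⟨c.cod_smooth.mdifferentiableOn (by simp), c.cod_symm_smooth.mdifferentiableOn (by simp)⟩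
  exact h.symm.mfderiv_surjective ha

end SubmersionCharts

theorem exists_clm_apply_eq {E F : Type*} [NormedAddCommGroup E] [NormedSpace ℝ E]
    [NormedAddCommGroup F] [NormedSpace ℝ F] {a : E} (ha : a ≠ 0) (b : F) :
    ∃ A : E →L[ℝ] F, A a = b := by
  obtain ⟨f, hf⟩ := SeparatingDual.exists_eq_one (R := ℝ) ha
  exact ⟨f.smulRight b, by simp [hf]⟩

/-- A submersion has smooth local sections through every point, tangent to any given vector that
is not vertical. -/
theorem Manifold.IsSubmersion.exists_section {ψ : X → S}
    (hψ : Manifold.IsSubmersion (𝓡 N) (𝓡 K) ∞ ψ) (x₀ : X) (v : TangentSpace (𝓡 N) x₀) :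
    ∃ (U : Set S) (σ : S → X), IsOpen U ∧ ψ x₀ ∈ U ∧ ContMDiffOn (𝓡 K) (𝓡 N) ∞ σ U ∧
      σ (ψ x₀) = x₀ ∧ (∀ s ∈ U, ψ (σ s) = s) ∧
      (mfderiv (𝓡 N) (𝓡 K) ψ x₀ v ≠ 0 →
        mfderiv (𝓡 K) (𝓡 N) σ (ψ x₀) (mfderiv (𝓡 N) (𝓡 K) ψ x₀ v) =
          (v : EuclideanSpace ℝ (Fin N))) := by
  obtain ⟨F, _, _, c, hx₀⟩ := hψ.exists_submersionCharts x₀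
  have hψs := hψ.contMDiff
  set y₀ := c.dom x₀ with hy₀
  have hy₀t : y₀ ∈ c.dom.target := c.dom.map_source hx₀
  have hxy : c.dom.symm y₀ = x₀ := c.dom.left_inv hx₀
  obtain ⟨w, hw⟩ : ∃ w : EuclideanSpace ℝ (Fin K) × F,
      mfderiv 𝓘(ℝ, EuclideanSpace ℝ (Fin K) × F) (𝓡 N) c.dom.symm y₀ w =
        (v : EuclideanSpace ℝ (Fin N)) := c.mfderiv_symm_surjective hy₀t v
  -- The section will be the graph of `a ↦ y₀.2 + A (a - y₀.1)`. Tangency to `w` means `A w.1 =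
  -- w.2`, which is solvable when `w.1 ≠ 0`, that is, when `v` is not vertical.
  obtain ⟨A, hA⟩ : ∃ A : EuclideanSpace ℝ (Fin K) →L[ℝ] F, w.1 ≠ 0 → A w.1 = w.2 := by
    by_cases h : w.1 = 0
    · exact ⟨0, fun h' => absurd h h'⟩
    · obtain ⟨A, hA⟩ := exists_clm_apply_eq h w.2
      exact ⟨A, fun _ => hA⟩
  let B : EuclideanSpace ℝ (Fin K) → EuclideanSpace ℝ (Fin K) × F :=
    fun a => (a, y₀.2 + A (a - y₀.1))
  have hB : ContDiff ℝ ∞ B := by fun_prop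
  have hκ : c.cod (ψ x₀) = y₀.1 := c.cod_apply _ hx₀
  have hBy : B (c.cod (ψ x₀)) = y₀ := by simp [B, hκ]
  let U : Set S := c.cod.source ∩ c.cod ⁻¹' (B ⁻¹' c.dom.target)
  have hUo : IsOpen U := c.cod.isOpen_inter_preimage (c.dom.open_target.preimage hB.continuous)
  have hxU : ψ x₀ ∈ U := ⟨c.mapsTo _ hx₀, by simpa [hBy] using hy₀t⟩
  have hsec : ∀ s ∈ U, ψ (c.dom.symm (B (c.cod s))) = s := by
    intro s hs
    rw [(c.map_symm hs.2).2]
    exact c.cod.left_inv hs.1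
  refine ⟨U, fun s => c.dom.symm (B (c.cod s)), hUo, hxU, ?_, ?_, hsec, ?_⟩
  · exact c.dom_symm_smooth.comp (hB.contMDiff.comp_contMDiffOn
      (c.cod_smooth.mono Set.inter_subset_left)) (fun s hs => hs.2)
  · simp only [hBy, hxy]
  · intro hv
    set σ : S → X := fun s => c.dom.symm (B (c.cod s)) with hσdef
    have hσ : ContMDiffOn (𝓡 K) (𝓡 N) ∞ σ U := c.dom_symm_smooth.comp
      (hB.contMDiff.comp_contMDiffOn (c.cod_smooth.mono Set.inter_subset_left)) (fun s hs => hs.2)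
    let Dσ (s : S) : EuclideanSpace ℝ (Fin K) →L[ℝ] EuclideanSpace ℝ (Fin N) :=
      mfderiv (𝓡 K) (𝓡 N) σ s
    let Dψ (x : X) : EuclideanSpace ℝ (Fin N) →L[ℝ] EuclideanSpace ℝ (Fin K) :=
      mfderiv (𝓡 N) (𝓡 K) ψ x
    let Dκ : EuclideanSpace ℝ (Fin K) →L[ℝ] EuclideanSpace ℝ (Fin K) :=
      mfderiv 𝓘(ℝ, EuclideanSpace ℝ (Fin K)) (𝓡 K) c.cod.symm y₀.1
    let DG (y : EuclideanSpace ℝ (Fin K) × F) :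
        EuclideanSpace ℝ (Fin K) × F →L[ℝ] EuclideanSpace ℝ (Fin N) :=
      mfderiv 𝓘(ℝ, EuclideanSpace ℝ (Fin K) × F) (𝓡 N) c.dom.symm y
    have h1 : Dψ x₀ v = Dκ w.1 := by
      have h := c.mfderiv_symm hψs hy₀t w
      have h' : Dψ (c.dom.symm y₀) (DG y₀ w) = Dκ w.1 := h
      rwa [hxy, show DG y₀ w = v from hw] at h'
    have hw0 : w.1 ≠ 0 := by
      intro h0
      apply hv
      change Dψ x₀ v = 0
      rw [h1, h0, map_zero]
    have hκs : c.cod.symm y₀.1 = ψ x₀ := by rw [← hκ, c.cod.left_inv (c.mapsTo _ hx₀)]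
    have hyt : y₀.1 ∈ c.cod.target := (c.map_symm hy₀t).1
    have hBy₀ : B y₀.1 = y₀ := by simp [B]
    have hdB : HasFDerivAt B ((ContinuousLinearMap.id ℝ _).prod A) y₀.1 := by
      refine HasFDerivAt.prodMk (hasFDerivAt_id _) ?_
      exact (A.hasFDerivAt.comp y₀.1 ((hasFDerivAt_id _).sub_const y₀.1)).const_add y₀.2
    have e1 : mfderiv 𝓘(ℝ, EuclideanSpace ℝ (Fin K)) (𝓡 N) (σ ∘ c.cod.symm) y₀.1 =
        (Dσ (c.cod.symm y₀.1)).comp Dκ :=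
      mfderiv_comp_of_eq (x := y₀.1) ((hσ.contMDiffAt (hUo.mem_nhds hxU)).mdifferentiableAt
        (by simp)) ((c.cod_symm_smooth.contMDiffAt (c.cod.open_target.mem_nhds hyt)).mdifferentiableAt
        (by simp)) hκs
    have e2 : mfderiv 𝓘(ℝ, EuclideanSpace ℝ (Fin K)) (𝓡 N) (c.dom.symm ∘ B) y₀.1 =
        (DG (B y₀.1)).comp ((ContinuousLinearMap.id ℝ _).prod A) :=
      (HasMFDerivAt.comp y₀.1 (((c.contMDiffAt_dom_symm (by rwa [hBy₀])).mdifferentiableAt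
        (by simp)).hasMFDerivAt) hdB.hasMFDerivAt).mfderiv
    have e3 : σ ∘ c.cod.symm =ᶠ[nhds y₀.1] c.dom.symm ∘ B := by
      filter_upwards [c.cod.open_target.mem_nhds hyt] with a ha
      simp [σ, c.cod.right_inv ha]
    have e4 := e3.mfderiv_eq (I := 𝓘(ℝ, EuclideanSpace ℝ (Fin K))) (I' := 𝓡 N)
    have e5 : (Dσ (c.cod.symm y₀.1)).comp Dκ =
      (DG (B y₀.1)).comp ((ContinuousLinearMap.id ℝ _).prod A) := e1.symm.trans (e4.trans e2)
    have e6 := congrArg (fun L => L w.1) e5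
    simp only [ContinuousLinearMap.comp_apply, hκs, hBy₀, ContinuousLinearMap.prod_apply,
      ContinuousLinearMap.id_apply, hA hw0] at e6
    change Dσ (ψ x₀) (Dψ x₀ v) = v
    rw [h1, e6]
    exact hw

theorem mfderiv_apply_mfderiv_section {ψ : X → S} (hψ : ContMDiff (𝓡 N) (𝓡 K) ∞ ψ)
    {U : Set S} {σ : S → X} (hU : IsOpen U) (hσ : ContMDiffOn (𝓡 K) (𝓡 N) ∞ σ U)
    (hsec : ∀ s ∈ U, ψ (σ s) = s) {s : S} (hs : s ∈ U) (w : TangentSpace (𝓡 K) s) :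
    mfderiv (𝓡 N) (𝓡 K) ψ (σ s) (mfderiv (𝓡 K) (𝓡 N) σ s w) = (w : EuclideanSpace ℝ (Fin K)) := by
  have h1 := mfderiv_comp s ((hψ _).mdifferentiableAt (by simp))
    ((hσ.contMDiffAt (hU.mem_nhds hs)).mdifferentiableAt (by simp))
  have he : ψ ∘ σ =ᶠ[nhds s] id := by
    filter_upwards [hU.mem_nhds hs] with z hz using hsec z hz
  have h4 := he.mfderiv_eq (I := 𝓡 K) (I' := 𝓡 K)
  rw [mfderiv_id] at h4
  let T (L : EuclideanSpace ℝ (Fin K) →L[ℝ] EuclideanSpace ℝ (Fin K)) :=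
    L (w : EuclideanSpace ℝ (Fin K))
  exact (congrArg T h1).symm.trans (congrArg T h4)

/-- The differential of a local section is a right inverse. -/
theorem Manifold.IsSubmersion.mfderiv_surjective {ψ : X → S}
    (hψ : Manifold.IsSubmersion (𝓡 N) (𝓡 K) ∞ ψ) (x : X) :
    Function.Surjective (mfderiv (𝓡 N) (𝓡 K) ψ x) := by
  intro w
  obtain ⟨U, σ, hU, hx, hσ, hσx, hsec, -⟩ := hψ.exists_section x 0
  have h := mfderiv_apply_mfderiv_section hψ.contMDiff hU hσ hsec hx w
  let Dψ (x : X) : EuclideanSpace ℝ (Fin N) →L[ℝ] EuclideanSpace ℝ (Fin K) :=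
    mfderiv (𝓡 N) (𝓡 K) ψ x
  let u : EuclideanSpace ℝ (Fin N) := mfderiv (𝓡 K) (𝓡 N) σ (ψ x) w
  exact ⟨u, (congrArg (fun z => Dψ z u) hσx).symm.trans h⟩

end Submersions

/-! ### Constancy along the fibers of a submersion -/

section FiberConstancy

variable {n N K : ℕ} {X : Type*} [TopologicalSpace X] [ChartedSpace (EuclideanSpace ℝ (Fin N)) X]
  {S : Type*} [TopologicalSpace S] [ChartedSpace (EuclideanSpace ℝ (Fin K)) S]

/-- Near a point, the points of its `ψ`-fiber are joined to it by coordinate segments. -/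
theorem SubmersionCharts.eventually_segment {ψ : X → S} {F : Type} [NormedAddCommGroup F]
    [NormedSpace ℝ F] (c : SubmersionCharts (N := N) (K := K) ψ F) {x₀ : X}
    (hx₀ : x₀ ∈ c.dom.source) {O : Set X} (hO : O ∈ nhds x₀) :
    ∀ᶠ x in nhds x₀, ψ x = ψ x₀ → ∃ b : F,
      c.dom.symm (c.dom x₀ + (1 : ℝ) • ((0 : EuclideanSpace ℝ (Fin K)), b)) = x ∧
      ∀ t ∈ Set.Icc (0 : ℝ) 1, c.dom x₀ + t • ((0 : EuclideanSpace ℝ (Fin K)), b) ∈ c.dom.target ∧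
        c.dom.symm (c.dom x₀ + t • ((0 : EuclideanSpace ℝ (Fin K)), b)) ∈ O := by
  have h1 : c.dom.target ∩ c.dom.symm ⁻¹' O ∈ nhds (c.dom x₀) := by
    refine Filter.inter_mem (c.dom.open_target.mem_nhds (c.dom.map_source hx₀)) ?_
    refine c.dom.symm.continuousAt (c.dom.map_source hx₀) ?_
    rwa [c.dom.left_inv hx₀]
  obtain ⟨ε, hε, hball⟩ := Metric.mem_nhds_iff.1 h1
  have h2 : ∀ᶠ x in nhds x₀, c.dom x ∈ Metric.ball (c.dom x₀) ε :=
    (c.dom.continuousAt hx₀).eventually (Metric.ball_mem_nhds _ hε)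
  filter_upwards [h2, c.dom.open_source.mem_nhds hx₀] with x hx hxs hψ
  have hfst : (c.dom x).1 = (c.dom x₀).1 := by
    rw [← c.cod_apply _ hxs, ← c.cod_apply _ hx₀, hψ]
  have hsub : ((0 : EuclideanSpace ℝ (Fin K)), (c.dom x).2 - (c.dom x₀).2) =
      c.dom x - c.dom x₀ := by
    ext1 <;> simp [hfst]
  refine ⟨(c.dom x).2 - (c.dom x₀).2, ?_, fun t ht => ?_⟩
  · rw [hsub, one_smul, add_sub_cancel, c.dom.left_inv hxs]
  · rw [hsub]
    exact hball ((convex_ball _ ε).add_smul_sub_mem (Metric.mem_ball_self hε) hx ht)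

theorem hasDerivAt_add_smul {V : Type*} [NormedAddCommGroup V] [NormedSpace ℝ V] (y w : V) (t : ℝ) :
    HasDerivAt (fun t : ℝ => y + t • w) w t := by
  simpa using ((hasDerivAt_id t).smul_const w).const_add y

theorem eq_of_hasDerivAt_zero_on_Icc {V : Type*} [NormedAddCommGroup V] [NormedSpace ℝ V]
    {h : ℝ → V} (hd : ∀ t ∈ Set.Icc (0 : ℝ) 1, HasDerivAt h 0 t) : h 1 = h 0 :=
  constant_of_has_deriv_right_zero (fun t ht => (hd t ht).continuousAt.continuousWithinAt)
    (fun t ht => (hd t (Set.Ico_subset_Icc_self ht)).hasDerivWithinAt) 1 (by simp)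

/-- A map whose differential kills the vertical vectors of a submersion is locally constant on its
fibers. -/
theorem Manifold.IsSubmersion.eventually_eq_of_ker_le {P : ℕ} {M : Type*} [TopologicalSpace M]
    [ChartedSpace (EuclideanSpace ℝ (Fin P)) M] [IsManifold (𝓡 P) ∞ M] {ψ : X → S}
    (hψ : Manifold.IsSubmersion (𝓡 N) (𝓡 K) ∞ ψ) {τ : X → M} (hτ : ContMDiff (𝓡 N) (𝓡 P) ∞ τ)
    (hker : ∀ (x : X) (v : TangentSpace (𝓡 N) x),
      mfderiv (𝓡 N) (𝓡 K) ψ x v = 0 → mfderiv (𝓡 N) (𝓡 P) τ x v = 0) (x₀ : X) :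
    ∀ᶠ x in nhds x₀, ψ x = ψ x₀ → τ x = τ x₀ := by
  obtain ⟨F, _, _, c, hx₀⟩ := hψ.exists_submersionCharts x₀
  have hO : τ ⁻¹' (extChartAt (𝓡 P) (τ x₀)).source ∈ nhds x₀ :=
    hτ.continuous.continuousAt (extChartAt_source_mem_nhds _)
  filter_upwards [c.eventually_segment hx₀ hO] with x hx hψx
  obtain ⟨b, rfl, hseg⟩ := hx hψx
  have hconst := eq_of_hasDerivAt_zero_on_Icc (h := fun t : ℝ => extChartAt (𝓡 P) (τ x₀)
    (τ (c.dom.symm (c.dom x₀ + t • ((0 : EuclideanSpace ℝ (Fin K)), b))))) (by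
    intro t ht
    obtain ⟨h1, h2⟩ := hseg t ht
    set y := c.dom x₀ + t • ((0 : EuclideanSpace ℝ (Fin K)), b) with hy
    have hγ : HasDerivAt (fun t : ℝ => c.dom x₀ + t • ((0 : EuclideanSpace ℝ (Fin K)), b))
        ((0 : EuclideanSpace ℝ (Fin K)), b) t := by
      exact hasDerivAt_add_smul _ _ t
    -- The segment stays in one fiber of `ψ`, so its velocity is vertical and is killed by `dτ`.
    have hv : mfderiv (𝓡 N) (𝓡 P) τ (c.dom.symm y) (mfderiv 𝓘(ℝ, EuclideanSpace ℝ (Fin K) × F)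
        (𝓡 N) c.dom.symm y ((0 : EuclideanSpace ℝ (Fin K)), b)) = 0 := by
      apply hker
      rw [c.mfderiv_symm hψ.contMDiff h1]
      exact map_zero _
    have h2' : τ (c.dom.symm y) ∈ (chartAt (EuclideanSpace ℝ (Fin P)) (τ x₀)).source := by
      simpa using h2
    have hm := HasMFDerivAt.comp y (mdifferentiableAt_extChartAt (I := 𝓡 P) h2').hasMFDerivAt
      (HasMFDerivAt.comp y ((hτ _).mdifferentiableAt (by simp)).hasMFDerivAt
        ((c.contMDiffAt_dom_symm h1).mdifferentiableAt (by simp)).hasMFDerivAt)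
    have hf := (hasMFDerivAt_iff_hasFDerivAt.1 hm).comp_hasDerivAt t hγ
    refine HasDerivAt.congr_deriv hf ?_
    let D : EuclideanSpace ℝ (Fin P) →L[ℝ] EuclideanSpace ℝ (Fin P) :=
      mfderiv (𝓡 P) 𝓘(ℝ, EuclideanSpace ℝ (Fin P)) (extChartAt (𝓡 P) (τ x₀)) (τ (c.dom.symm y))
    exact (congrArg D hv).trans (map_zero D))
  have h0 := (hseg 0 (by simp)).2
  have h1 := (hseg 1 (by simp)).2
  have he := (extChartAt (𝓡 P) (τ x₀)).injOn h1 h0 hconst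
  simpa [c.dom.left_inv hx₀] using he

/-- The infinitesimal form of the fact that rotations preserve sums of squares, applied below to the
skew matrix `θ_{ij}(v)`. -/
theorem sum_sum_skew_mul {ι : Type*} [Fintype ι] {c : ι → ι → ℝ} (hc : ∀ i j, c i j = - c j i)
    (g : ι → ℝ) : ∑ i, g i * ∑ j, c i j * g j = 0 := by
  have h : ∑ i, g i * ∑ j, c i j * g j = - ∑ i, g i * ∑ j, c i j * g j := by
    calc ∑ i, g i * ∑ j, c i j * g j = ∑ i, ∑ j, g i * (c i j * g j) := by
          simp_rw [Finset.mul_sum]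
      _ = ∑ j, ∑ i, g i * (c i j * g j) := Finset.sum_comm
      _ = ∑ j, ∑ i, -(g j * (c j i * g i)) := by
          refine Finset.sum_congr rfl fun j _ => Finset.sum_congr rfl fun i _ => ?_
          rw [hc i j]; ring
      _ = - ∑ i, g i * ∑ j, c i j * g j := by
          simp_rw [Finset.mul_sum, Finset.sum_neg_distrib]
  linarith

variable [IsManifold (𝓡 N) ∞ X]

namespace FinslerForms

theorem IsFinslerOn.d_omega_zero_of_vertical {f : FinslerForms n N X} {W : Set X}
    (hf : f.IsFinslerOn W) {x : X} (hx : x ∈ W) {v : TangentSpace (𝓡 N) x}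
    (h1 : ∀ a, f.omega a x v = 0) (h2 : ∀ i, f.theta i x v = 0) (w : TangentSpace (𝓡 N) x) :
    (f.omega 0).d x v w = 0 := by
  rw [(hf.structureEquations x hx).1]
  simp [OneForm.wedge, h1, h2]

/-- By Cartan's formula this is the Lie derivative of `ω_i` along a vertical field. The `ω_i` rotate
into one another, so a single one need not descend although `∑ ω_i²` does. -/
theorem IsFinslerOn.d_omega_succ_of_vertical {f : FinslerForms n N X} {W : Set X}
    (hf : f.IsFinslerOn W) {x : X} (hx : x ∈ W) {v : TangentSpace (𝓡 N) x}
    (h1 : ∀ a, f.omega a x v = 0) (h2 : ∀ i, f.theta i x v = 0) (i : Fin n)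
    (w : TangentSpace (𝓡 N) x) :
    (f.omega i.succ).d x v w = - ∑ j, f.conn i j x v * f.omega j.succ x w := by
  rw [(hf.structureEquations x hx).2]
  simp [OneForm.wedge, h1, h2]

/-- Along the fibers of `ψ`, the form `ω_0` and the quadratic form `∑ ω_i²` are basic. -/
theorem IsFinslerOn.eventually_descends {f : FinslerForms n N X} (hf : f.IsFinslerOn Set.univ)
    {ψ : X → S} (hψ : Manifold.IsSubmersion (𝓡 N) (𝓡 K) ∞ ψ)
    (hψ_leaf : ∀ (x : X) (v : TangentSpace (𝓡 N) x), mfderiv (𝓡 N) (𝓡 K) ψ x v = 0 →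
        (∀ a, f.omega a x v = 0) ∧ ∀ i, f.theta i x v = 0) (x₀ : X) :
    ∀ᶠ x in nhds x₀, ψ x = ψ x₀ → ∀ v v₀ : EuclideanSpace ℝ (Fin N),
      (mfderiv (𝓡 N) (𝓡 K) ψ x v : EuclideanSpace ℝ (Fin K)) = mfderiv (𝓡 N) (𝓡 K) ψ x₀ v₀ →
      f.omega 0 x v = f.omega 0 x₀ v₀ ∧
        ∑ i : Fin n, (f.omega i.succ x v) ^ 2 = ∑ i : Fin n, (f.omega i.succ x₀ v₀) ^ 2 := by
  obtain ⟨F, _, _, c, hx₀⟩ := hψ.exists_submersionCharts x₀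
  filter_upwards [c.eventually_segment hx₀ (O := Set.univ) Filter.univ_mem] with x hx hψx v v₀ hvv
  obtain ⟨b, hxb, hseg⟩ := hx hψx
  set y₀ := c.dom x₀ with hy₀
  let γ : ℝ → EuclideanSpace ℝ (Fin K) × F :=
    fun t => y₀ + t • ((0 : EuclideanSpace ℝ (Fin K)), b)
  have hγt : ∀ t ∈ Set.Icc (0 : ℝ) 1, γ t ∈ c.dom.target := fun t ht => (hseg t ht).1
  let Dψ (x : X) : EuclideanSpace ℝ (Fin N) →L[ℝ] EuclideanSpace ℝ (Fin K) :=
    mfderiv (𝓡 N) (𝓡 K) ψ x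
  let DG (y : EuclideanSpace ℝ (Fin K) × F) :
      EuclideanSpace ℝ (Fin K) × F →L[ℝ] EuclideanSpace ℝ (Fin N) :=
    mfderiv 𝓘(ℝ, EuclideanSpace ℝ (Fin K) × F) (𝓡 N) c.dom.symm y
  let Dκ (a : EuclideanSpace ℝ (Fin K)) : EuclideanSpace ℝ (Fin K) →L[ℝ] EuclideanSpace ℝ (Fin K) :=
    mfderiv 𝓘(ℝ, EuclideanSpace ℝ (Fin K)) (𝓡 K) c.cod.symm a
  let om (a : Fin (n + 1)) (x : X) : EuclideanSpace ℝ (Fin N) →L[ℝ] ℝ := f.omega a x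
  have hDψG : ∀ y ∈ c.dom.target, ∀ u, Dψ (c.dom.symm y) (DG y u) = Dκ y.1 u.1 :=
    fun y hy u => c.mfderiv_symm hψ.contMDiff hy u
  have hγ1 : ∀ t, (γ t).1 = y₀.1 := fun t => by simp [γ]
  have hy₀t : y₀ ∈ c.dom.target := c.dom.map_source hx₀
  obtain ⟨a', ha'⟩ : ∃ a', Dκ y₀.1 a' = Dψ x₀ v₀ :=
    c.mfderiv_cod_symm_surjective (c.map_symm hy₀t).1 (Dψ x₀ v₀ : EuclideanSpace ℝ (Fin K))
  let β (a : Fin (n + 1)) := (f.omega a).pullE c.dom.symm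
  -- The vector `(a', 0)` is a constant lift, along the segment, of the fixed vector `Dψ x₀ v₀`. Any
  -- other lift gives the same values, because the forms vanish on vertical vectors.
  let g (a : Fin (n + 1)) (t : ℝ) : ℝ := β a (γ t) (a', 0)
  have homega : ∀ a x, (f.omega a).SmoothAt x := fun a x =>
    (OneForm.smoothOn_iff isOpen_univ).1 (hf.smooth_omega a) x trivial
  have hvert : ∀ y ∈ c.dom.target, ∀ u : F,
      (∀ a, f.omega a (c.dom.symm y) (DG y (0, u)) = 0) ∧
        ∀ i, f.theta i (c.dom.symm y) (DG y (0, u)) = 0 := by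
    intro y hy u
    apply hψ_leaf
    exact (hDψG y hy (0, u)).trans (map_zero _)
  have hderiv : ∀ a, ∀ t ∈ Set.Icc (0 : ℝ) 1, HasDerivAt (g a)
      ((f.omega a).d (c.dom.symm (γ t)) (DG (γ t) (0, b)) (DG (γ t) (a', 0))) t := by
    intro a t ht
    have hG := c.contMDiffAt_dom_symm (hγt t ht)
    have hβ : DifferentiableAt ℝ (β a) (γ t) :=
      (OneForm.contDiffAt_pullE hG (homega a _)).differentiableAt (by simp)
    have hγd : HasDerivAt γ ((0 : EuclideanSpace ℝ (Fin K)), b) t := by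
      exact hasDerivAt_add_smul _ _ t
    have h1 : HasDerivAt (g a) (fderiv ℝ (β a) (γ t) (0, b) (a', 0)) t := by
      have := (hβ.hasFDerivAt.comp_hasDerivAt t hγd).clm_apply
        (hasDerivAt_const t ((a', 0) : EuclideanSpace ℝ (Fin K) × F))
      simpa using this
    -- One of the two terms of `dω_a` vanishes because `ω_a` is identically zero on the vertical
    -- field `(0, b)`; the other is the derivative of `g a`.
    have h2 : fderiv ℝ (β a) (γ t) (a', 0) (0, b) = 0 := by
      have e : (fun y => β a y ((0 : EuclideanSpace ℝ (Fin K)), b)) =ᶠ[nhds (γ t)] fun _ => 0 := by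
        filter_upwards [c.dom.open_target.mem_nhds (hγt t ht)] with y hy
        exact (hvert y hy b).1 a
      have h3 := (hβ.hasFDerivAt.clm_apply (hasFDerivAt_const (((0 : EuclideanSpace ℝ (Fin K)), b))
        (γ t))).fderiv
      rw [e.fderiv_eq] at h3
      have := congrArg (fun L => L (a', 0)) h3
      simpa using this.symm
    refine h1.congr_deriv ?_
    rw [← sub_zero (fderiv ℝ (β a) (γ t) (0, b) (a', 0)), ← h2]
    exact OneForm.d_pullE hG (homega a _) _ _
  have hg0 : g 0 1 = g 0 0 := eq_of_hasDerivAt_zero_on_Icc fun t ht => (hderiv 0 t ht).congr_deriv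
    (hf.d_omega_zero_of_vertical trivial (hvert _ (hγt t ht) b).1 (hvert _ (hγt t ht) b).2 _)
  have hgi : ∑ i : Fin n, g i.succ 1 ^ 2 = ∑ i : Fin n, g i.succ 0 ^ 2 := by
    refine eq_of_hasDerivAt_zero_on_Icc (h := fun t => ∑ i : Fin n, g i.succ t ^ 2) fun t ht => ?_
    have h1 := HasDerivAt.fun_sum (u := Finset.univ) fun (i : Fin n) _ => (hderiv i.succ t ht).pow 2
    refine h1.congr_deriv ?_
    -- The derivative of `∑ g_i²` is `-2 ∑ g_i θ_{ij}(v) g_j`, with `v` the velocity of the segment.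
    have h2 := sum_sum_skew_mul (c := fun i j => f.conn i j (c.dom.symm (γ t)) (DG (γ t) (0, b)))
      (fun i j => by rw [hf.conn_skew _ trivial i j]; rfl) (fun i => g i.succ t)
    calc _ = (-2) * ∑ i : Fin n, g i.succ t * ∑ j : Fin n,
          f.conn i j (c.dom.symm (γ t)) (DG (γ t) (0, b)) * g j.succ t := by
          rw [Finset.mul_sum]
          refine Finset.sum_congr rfl fun i _ => ?_
          have hd : (f.omega i.succ).d (c.dom.symm (γ t)) (DG (γ t) (0, b)) (DG (γ t) (a', 0)) =
              - ∑ j : Fin n, f.conn i j (c.dom.symm (γ t)) (DG (γ t) (0, b)) * g j.succ t :=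
            hf.d_omega_succ_of_vertical trivial (hvert _ (hγt t ht) b).1 (hvert _ (hγt t ht) b).2
              i _
          refine (congrArg (fun r => _ * r) hd).trans ?_
          push_cast
          ring
      _ = 0 := by rw [h2, mul_zero]
  have hval : ∀ t ∈ Set.Icc (0 : ℝ) 1, ∀ z : X, c.dom.symm (γ t) = z →
      ∀ u : EuclideanSpace ℝ (Fin N), Dψ z u = Dψ x₀ v₀ → ∀ a, f.omega a z u = g a t := by
    rintro t ht z rfl u hu a
    have h1 : Dψ (c.dom.symm (γ t)) (u - DG (γ t) (a', 0)) = 0 := by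
      rw [map_sub, hDψG _ (hγt t ht), hu, hγ1, ha', sub_self]
    have h2 : om a (c.dom.symm (γ t)) (u - DG (γ t) (a', 0)) = 0 := (hψ_leaf _ _ h1).1 a
    rw [map_sub, sub_eq_zero] at h2
    exact h2
  have hγ0 : c.dom.symm (γ 0) = x₀ := by
    change c.dom.symm (y₀ + (0 : ℝ) • _) = x₀
    rw [zero_smul, add_zero, hy₀, c.dom.left_inv hx₀]
  have e1 := hval 1 (by simp) x hxb v hvv
  have e0 := hval 0 (by simp) x₀ hγ0 v₀ rfl
  simp only [e1, e0]
  exact ⟨hg0, hgi⟩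

end FinslerForms

end FiberConstancy

/-! ### Descent of the projection and of the vector `V` to `S` -/

section Descent

/-- If the joint map to `ι → ℝ` were not onto, a nonzero functional would vanish on its range, and
its coefficients would be a relation among the `l i`. -/
theorem exists_apply_eq_of_linearIndependent {E ι : Type*} [Fintype ι] [AddCommGroup E]
    [Module ℝ E] [TopologicalSpace E] {l : ι → E →L[ℝ] ℝ} (hl : LinearIndependent ℝ l)
    (c : ι → ℝ) : ∃ v, ∀ i, l i v = c i := by
  classical
  let L : E →ₗ[ℝ] (ι → ℝ) := LinearMap.pi fun i => (l i).toLinearMap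
  suffices h : LinearMap.range L = ⊤ by
    obtain ⟨v, hv⟩ := LinearMap.range_eq_top.1 h c
    exact ⟨v, fun i => congrFun hv i⟩
  by_contra h
  obtain ⟨φ, hφ, hφL⟩ := Submodule.exists_le_ker_of_lt_top _ (lt_top_iff_ne_top.2 h)
  apply hφ
  have hexp : ∀ y : ι → ℝ, φ y = ∑ i, y i • φ (fun j => if i = j then 1 else 0) :=
    φ.pi_apply_eq_sum_univ
  have hz : ∀ i, φ (fun j => if i = j then 1 else 0) = 0 := by
    refine Fintype.linearIndependent_iff.1 hl _ ?_
    ext v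
    have hv : φ (L v) = 0 := hφL ⟨v, rfl⟩
    rw [hexp] at hv
    simpa [L, mul_comm] using hv
  refine LinearMap.ext fun y => ?_
  rw [hexp]
  simp [hz]

variable {n N K P : ℕ} {X : Type*} [TopologicalSpace X] [ChartedSpace (EuclideanSpace ℝ (Fin N)) X]
  {S : Type*} [TopologicalSpace S] [ChartedSpace (EuclideanSpace ℝ (Fin K)) S]

/-- The forms in `g` on `U ⊆ S` are compatible with the projection `p : S → M` and with the family
of tangent vectors `V`, to be thought of as the differential of `p` on the vector field dual to
`ω_0`. -/
structure FinslerForms.IsFrameOn [IsManifold (𝓡 K) ∞ S] {M : Type*} [TopologicalSpace M]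
    [ChartedSpace (EuclideanSpace ℝ (Fin P)) M]
    (g : FinslerForms n K S) (p : S → M) (V : ∀ s, TangentSpace (𝓡 P) (p s)) (U : Set S) :
    Prop where
  finsler : g.IsFinslerOn U
  ker_iff : ∀ s ∈ U, ∀ w : TangentSpace (𝓡 K) s,
    mfderiv (𝓡 K) (𝓡 P) p s w = 0 ↔ ∀ a, g.omega a s w = 0
  mfderiv_eq : ∀ s ∈ U, ∀ w : TangentSpace (𝓡 K) s, g.omega 0 s w = 1 →
    (∀ i : Fin n, g.omega i.succ s w = 0) → mfderiv (𝓡 K) (𝓡 P) p s w = V s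

variable [IsManifold (𝓡 N) ∞ X] [IsManifold (𝓡 K) ∞ S]
  {M : Type*} [TopologicalSpace M] [ChartedSpace (EuclideanSpace ℝ (Fin P)) M]
  [IsManifold (𝓡 P) ∞ M]

-- Local constancy on connected fibers is constancy. The quotient map is smooth because near each
-- point it is `τ` composed with a local section of `ψ`.
omit [IsManifold (𝓡 N) ∞ X] [IsManifold (𝓡 K) ∞ S] in
theorem Manifold.IsSubmersion.exists_descent {ψ : X → S} {τ : X → M}
    (hψ : Manifold.IsSubmersion (𝓡 N) (𝓡 K) ∞ ψ) (hψ_conn : ∀ s, IsConnected (ψ ⁻¹' {s}))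
    (hτ : ContMDiff (𝓡 N) (𝓡 P) ∞ τ)
    (hker : ∀ (x : X) (v : TangentSpace (𝓡 N) x),
      mfderiv (𝓡 N) (𝓡 K) ψ x v = 0 → mfderiv (𝓡 N) (𝓡 P) τ x v = 0) :
    ∃ p : S → M, ContMDiff (𝓡 K) (𝓡 P) ∞ p ∧ ∀ x, p (ψ x) = τ x := by
  have hconst : ∀ x y, ψ x = ψ y → τ x = τ y := by
    intro x y hxy
    refine (hψ_conn (ψ x)).isPreconnected.induction₂' (fun x y => τ x = τ y) ?_
      (fun x y z _ _ _ h1 h2 => h1.trans h2) rfl (by simp [hxy])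
    intro z hz
    filter_upwards [nhdsWithin_le_nhds (hψ.eventually_eq_of_ker_le hτ hker z),
      self_mem_nhdsWithin] with w hw hwz
    have : τ w = τ z := hw (Eq.trans hwz (Eq.symm hz))
    exact ⟨this.symm, this⟩
  choose ξ hξ using fun s => (hψ_conn s).nonempty
  have hp : ∀ x, τ (ξ (ψ x)) = τ x := fun x => hconst _ _ (hξ (ψ x))
  refine ⟨fun s => τ (ξ s), fun s => ?_, hp⟩
  obtain ⟨U, σ, hU, hsU, hσ, -, hsec, -⟩ := hψ.exists_section (ξ s) 0
  rw [show ψ (ξ s) = s from hξ s] at hsU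
  refine (hτ.contMDiffAt.comp s (hσ.contMDiffAt (hU.mem_nhds hsU))).congr_of_eventuallyEq ?_
  filter_upwards [hU.mem_nhds hsU] with t ht
  exact (congrArg (fun s => τ (ξ s)) (hsec t ht)).symm.trans (hp (σ t))

omit [IsManifold (𝓡 N) ∞ X] [IsManifold (𝓡 K) ∞ S] [IsManifold (𝓡 P) ∞ M] in
theorem mfderiv_descent {ψ : X → S} {τ : X → M} {p : S → M}
    (hψ : ContMDiff (𝓡 N) (𝓡 K) ∞ ψ) (hp : ContMDiff (𝓡 K) (𝓡 P) ∞ p) (hpτ : ∀ x, p (ψ x) = τ x)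
    (x : X) (v : TangentSpace (𝓡 N) x) :
    mfderiv (𝓡 K) (𝓡 P) p (ψ x) (mfderiv (𝓡 N) (𝓡 K) ψ x v) =
      (mfderiv (𝓡 N) (𝓡 P) τ x v : EuclideanSpace ℝ (Fin P)) := by
  have h : τ = p ∘ ψ := funext fun x => (hpτ x).symm
  subst h
  let T (L : EuclideanSpace ℝ (Fin N) →L[ℝ] EuclideanSpace ℝ (Fin P)) :=
    L (v : EuclideanSpace ℝ (Fin N))
  exact (congrArg T (mfderiv_comp x ((hp _).mdifferentiableAt (by simp))
    ((hψ _).mdifferentiableAt (by simp)))).symm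

-- The local comparison `eventually_descends` spreads over a connected fiber. Chaining two
-- comparisons needs, at the middle point, a vector over the same vector of `S`; surjectivity of
-- `dψ` supplies it.
omit [IsManifold (𝓡 K) ∞ S] in
theorem FinslerForms.IsFinslerOn.descends {f : FinslerForms n N X} (hf : f.IsFinslerOn Set.univ)
    {ψ : X → S} (hψ : Manifold.IsSubmersion (𝓡 N) (𝓡 K) ∞ ψ)
    (hψ_conn : ∀ s, IsConnected (ψ ⁻¹' {s}))
    (hψ_leaf : ∀ (x : X) (v : TangentSpace (𝓡 N) x), mfderiv (𝓡 N) (𝓡 K) ψ x v = 0 →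
        (∀ a, f.omega a x v = 0) ∧ ∀ i, f.theta i x v = 0) {x y : X} (hxy : ψ x = ψ y)
    (v w : EuclideanSpace ℝ (Fin N))
    (hvw : (mfderiv (𝓡 N) (𝓡 K) ψ x v : EuclideanSpace ℝ (Fin K)) = mfderiv (𝓡 N) (𝓡 K) ψ y w) :
    f.omega 0 x v = f.omega 0 y w ∧
        ∑ i : Fin n, (f.omega i.succ x v) ^ 2 = ∑ i : Fin n, (f.omega i.succ y w) ^ 2 := by
  let Dψ (x : X) : EuclideanSpace ℝ (Fin N) →L[ℝ] EuclideanSpace ℝ (Fin K) :=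
    mfderiv (𝓡 N) (𝓡 K) ψ x
  have hsurj : ∀ x (u : EuclideanSpace ℝ (Fin K)), ∃ v, Dψ x v = u :=
    fun x u => hψ.mfderiv_surjective x u
  refine (hψ_conn (ψ x)).isPreconnected.induction₂' (fun x y => ∀ v w : EuclideanSpace ℝ (Fin N),
    Dψ x v = Dψ y w → f.omega 0 x v = f.omega 0 y w ∧
      ∑ i : Fin n, (f.omega i.succ x v) ^ 2 = ∑ i : Fin n, (f.omega i.succ y w) ^ 2) ?_
      ?_ rfl (by simp [hxy]) v w hvw
  · intro z hz
    filter_upwards [nhdsWithin_le_nhds (hf.eventually_descends hψ hψ_leaf z),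
      self_mem_nhdsWithin] with t ht htz
    have h := ht (Eq.trans htz (Eq.symm hz))
    refine ⟨fun v w hvw => ?_, fun v w hvw => h v w hvw⟩
    obtain ⟨h1, h2⟩ := h w v hvw.symm
    exact ⟨h1.symm, h2.symm⟩
  · intro a b c _ _ _ hab hbc v w hvw
    obtain ⟨u, hu⟩ := hsurj b (Dψ a v)
    obtain ⟨h1, h2⟩ := hab v u hu.symm
    obtain ⟨h3, h4⟩ := hbc u w (hu.trans hvw)
    exact ⟨h1.trans h3, h2.trans h4⟩

-- The conditions `ω_0 = 1` and `∑ ω_i² = 0` descend to `S`, and they determine a vector up to the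
-- kernel of `dp ∘ dψ`. The resulting `V` is the vector part of the future immersion `ι`.
omit [IsManifold (𝓡 K) ∞ S] [IsManifold (𝓡 P) ∞ M] in
theorem FinslerForms.IsFinslerOn.exists_field {f : FinslerForms n N X}
    (hf : f.IsFinslerOn Set.univ) {ψ : X → S} (hψ : Manifold.IsSubmersion (𝓡 N) (𝓡 K) ∞ ψ)
    (hψ_conn : ∀ s, IsConnected (ψ ⁻¹' {s}))
    (hψ_leaf : ∀ (x : X) (v : TangentSpace (𝓡 N) x), mfderiv (𝓡 N) (𝓡 K) ψ x v = 0 →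
        (∀ a, f.omega a x v = 0) ∧ ∀ i, f.theta i x v = 0)
    {p : S → M} (hp : ∀ (x : X) (v : TangentSpace (𝓡 N) x), (∀ a, f.omega a x v = 0) →
      mfderiv (𝓡 K) (𝓡 P) p (ψ x) (mfderiv (𝓡 N) (𝓡 K) ψ x v) = 0) :
    ∃ V : ∀ s, TangentSpace (𝓡 P) (p s), ∀ (x : X) (v : TangentSpace (𝓡 N) x),
      f.omega 0 x v = 1 → (∀ i : Fin n, f.omega i.succ x v = 0) →
      mfderiv (𝓡 K) (𝓡 P) p (ψ x) (mfderiv (𝓡 N) (𝓡 K) ψ x v) = V (ψ x) := by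
  choose ξ hξ using fun s => (hψ_conn s).nonempty
  let Dψ (x : X) : EuclideanSpace ℝ (Fin N) →L[ℝ] EuclideanSpace ℝ (Fin K) :=
    mfderiv (𝓡 N) (𝓡 K) ψ x
  let Dp (s : S) : EuclideanSpace ℝ (Fin K) →L[ℝ] EuclideanSpace ℝ (Fin P) :=
    mfderiv (𝓡 K) (𝓡 P) p s
  let om (a : Fin (n + 1)) (x : X) : EuclideanSpace ℝ (Fin N) →L[ℝ] ℝ := f.omega a x
  have hdual : ∀ x, ∃ v : EuclideanSpace ℝ (Fin N), om 0 x v = 1 ∧ ∀ i : Fin n, om i.succ x v = 0 := by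
    intro x
    obtain ⟨v, hv⟩ := exists_apply_eq_of_linearIndependent (hf.linearIndependent x trivial)
      (Sum.elim (fun a => if a = 0 then 1 else 0) (fun _ => 0))
    refine ⟨v, ?_, fun i => ?_⟩
    · exact (hv (Sum.inl 0)).trans (by simp)
    · exact (hv (Sum.inl i.succ)).trans (by simp)
  choose e he0 hei using hdual
  refine ⟨fun s => Dp s (Dψ (ξ s) (e (ξ s))), fun x (v : EuclideanSpace ℝ (Fin N)) hv0 hvi => ?_⟩
  obtain ⟨u, hu⟩ : ∃ u, Dψ x u = Dψ (ξ (ψ x)) (e (ξ (ψ x))) :=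
    hψ.mfderiv_surjective x (Dψ (ξ (ψ x)) (e (ξ (ψ x))) : EuclideanSpace ℝ (Fin K))
  obtain ⟨h1, h2⟩ := hf.descends hψ hψ_conn hψ_leaf (x := x) (y := ξ (ψ x)) (Eq.symm (hξ (ψ x)))
    u (e (ξ (ψ x))) hu
  have h1' : om 0 x u = 1 := h1.trans (he0 _)
  -- Only the sum of squares is constant along the fiber, but its vanishing forces each `ω_i` to
  -- vanish.
  have h2' : ∀ i : Fin n, om i.succ x u = 0 := by
    have h3 : ∑ i : Fin n, (om i.succ x u) ^ 2 = 0 := by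
      refine Eq.trans h2 (Finset.sum_eq_zero fun i _ => ?_)
      exact (congrArg (· ^ 2) (hei (ξ (ψ x)) i)).trans (by simp)
    intro i
    have := (Finset.sum_eq_zero_iff_of_nonneg (fun i _ => sq_nonneg _)).1 h3 i (Finset.mem_univ i)
    exact pow_eq_zero_iff two_ne_zero |>.1 this
  have h4 : Dp (ψ x) (Dψ x (v - u)) = 0 := by
    refine hp x (v - u) fun a => ?_
    change om a x (v - u) = 0
    rw [map_sub, sub_eq_zero]
    refine Fin.cases ?_ (fun i => ?_) a
    · rw [h1']; exact hv0
    · rw [h2']; exact hvi i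
  rw [map_sub, map_sub, sub_eq_zero, hu] at h4
  exact h4

end Descent

/-! ### Coframings of `S` pulled back by sections of `ψ` -/

section PullbackFrame

variable {n N K P : ℕ} {X : Type*} [TopologicalSpace X] [ChartedSpace (EuclideanSpace ℝ (Fin N)) X]
  [IsManifold (𝓡 N) ∞ X]
  {S : Type*} [TopologicalSpace S] [ChartedSpace (EuclideanSpace ℝ (Fin K)) S]
  [IsManifold (𝓡 K) ∞ S]
  {M : Type*} [TopologicalSpace M] [ChartedSpace (EuclideanSpace ℝ (Fin P)) M]

theorem FinslerForms.IsFinslerOn.pullback_isFrameOn {f : FinslerForms n N X}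
    (hf : f.IsFinslerOn Set.univ) {ψ : X → S} (hψ : ContMDiff (𝓡 N) (𝓡 K) ∞ ψ)
    (hψ_leaf : ∀ (x : X) (v : TangentSpace (𝓡 N) x), mfderiv (𝓡 N) (𝓡 K) ψ x v = 0 →
        (∀ a, f.omega a x v = 0) ∧ ∀ i, f.theta i x v = 0)
    {p : S → M} {V : ∀ s, TangentSpace (𝓡 P) (p s)}
    (hp : ∀ (x : X) (v : TangentSpace (𝓡 N) x),
      mfderiv (𝓡 K) (𝓡 P) p (ψ x) (mfderiv (𝓡 N) (𝓡 K) ψ x v) = 0 ↔ ∀ a, f.omega a x v = 0)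
    (hV : ∀ (x : X) (v : TangentSpace (𝓡 N) x),
      f.omega 0 x v = 1 → (∀ i : Fin n, f.omega i.succ x v = 0) →
      mfderiv (𝓡 K) (𝓡 P) p (ψ x) (mfderiv (𝓡 N) (𝓡 K) ψ x v) = V (ψ x))
    {U : Set S} {σ : S → X} (hU : IsOpen U) (hσ : ContMDiffOn (𝓡 K) (𝓡 N) ∞ σ U)
    (hsec : ∀ s ∈ U, ψ (σ s) = s) :
    (f.pullback σ : FinslerForms n K S).IsFrameOn p V U := by
  let Dψ (x : X) : EuclideanSpace ℝ (Fin N) →L[ℝ] EuclideanSpace ℝ (Fin K) :=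
    mfderiv (𝓡 N) (𝓡 K) ψ x
  let Dσ (s : S) : EuclideanSpace ℝ (Fin K) →L[ℝ] EuclideanSpace ℝ (Fin N) :=
    mfderiv (𝓡 K) (𝓡 N) σ s
  let Dp (s : S) : EuclideanSpace ℝ (Fin K) →L[ℝ] EuclideanSpace ℝ (Fin P) :=
    mfderiv (𝓡 K) (𝓡 P) p s
  let V' (s : S) : EuclideanSpace ℝ (Fin P) := V s
  have hDD : ∀ s ∈ U, ∀ w, Dψ (σ s) (Dσ s w) = w :=
    fun s hs w => mfderiv_apply_mfderiv_section hψ hU hσ hsec hs w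
  refine ⟨hf.pullback isOpen_univ hU hσ (fun _ _ => trivial) ?_, ?_, ?_⟩
  · intro s hs v
    let om (a : Fin (n + 1)) : EuclideanSpace ℝ (Fin N) →L[ℝ] ℝ := f.omega a (σ s)
    let th (i : Fin n) : EuclideanSpace ℝ (Fin N) →L[ℝ] ℝ := f.theta i (σ s)
    let v' : EuclideanSpace ℝ (Fin N) := v
    -- The difference between `v'` and `dσ (dψ v')` is vertical, so the coframe agrees on the two
    -- vectors.
    have h : Dψ (σ s) (v' - Dσ s (Dψ (σ s) v')) = 0 := by
      rw [map_sub, hDD s hs, sub_self]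
    have h' : (∀ a, om a (v' - Dσ s (Dψ (σ s) v')) = 0) ∧
      ∀ i, th i (v' - Dσ s (Dψ (σ s) v')) = 0 := hψ_leaf _ _ h
    simp only [map_sub, sub_eq_zero] at h'
    exact ⟨Dψ (σ s) v', h'⟩
  · intro s hs (w : EuclideanSpace ℝ (Fin K))
    have h := hp (σ s) (Dσ s w)
    change Dp (ψ (σ s)) (Dψ (σ s) (Dσ s w)) = 0 ↔ _ at h
    rw [hDD s hs, hsec s hs] at h
    exact h
  · intro s hs (w : EuclideanSpace ℝ (Fin K)) h0 hi
    have h := hV (σ s) (Dσ s w) h0 hi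
    change Dp (ψ (σ s)) (Dψ (σ s) (Dσ s w)) = V' (ψ (σ s)) at h
    rw [hDD s hs, hsec s hs] at h
    exact h

end PullbackFrame

/-! ### Integrability of `dq = ∑ P_a ω_a` -/

section VectorSpaceModel

variable {E F ι : Type*} [NormedAddCommGroup E] [NormedSpace ℝ E] [NormedAddCommGroup F]
  [NormedSpace ℝ F] [Fintype ι]

/-- The identity obtained by differentiating `dq = ∑ P_a ω_a` and skew-symmetrizing. -/
theorem sum_skew_fderiv_eq_zero {q : E → F} {W : ι → E → E →L[ℝ] ℝ} {P : ι → E → F} {y : E}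
    (hq : ContDiffAt ℝ 2 q y) (hW : ∀ a, DifferentiableAt ℝ (W a) y)
    (hP : ∀ a, DifferentiableAt ℝ (P a) y)
    (h : fderiv ℝ q =ᶠ[nhds y] fun z => ∑ a, (W a z).smulRight (P a z)) (v w : E) :
    ∑ a, (W a y w • fderiv ℝ (P a) y v - W a y v • fderiv ℝ (P a) y w +
      (fderiv ℝ (W a) y v w - fderiv ℝ (W a) y w v) • P a y) = 0 := by
  have hd : ∀ v w, fderiv ℝ (fderiv ℝ q) y v w =
      ∑ a, (W a y w • fderiv ℝ (P a) y v + fderiv ℝ (W a) y v w • P a y) := by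
    intro v w
    have h1 : (fun z => fderiv ℝ q z w) =ᶠ[nhds y] fun z => ∑ a, W a z w • P a z := by
      filter_upwards [h] with z hz
      simp [hz]
    have h2 : DifferentiableAt ℝ (fderiv ℝ q) y :=
      (hq.fderiv_right (m := 1) (by norm_num)).differentiableAt (by simp)
    have h3 := (h2.hasFDerivAt.clm_apply (hasFDerivAt_const w y)).fderiv
    rw [h1.fderiv_eq] at h3
    have h4 := HasFDerivAt.fun_sum (u := Finset.univ) fun a _ =>
      ((hW a).hasFDerivAt.clm_apply (hasFDerivAt_const w y)).smul (hP a).hasFDerivAt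
    have h5 := congrArg (fun L => L v) (h3.symm.trans h4.fderiv)
    simpa using h5
  have hs : fderiv ℝ (fderiv ℝ q) y v w = fderiv ℝ (fderiv ℝ q) y w v :=
    (hq.isSymmSndFDerivAt (by simp)) v w
  rw [hd, hd, ← sub_eq_zero, ← Finset.sum_sub_distrib] at hs
  rw [← hs]
  refine Finset.sum_congr rfl fun a _ => ?_
  rw [sub_smul]
  abel

/-- With `v` killed by every `W a` and `w` dual to `W b`, the only derivative of a `P a` that
survives in `sum_skew_fderiv_eq_zero` is that of `P b` along `v`. -/
theorem fderiv_apply_of_vertical [DecidableEq ι] {q : E → F} {W : ι → E → E →L[ℝ] ℝ}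
    {P : ι → E → F} {y : E}
    (hq : ContDiffAt ℝ 2 q y) (hW : ∀ a, DifferentiableAt ℝ (W a) y)
    (hP : ∀ a, DifferentiableAt ℝ (P a) y)
    (h : fderiv ℝ q =ᶠ[nhds y] fun z => ∑ a, (W a z).smulRight (P a z)) {v w : E}
    (hv : ∀ a, W a y v = 0) {b : ι} (hw : ∀ a, W a y w = if a = b then 1 else 0) :
    fderiv ℝ (P b) y v = - ∑ a, (fderiv ℝ (W a) y v w - fderiv ℝ (W a) y w v) • P a y := by
  have := sum_skew_fderiv_eq_zero hq hW hP h v w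
  rw [Finset.sum_add_distrib] at this
  simp only [hv, hw, zero_smul, sub_zero, ite_smul, one_smul, Finset.sum_ite_eq', Finset.mem_univ,
    if_true] at this
  exact eq_neg_of_add_eq_zero_left this

end VectorSpaceModel

/-! ### The coframe and its dual vector fields in a chart -/

namespace FinslerForms

variable {n N : ℕ} {X : Type*} [TopologicalSpace X] [ChartedSpace (EuclideanSpace ℝ (Fin N)) X]

/-- The coframe of `f` read in the chart centred at `x`. -/
noncomputable def coframeInChart (f : FinslerForms n N X) (x : X)
    (y : EuclideanSpace ℝ (Fin N)) : EuclideanSpace ℝ (Fin N) →L[ℝ] CoframeValue n :=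
  ContinuousLinearMap.pi (Sum.elim (fun a => (f.omega a).inChart x y)
    (fun i => (f.theta i).inChart x y))

theorem coframeInChart_inl (f : FinslerForms n N X) (x : X) (y v : EuclideanSpace ℝ (Fin N))
    (a : Fin (n + 1)) : f.coframeInChart x y v (Sum.inl a) = (f.omega a).inChart x y v := rfl

theorem coframeInChart_apply (f : FinslerForms n N X) (x : X) (y v : EuclideanSpace ℝ (Fin N)) :
    f.coframeInChart x y v = f.coframe ((extChartAt (𝓡 N) x).symm y)
      (mfderiv 𝓘(ℝ, EuclideanSpace ℝ (Fin N)) (𝓡 N) (extChartAt (𝓡 N) x).symm y v) := by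
  ext (a | i) <;> rfl

variable [IsManifold (𝓡 N) ∞ X]

theorem IsFinslerOn.contDiffAt_coframeInChart {f : FinslerForms n N X} {U : Set X}
    (hf : f.IsFinslerOn U) (hU : IsOpen U) {x : X} (hx : x ∈ U) :
    ContDiffAt ℝ ∞ (f.coframeInChart x) (extChartAt (𝓡 N) x x) := by
  have h : ContDiffAt ℝ ∞ (fun y => (Sum.elim (fun a => (f.omega a).inChart x y)
      (fun i => (f.theta i).inChart x y) : Fin (n + 1) ⊕ Fin n → EuclideanSpace ℝ (Fin N) →L[ℝ] ℝ))
      (extChartAt (𝓡 N) x x) := by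
    rw [contDiffAt_pi]
    rintro (a | i)
    · exact (OneForm.smoothOn_iff hU).1 (hf.smooth_omega a) x hx
    · exact (OneForm.smoothOn_iff hU).1 (hf.smooth_theta i) x hx
  exact (ContinuousLinearMap.piEquivL ℝ (EuclideanSpace ℝ (Fin N))
    (fun _ : Fin (n + 1) ⊕ Fin n => ℝ)).contDiff.contDiffAt.comp _ h

theorem IsFinslerOn.coframe_surjective {f : FinslerForms n N X} {U : Set X}
    (hf : f.IsFinslerOn U) {x : X} (hx : x ∈ U) : Function.Surjective (f.coframe x) := by
  intro c
  obtain ⟨v, hv⟩ := exists_apply_eq_of_linearIndependent (hf.linearIndependent x hx) c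
  refine ⟨v, ?_⟩
  ext (a | i)
  exacts [hv (Sum.inl a), hv (Sum.inr i)]

theorem IsFinslerOn.coframeInChart_surjective {f : FinslerForms n N X} {U : Set X}
    (hf : f.IsFinslerOn U) (x : X) {y : EuclideanSpace ℝ (Fin N)}
    (hy : y ∈ (extChartAt (𝓡 N) x).target) (hyU : (extChartAt (𝓡 N) x).symm y ∈ U) :
    Function.Surjective (f.coframeInChart x y) := by
  have h : Function.Surjective
      (mfderiv 𝓘(ℝ, EuclideanSpace ℝ (Fin N)) (𝓡 N) (extChartAt (𝓡 N) x).symm y) := by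
    have h1 := isInvertible_mfderivWithin_extChartAt_symm (I := 𝓡 N) hy
    rw [ModelWithCorners.range_eq_univ, mfderivWithin_univ] at h1
    exact h1.bijective.surjective
  intro c
  obtain ⟨v, hv⟩ := (hf.coframe_surjective hyU).comp h c
  exact ⟨v, (f.coframeInChart_apply x y v).trans hv⟩

omit [IsManifold (𝓡 N) ∞ X] in
theorem _root_.eventually_mem_target_and_symm_mem {U : Set X} (hU : IsOpen U) {x : X}
    (hx : x ∈ U) : ∀ᶠ y in nhds (extChartAt (𝓡 N) x x),
      y ∈ (extChartAt (𝓡 N) x).target ∧ (extChartAt (𝓡 N) x).symm y ∈ U := by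
  have hc := continuousAt_extChartAt_symm (I := 𝓡 N) x
  rw [ContinuousAt, extChartAt_to_inv] at hc
  filter_upwards [extChartAt_target_mem_nhds_self x (mem_extChartAt_target (I := 𝓡 N) x),
    hc.eventually (hU.mem_nhds hx)] with y h1 h2 using ⟨h1, h2⟩

theorem isInvertible_of_surjective_of_dim
    {A : EuclideanSpace ℝ (Fin (2 * n + 1)) →L[ℝ] CoframeValue n} (hA : Function.Surjective A) :
    A.IsInvertible := by
  have hdim : Module.finrank ℝ (EuclideanSpace ℝ (Fin (2 * n + 1))) =
      Module.finrank ℝ (CoframeValue n) := by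
    simp [CoframeValue]; ring
  have hinj : Function.Injective A :=
    (LinearMap.injective_iff_surjective_of_finrank_eq_finrank (f := A.toLinearMap) hdim).2 hA
  exact ⟨(LinearEquiv.ofBijective A.toLinearMap ⟨hinj, hA⟩).toContinuousLinearEquiv, by ext; rfl⟩

variable {S : Type*} [TopologicalSpace S] [ChartedSpace (EuclideanSpace ℝ (Fin (2 * n + 1))) S]
  [IsManifold (𝓡 (2 * n + 1)) ∞ S]

theorem IsFinslerOn.isInvertible_coframeInChart {g : FinslerForms n (2 * n + 1) S} {U : Set S}
    (hg : g.IsFinslerOn U) (s : S) {y : EuclideanSpace ℝ (Fin (2 * n + 1))}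
    (hy : y ∈ (extChartAt (𝓡 (2 * n + 1)) s).target)
    (hyU : (extChartAt (𝓡 (2 * n + 1)) s).symm y ∈ U) : (g.coframeInChart s y).IsInvertible :=
  isInvertible_of_surjective_of_dim (hg.coframeInChart_surjective s hy hyU)

/-- The vector field dual to the `b`-th form of the coframe, in the chart centred at `s`. -/
noncomputable def dualInChart (g : FinslerForms n (2 * n + 1) S) (s : S) (b : Fin (n + 1) ⊕ Fin n)
    (y : EuclideanSpace ℝ (Fin (2 * n + 1))) : EuclideanSpace ℝ (Fin (2 * n + 1)) :=
  (g.coframeInChart s y).inverse (Pi.single b 1)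

omit [IsManifold (𝓡 (2 * n + 1)) ∞ S] in
theorem coframeInChart_dualInChart {g : FinslerForms n (2 * n + 1) S} {s : S}
    {y : EuclideanSpace ℝ (Fin (2 * n + 1))} (h : (g.coframeInChart s y).IsInvertible)
    (b : Fin (n + 1) ⊕ Fin n) : g.coframeInChart s y (g.dualInChart s b y) = Pi.single b 1 := by
  obtain ⟨A, hA⟩ := h
  rw [dualInChart, ← hA]
  simp

theorem IsFinslerOn.contDiffAt_dualInChart {g : FinslerForms n (2 * n + 1) S} {U : Set S}
    (hg : g.IsFinslerOn U) (hU : IsOpen U) {s : S} (hs : s ∈ U) (b : Fin (n + 1) ⊕ Fin n) :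
    ContDiffAt ℝ ∞ (g.dualInChart s b) (extChartAt (𝓡 (2 * n + 1)) s s) := by
  have h1 := hg.isInvertible_coframeInChart s (mem_extChartAt_target s) (by simpa using hs)
  exact ((h1.contDiffAt_map_inverse (n := ∞)).comp _ (hg.contDiffAt_coframeInChart hU hs)).clm_apply
    contDiffAt_const

end FinslerForms

/-! ### The projection to `M` in charts -/

section ProjectionInChart

variable {K P : ℕ} {S : Type*} [TopologicalSpace S] [ChartedSpace (EuclideanSpace ℝ (Fin K)) S]
  {M : Type*} [TopologicalSpace M] [ChartedSpace (EuclideanSpace ℝ (Fin P)) M]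

/-- The map `p` read in the charts centred at `s` and `p s`. -/
noncomputable def mapInChart (p : S → M) (s : S) (y : EuclideanSpace ℝ (Fin K)) :
    EuclideanSpace ℝ (Fin P) :=
  extChartAt (𝓡 P) (p s) (p ((extChartAt (𝓡 K) s).symm y))

variable [IsManifold (𝓡 K) ∞ S] [IsManifold (𝓡 P) ∞ M]

omit [IsManifold (𝓡 P) ∞ M] in
theorem contDiffAt_mapInChart {p : S → M} (hp : ContMDiff (𝓡 K) (𝓡 P) ∞ p) (s : S) :
    ContDiffAt ℝ ∞ (mapInChart (K := K) (P := P) p s) (extChartAt (𝓡 K) s s) := by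
  rw [← contMDiffAt_iff_contDiffAt]
  have h1 : ContMDiffAt 𝓘(ℝ, EuclideanSpace ℝ (Fin K)) (𝓡 P) ∞ (p ∘ (extChartAt (𝓡 K) s).symm)
      (extChartAt (𝓡 K) s s) :=
    (hp _).comp _ (contMDiffAt_extChartAt_symm (mem_extChartAt_target s))
  refine ContMDiffAt.comp_of_eq (contMDiffAt_extChartAt (n := ∞) (I := 𝓡 P) (x := p s)) h1 ?_
  simp

theorem fderiv_mapInChart {p : S → M} (hp : ContMDiff (𝓡 K) (𝓡 P) ∞ p) {s : S}
    {y : EuclideanSpace ℝ (Fin K)} (hy : y ∈ (extChartAt (𝓡 K) s).target)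
    (hpy : p ((extChartAt (𝓡 K) s).symm y) ∈ (extChartAt (𝓡 P) (p s)).source)
    (v : EuclideanSpace ℝ (Fin K)) :
    fderiv ℝ (mapInChart (K := K) (P := P) p s) y v =
      mfderiv (𝓡 P) 𝓘(ℝ, EuclideanSpace ℝ (Fin P)) (extChartAt (𝓡 P) (p s))
        (p ((extChartAt (𝓡 K) s).symm y))
        (mfderiv (𝓡 K) (𝓡 P) p ((extChartAt (𝓡 K) s).symm y)
          (mfderiv 𝓘(ℝ, EuclideanSpace ℝ (Fin K)) (𝓡 K) (extChartAt (𝓡 K) s).symm y v)) := by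
  rw [extChartAt_source] at hpy
  have h := HasMFDerivAt.comp y (mdifferentiableAt_extChartAt (I := 𝓡 P) hpy).hasMFDerivAt
    (HasMFDerivAt.comp y ((hp _).mdifferentiableAt (by simp)).hasMFDerivAt
      (mdifferentiableAt_extChartAt_symm hy).hasMFDerivAt)
  let A : EuclideanSpace ℝ (Fin P) →L[ℝ] EuclideanSpace ℝ (Fin P) :=
    mfderiv (𝓡 P) 𝓘(ℝ, EuclideanSpace ℝ (Fin P)) (extChartAt (𝓡 P) (p s))
        (p ((extChartAt (𝓡 K) s).symm y))
  let B : EuclideanSpace ℝ (Fin K) →L[ℝ] EuclideanSpace ℝ (Fin P) :=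
    mfderiv (𝓡 K) (𝓡 P) p ((extChartAt (𝓡 K) s).symm y)
  let D : EuclideanSpace ℝ (Fin K) →L[ℝ] EuclideanSpace ℝ (Fin K) :=
    mfderiv 𝓘(ℝ, EuclideanSpace ℝ (Fin K)) (𝓡 K) (extChartAt (𝓡 K) s).symm y
  have h2 : HasFDerivAt (mapInChart (K := K) (P := P) p s) (A.comp (B.comp D)) y :=
    hasMFDerivAt_iff_hasFDerivAt.1 h
  rw [h2.fderiv]
  rfl

end ProjectionInChart

/-! ### Derivatives of the moving frame along the fibers of `p` -/

namespace FinslerForms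

section Vertical

variable {n N : ℕ} {X : Type*} [TopologicalSpace X] [ChartedSpace (EuclideanSpace ℝ (Fin N)) X]

theorem StructureEquationsAt.d_omega_zero {f : FinslerForms n N X} {x : X}
    (hf : f.StructureEquationsAt x) {v : TangentSpace (𝓡 N) x} (hv : ∀ a, f.omega a x v = 0)
    (w : TangentSpace (𝓡 N) x) :
    (f.omega 0).d x v w = - ∑ j, f.theta j x v * f.omega j.succ x w := by
  rw [hf.1]
  simp [OneForm.wedge, hv]

/-- Every term with `θ_{ij}` or `I_{ijk}` carries a factor `ω_j` and drops out, so `θ_{0i}(v)` can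
be read off without knowing them. -/
theorem StructureEquationsAt.d_omega_succ {f : FinslerForms n N X} {x : X}
    (hf : f.StructureEquationsAt x) {v : TangentSpace (𝓡 N) x} (hv : ∀ a, f.omega a x v = 0)
    (i : Fin n) {w : TangentSpace (𝓡 N) x} (hw : ∀ i : Fin n, f.omega i.succ x w = 0) :
    (f.omega i.succ).d x v w = f.theta i x v * f.omega 0 x w := by
  rw [hf.2]
  simp [OneForm.wedge, hv, hw]

end Vertical

variable {n : ℕ} {S : Type*} [TopologicalSpace S]
  [ChartedSpace (EuclideanSpace ℝ (Fin (2 * n + 1))) S] [IsManifold (𝓡 (2 * n + 1)) ∞ S]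
  {M : Type*} [TopologicalSpace M] [ChartedSpace (EuclideanSpace ℝ (Fin (n + 1))) M]
  [IsManifold (𝓡 (n + 1)) ∞ M]

/-- The image under `p` of the `a`-th dual vector field, in the charts centred at `s`, `p s`. -/
noncomputable def frameInChart (g : FinslerForms n (2 * n + 1) S) (p : S → M) (s : S)
    (a : Fin (n + 1)) (y : EuclideanSpace ℝ (Fin (2 * n + 1))) : EuclideanSpace ℝ (Fin (n + 1)) :=
  fderiv ℝ (mapInChart (K := 2 * n + 1) (P := n + 1) p s) y (g.dualInChart s (Sum.inl a) y)

variable {g : FinslerForms n (2 * n + 1) S} {p : S → M} {V : ∀ s, TangentSpace (𝓡 (n + 1)) (p s)}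
  {U : Set S}

omit [IsManifold (𝓡 (2 * n + 1)) ∞ S] [IsManifold (𝓡 (n + 1)) ∞ M] in
theorem eventually_chart_domain (hp : ContMDiff (𝓡 (2 * n + 1)) (𝓡 (n + 1)) ∞ p) (hU : IsOpen U)
    {s : S} (hs : s ∈ U) : ∀ᶠ y in nhds (extChartAt (𝓡 (2 * n + 1)) s s),
      y ∈ (extChartAt (𝓡 (2 * n + 1)) s).target ∧
      (extChartAt (𝓡 (2 * n + 1)) s).symm y ∈ U ∧
      p ((extChartAt (𝓡 (2 * n + 1)) s).symm y) ∈ (extChartAt (𝓡 (n + 1)) (p s)).source := by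
  have h := eventually_mem_target_and_symm_mem (N := 2 * n + 1) (x := s)
    (hU.inter ((isOpen_extChartAt_source (I := 𝓡 (n + 1)) (p s)).preimage hp.continuous))
    ⟨hs, mem_extChartAt_source (I := 𝓡 (n + 1)) (p s)⟩
  exact h

theorem IsFrameOn.fderiv_mapInChart_eq_zero_iff (hg : g.IsFrameOn p V U)
    (hp : ContMDiff (𝓡 (2 * n + 1)) (𝓡 (n + 1)) ∞ p) {s : S}
    {y : EuclideanSpace ℝ (Fin (2 * n + 1))} (hy : y ∈ (extChartAt (𝓡 (2 * n + 1)) s).target)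
    (hyU : (extChartAt (𝓡 (2 * n + 1)) s).symm y ∈ U)
    (hpy : p ((extChartAt (𝓡 (2 * n + 1)) s).symm y) ∈ (extChartAt (𝓡 (n + 1)) (p s)).source)
    (v : EuclideanSpace ℝ (Fin (2 * n + 1))) :
    fderiv ℝ (mapInChart (K := 2 * n + 1) (P := n + 1) p s) y v = 0 ↔
      ∀ a, (g.omega a).inChart s y v = 0 := by
  have h1 := (isInvertible_mfderiv_extChartAt (I := 𝓡 (n + 1)) hpy).bijective.injective
  have h2 := hg.ker_iff _ hyU
    (mfderiv 𝓘(ℝ, EuclideanSpace ℝ (Fin (2 * n + 1))) (𝓡 (2 * n + 1))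
      (extChartAt (𝓡 (2 * n + 1)) s).symm y v)
  rw [fderiv_mapInChart hp hy hpy]
  refine Iff.trans ?_ h2
  exact map_eq_zero_iff _ h1

/-- Once its components along the dual vectors of the `ω_a` are removed, a vector is annihilated by
all `ω_a`, hence by `dp`. -/
theorem IsFrameOn.fderiv_mapInChart_eq_sum (hg : g.IsFrameOn p V U)
    (hp : ContMDiff (𝓡 (2 * n + 1)) (𝓡 (n + 1)) ∞ p) {s : S}
    {y : EuclideanSpace ℝ (Fin (2 * n + 1))} (hy : y ∈ (extChartAt (𝓡 (2 * n + 1)) s).target)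
    (hyU : (extChartAt (𝓡 (2 * n + 1)) s).symm y ∈ U)
    (hpy : p ((extChartAt (𝓡 (2 * n + 1)) s).symm y) ∈ (extChartAt (𝓡 (n + 1)) (p s)).source) :
    fderiv ℝ (mapInChart (K := 2 * n + 1) (P := n + 1) p s) y =
      ∑ a, ((g.omega a).inChart s y).smulRight (g.frameInChart p s a y) := by
  ext1 v
  have hinv := hg.finsler.isInvertible_coframeInChart s hy hyU
  have h : fderiv ℝ (mapInChart (K := 2 * n + 1) (P := n + 1) p s) y
      (v - ∑ a, (g.omega a).inChart s y v • g.dualInChart s (Sum.inl a) y) = 0 := by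
    rw [hg.fderiv_mapInChart_eq_zero_iff hp hy hyU hpy]
    intro b
    have hb : ∀ a, (g.omega b).inChart s y (g.dualInChart s (Sum.inl a) y) =
        if a = b then 1 else 0 := by
      intro a
      rw [← coframeInChart_inl, coframeInChart_dualInChart hinv, Pi.single_apply]
      simp [eq_comm]
    simp [map_sub, map_sum, hb]
  rw [map_sub, sub_eq_zero] at h
  rw [h]
  simp [frameInChart, map_sum]

/-- The vector dual to `ω_0` is among those that define `V`. Thus `P_0` is the vector part of `ι`,
and derivatives of `P_0` are derivatives of `ι`. -/
theorem IsFrameOn.mfderiv_field (hg : g.IsFrameOn p V U)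
    (hp : ContMDiff (𝓡 (2 * n + 1)) (𝓡 (n + 1)) ∞ p) {s : S}
    {y : EuclideanSpace ℝ (Fin (2 * n + 1))} (hy : y ∈ (extChartAt (𝓡 (2 * n + 1)) s).target)
    (hyU : (extChartAt (𝓡 (2 * n + 1)) s).symm y ∈ U)
    (hpy : p ((extChartAt (𝓡 (2 * n + 1)) s).symm y) ∈ (extChartAt (𝓡 (n + 1)) (p s)).source) :
    mfderiv (𝓡 (n + 1)) 𝓘(ℝ, EuclideanSpace ℝ (Fin (n + 1))) (extChartAt (𝓡 (n + 1)) (p s))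
        (p ((extChartAt (𝓡 (2 * n + 1)) s).symm y)) (V ((extChartAt (𝓡 (2 * n + 1)) s).symm y)) =
      g.frameInChart p s 0 y := by
  have hinv := hg.finsler.isInvertible_coframeInChart s hy hyU
  have hC := coframeInChart_dualInChart hinv (Sum.inl 0)
  rw [frameInChart, fderiv_mapInChart hp hy hpy]
  rw [hg.mfderiv_eq _ hyU]
  · exact (congrFun hC (Sum.inl 0)).trans (by simp)
  · intro i
    exact (congrFun hC (Sum.inl i.succ)).trans (by simp)

omit [IsManifold (𝓡 (n + 1)) ∞ M] in
theorem IsFrameOn.contDiffAt_frameInChart (hg : g.IsFrameOn p V U) (hU : IsOpen U)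
    (hp : ContMDiff (𝓡 (2 * n + 1)) (𝓡 (n + 1)) ∞ p) {s : S} (hs : s ∈ U) (a : Fin (n + 1)) :
    ContDiffAt ℝ ∞ (g.frameInChart p s a) (extChartAt (𝓡 (2 * n + 1)) s s) :=
  ((contDiffAt_mapInChart hp s).fderiv_right (by simp)).clm_apply
    (hg.finsler.contDiffAt_dualInChart hU hs _)

/-- The derivatives of the frame along the fibers of `p`. -/
theorem IsFrameOn.eventually_fderiv_frameInChart (hg : g.IsFrameOn p V U) (hU : IsOpen U)
    (hp : ContMDiff (𝓡 (2 * n + 1)) (𝓡 (n + 1)) ∞ p) {s : S} (hs : s ∈ U) :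
    ∀ᶠ y in nhds (extChartAt (𝓡 (2 * n + 1)) s s), ∀ v : EuclideanSpace ℝ (Fin (2 * n + 1)),
      (∀ a, (g.omega a).inChart s y v = 0) →
      (fderiv ℝ (g.frameInChart p s 0) y v =
        - ∑ i : Fin n, (g.theta i).inChart s y v • g.frameInChart p s i.succ y) ∧
      ∀ k : Fin n, ∃ c : Fin n → ℝ, fderiv ℝ (g.frameInChart p s k.succ) y v =
        (g.theta k).inChart s y v • g.frameInChart p s 0 y +
          ∑ i : Fin n, c i • g.frameInChart p s i.succ y := by
  have hdom := eventually_chart_domain hp hU hs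
  have hq := ((contDiffAt_mapInChart hp s).of_le
    (ENat.LEInfty.out : (2 : WithTop ℕ∞) ≤ ∞)).eventually (by simp)
  have hP : ∀ᶠ y in nhds (extChartAt (𝓡 (2 * n + 1)) s s), ∀ a,
      ContDiffAt ℝ 1 (g.frameInChart p s a) y :=
    Filter.eventually_all.2 fun a => ((hg.contDiffAt_frameInChart hU hp hs a).of_le
      (ENat.LEInfty.out : (1 : WithTop ℕ∞) ≤ ∞)).eventually (by simp)
  filter_upwards [hdom, hdom.eventually_nhds, hq, hP] with y ⟨hy, hyU, hpy⟩ hdomy hqy hPy v hv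
  have hinv := hg.finsler.isInvertible_coframeInChart s hy hyU
  have hG := contMDiffAt_extChartAt_symm hy
  have hom : ∀ a, (g.omega a).SmoothAt ((extChartAt (𝓡 (2 * n + 1)) s).symm y) := fun a =>
    (OneForm.smoothOn_iff hU).1 (hg.finsler.smooth_omega a) _ hyU
  have hW : ∀ a, DifferentiableAt ℝ ((g.omega a).inChart s) y := fun a =>
    (OneForm.contDiffAt_pullE hG (hom a)).differentiableAt (by simp)
  have hdq : fderiv ℝ (mapInChart (K := 2 * n + 1) (P := n + 1) p s) =ᶠ[nhds y] fun z =>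
      ∑ a, ((g.omega a).inChart s z).smulRight (g.frameInChart p s a z) := by
    filter_upwards [hdomy] with z hz using hg.fderiv_mapInChart_eq_sum hp hz.1 hz.2.1 hz.2.2
  have hdual : ∀ b a, (g.omega a).inChart s y (g.dualInChart s (Sum.inl b) y) =
      if a = b then 1 else 0 := by
    intro b a
    rw [← coframeInChart_inl, coframeInChart_dualInChart hinv, Pi.single_apply]
    simp
  -- This is `dP_b(v) = -∑ dω_a(v, e_b) P_a` with `e_b` dual to `ω_b`; the structure equations
  -- supply the coefficients.
  have hmain := fun b => fderiv_apply_of_vertical hqy hW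
    (fun a => (hPy a).differentiableAt (by simp)) hdq hv (hdual b)
  have hd : ∀ a w, fderiv ℝ ((g.omega a).inChart s) y v w - fderiv ℝ ((g.omega a).inChart s) y w v =
      (g.omega a).d _ _ _ := fun a w => OneForm.d_pullE hG (hom a) v w
  have hst := hg.finsler.structureEquations _ hyU
  have hd0 : ∀ w, fderiv ℝ ((g.omega 0).inChart s) y v w -
      fderiv ℝ ((g.omega 0).inChart s) y w v =
      - ∑ j : Fin n, (g.theta j).inChart s y v * (g.omega j.succ).inChart s y w := fun w =>
    (hd 0 w).trans (hst.d_omega_zero hv _)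
  have hdi : ∀ i : Fin n, fderiv ℝ ((g.omega i.succ).inChart s) y v (g.dualInChart s (Sum.inl 0) y) -
      fderiv ℝ ((g.omega i.succ).inChart s) y (g.dualInChart s (Sum.inl 0) y) v =
      (g.theta i).inChart s y v * (g.omega 0).inChart s y (g.dualInChart s (Sum.inl 0) y) := fun i =>
    (hd i.succ _).trans (hst.d_omega_succ hv i fun j => (hdual 0 j.succ).trans (by simp))
  constructor
  · rw [hmain 0, Fin.sum_univ_succ, hd0]
    simp [hdi, hdual]
  · intro k
    -- The coefficients on `P_1, …, P_n` are left unevaluated: the covector `u*` kills these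
    -- vectors. The coefficient on `P_0` comes from `dω_0(v, e_k) = -θ_{0k}(v)`.
    refine ⟨fun i => -(fderiv ℝ ((g.omega i.succ).inChart s) y v (g.dualInChart s (Sum.inl k.succ) y)
      - fderiv ℝ ((g.omega i.succ).inChart s) y (g.dualInChart s (Sum.inl k.succ) y) v), ?_⟩
    rw [hmain k.succ, Fin.sum_univ_succ, hd0]
    simp only [hdual, Fin.succ_inj, mul_ite, mul_one, mul_zero, Finset.sum_ite_eq', Finset.mem_univ,
      if_true, neg_smul, neg_add_rev, neg_neg, Finset.sum_neg_distrib]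
    abel

end FinslerForms

/-! ### Charts of the tangent bundle -/

section TangentBundleCharts

variable {n : ℕ}
  {M : Type*} [TopologicalSpace M] [ChartedSpace (EuclideanSpace ℝ (Fin (n + 1))) M]
  [IsManifold (𝓡 (n + 1)) ∞ M]

theorem trivializationAt_tangent_apply_snd {x₀ : M} (q : TangentBundle (𝓡 (n + 1)) M)
    (hq : q.proj ∈ (extChartAt (𝓡 (n + 1)) x₀).source) :
    (trivializationAt (EuclideanSpace ℝ (Fin (n + 1))) (TangentSpace (𝓡 (n + 1))) x₀ q).2 =
      mfderiv (𝓡 (n + 1)) 𝓘(ℝ, EuclideanSpace ℝ (Fin (n + 1))) (extChartAt (𝓡 (n + 1)) x₀)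
        q.proj q.snd := by
  rw [extChartAt_source] at hq
  let T (L : EuclideanSpace ℝ (Fin (n + 1)) →L[ℝ] EuclideanSpace ℝ (Fin (n + 1))) :=
    L (q.snd : EuclideanSpace ℝ (Fin (n + 1)))
  refine Eq.trans ?_ (congrArg T (TangentBundle.continuousLinearMapAt_trivializationAt hq))
  change _ = Trivialization.continuousLinearMapAt ℝ
    (trivializationAt (EuclideanSpace ℝ (Fin (n + 1))) (TangentSpace (𝓡 (n + 1))) x₀) q.proj q.snd
  rw [Trivialization.continuousLinearMapAt_apply, Trivialization.linearMapAt_apply, if_pos]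
  simpa using hq

theorem extChartAt_tangentBundle_apply (p q : TangentBundle (𝓡 (n + 1)) M)
    (hq : q.proj ∈ (extChartAt (𝓡 (n + 1)) p.proj).source) :
    extChartAt (𝓡 (n + 1)).tangent p q = (extChartAt (𝓡 (n + 1)) p.proj q.proj,
      mfderiv (𝓡 (n + 1)) 𝓘(ℝ, EuclideanSpace ℝ (Fin (n + 1))) (extChartAt (𝓡 (n + 1)) p.proj)
        q.proj q.snd) := by
  rw [← trivializationAt_tangent_apply_snd q hq]
  rw [FiberBundle.extChartAt]
  ext1
  · simp
  · simp

/-- In the chart of `TM` centred at `p`, the fiber through `p` is read by the differential of the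
chart of `M` at its own centre, which is the identity. -/
theorem verticalLift_apply (p : TangentBundle (𝓡 (n + 1)) M)
    (v : EuclideanSpace ℝ (Fin (n + 1))) :
    verticalLift p v = ((0, v) : EuclideanSpace ℝ (Fin (n + 1)) × EuclideanSpace ℝ (Fin (n + 1))) := by
  let F : EuclideanSpace ℝ (Fin (n + 1)) → TangentBundle (𝓡 (n + 1)) M := fun v => ⟨p.proj, v⟩
  let e : EuclideanSpace ℝ (Fin (n + 1)) := p.snd
  have hself : ∀ v : EuclideanSpace ℝ (Fin (n + 1)), mfderiv (𝓡 (n + 1))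
      𝓘(ℝ, EuclideanSpace ℝ (Fin (n + 1))) (extChartAt (𝓡 (n + 1)) p.proj) p.proj v = v :=
    fun v => congrArg (fun L => L v) (mfderiv_extChartAt_self (I := 𝓡 (n + 1)) (x := p.proj))
  have hw : writtenInExtChartAt 𝓘(ℝ, EuclideanSpace ℝ (Fin (n + 1))) (𝓡 (n + 1)).tangent e F =
      fun v => (extChartAt (𝓡 (n + 1)) p.proj p.proj, v) := funext fun v =>
    (extChartAt_tangentBundle_apply (F e) (F v)
      (mem_extChartAt_source (I := 𝓡 (n + 1)) p.proj)).trans (Prod.ext rfl (hself v))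
  have hs : ContMDiffAt 𝓘(ℝ, EuclideanSpace ℝ (Fin (n + 1))) (𝓡 (n + 1)).tangent 1 F e := by
    rw [Bundle.contMDiffAt_totalSpace]
    refine ⟨contMDiffAt_const, ?_⟩
    exact contMDiffAt_id.congr_of_eventuallyEq (Filter.Eventually.of_forall fun v =>
      (trivializationAt_tangent_apply_snd (x₀ := p.proj) (F v)
        (mem_extChartAt_source (I := 𝓡 (n + 1)) p.proj)).trans (hself v))
  have h1 := (hs.mdifferentiableAt one_ne_zero).mfderiv
  rw [hw] at h1
  have h2 : HasFDerivAt (fun v : EuclideanSpace ℝ (Fin (n + 1)) =>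
      (extChartAt (𝓡 (n + 1)) p.proj p.proj, v))
      ((0 : EuclideanSpace ℝ (Fin (n + 1)) →L[ℝ] EuclideanSpace ℝ (Fin (n + 1))).prod
        (ContinuousLinearMap.id ℝ (EuclideanSpace ℝ (Fin (n + 1))))) e :=
    (hasFDerivAt_const _ e).prodMk (hasFDerivAt_id e)
  have h3 : fderiv ℝ (fun v : EuclideanSpace ℝ (Fin (n + 1)) =>
      (extChartAt (𝓡 (n + 1)) p.proj p.proj, v)) e v = (0, v) := by
    rw [h2.fderiv]
    rfl
  refine Eq.trans ?_ h3
  rw [← fderivWithin_univ]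
  have h4 := congrArg (fun L => L v) h1
  simp only [modelWithCornersSelf_coe, Set.range_id] at h4
  exact h4

end TangentBundleCharts

/-! ### Local expressions at the centre of a chart -/

section OneFormInChart

variable {N : ℕ} {X : Type*} [TopologicalSpace X] [ChartedSpace (EuclideanSpace ℝ (Fin N)) X]
  [IsManifold (𝓡 N) ∞ X]

theorem OneForm.inChart_self (α : OneForm N X) (x : X) (v : EuclideanSpace ℝ (Fin N)) :
    α.inChart x (extChartAt (𝓡 N) x x) v = α x v := by
  let a (z : X) : EuclideanSpace ℝ (Fin N) →L[ℝ] ℝ := α z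
  exact (congrArg (a _) (mfderiv_extChartAt_symm_self x v)).trans
    (congrArg (fun z => a z v) (extChartAt_to_inv (I := 𝓡 N) x))

theorem FinslerForms.coframeInChart_self {n : ℕ} (f : FinslerForms n N X) (x : X)
    (v : EuclideanSpace ℝ (Fin N)) :
    f.coframeInChart x (extChartAt (𝓡 N) x x) v = f.coframe x v := by
  ext (a | i)
  exacts [(f.omega a).inChart_self x v, (f.theta i).inChart_self x v]

omit [IsManifold (𝓡 N) ∞ X] in
theorem fderiv_mapInChart_self {P : ℕ} {M : Type*} [TopologicalSpace M]
    [ChartedSpace (EuclideanSpace ℝ (Fin P)) M] {p : X → M} (hp : ContMDiff (𝓡 N) (𝓡 P) ∞ p)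
    (x : X) (v : EuclideanSpace ℝ (Fin N)) :
    fderiv ℝ (mapInChart (K := N) (P := P) p x) (extChartAt (𝓡 N) x x) v =
      mfderiv (𝓡 N) (𝓡 P) p x v := by
  have h1 := ((hp x).mdifferentiableAt (by simp)).mfderiv
  rw [ModelWithCorners.range_eq_univ, fderivWithin_univ] at h1
  exact (congrArg (fun L => L v) h1).symm

end OneFormInChart

/-! ### The lift of `S` to `TM` and its differential -/

namespace FinslerForms

variable {n : ℕ} {S : Type*} [TopologicalSpace S]
  [ChartedSpace (EuclideanSpace ℝ (Fin (2 * n + 1))) S] [IsManifold (𝓡 (2 * n + 1)) ∞ S]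
  {M : Type*} [TopologicalSpace M] [ChartedSpace (EuclideanSpace ℝ (Fin (n + 1))) M]
  [IsManifold (𝓡 (n + 1)) ∞ M]
  {g : FinslerForms n (2 * n + 1) S} {p : S → M} {V : ∀ s, TangentSpace (𝓡 (n + 1)) (p s)}
  {U : Set S}

/-- The map `S → TM` given by a family of tangent vectors along `p`. -/
def liftToTangent (p : S → M) (V : ∀ s, TangentSpace (𝓡 (n + 1)) (p s)) (s : S) :
    TangentBundle (𝓡 (n + 1)) M := ⟨p s, V s⟩

theorem IsFrameOn.eventually_trivializationAt (hg : g.IsFrameOn p V U) (hU : IsOpen U)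
    (hp : ContMDiff (𝓡 (2 * n + 1)) (𝓡 (n + 1)) ∞ p) {s : S} (hs : s ∈ U) :
    ∀ᶠ y in nhds (extChartAt (𝓡 (2 * n + 1)) s s),
      (trivializationAt (EuclideanSpace ℝ (Fin (n + 1))) (TangentSpace (𝓡 (n + 1))) (p s)
        (liftToTangent p V ((extChartAt (𝓡 (2 * n + 1)) s).symm y))).2 =
      g.frameInChart p s 0 y := by
  filter_upwards [eventually_chart_domain hp hU hs] with y ⟨hy, hyU, hpy⟩
  exact (trivializationAt_tangent_apply_snd _ hpy).trans (hg.mfderiv_field hp hy hyU hpy)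

theorem IsFrameOn.contMDiffAt_lift (hg : g.IsFrameOn p V U) (hU : IsOpen U)
    (hp : ContMDiff (𝓡 (2 * n + 1)) (𝓡 (n + 1)) ∞ p) {s : S} (hs : s ∈ U) :
    ContMDiffAt (𝓡 (2 * n + 1)) (𝓡 (n + 1)).tangent ∞ (liftToTangent p V) s := by
  rw [Bundle.contMDiffAt_totalSpace]
  refine ⟨hp s, ?_⟩
  have h1 := hg.contDiffAt_frameInChart hU hp hs 0
  rw [← contMDiffAt_iff_contDiffAt] at h1
  refine (h1.comp s (contMDiffAt_extChartAt (n := ∞) (I := 𝓡 (2 * n + 1)) (x := s))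
    ).congr_of_eventuallyEq ?_
  have hc := continuousAt_extChartAt (I := 𝓡 (2 * n + 1)) s
  filter_upwards [hc.eventually (hg.eventually_trivializationAt hU hp hs),
    extChartAt_source_mem_nhds (I := 𝓡 (2 * n + 1)) s] with t ht hts
  rw [(extChartAt (𝓡 (2 * n + 1)) s).left_inv hts] at ht
  exact ht

/-- In the charts centred at `s` and at `ι s`, `mfderiv` is the ordinary derivative and the lift
reads as the pair of `p` and `P_0`. -/
theorem IsFrameOn.mfderiv_lift (hg : g.IsFrameOn p V U) (hU : IsOpen U)
    (hp : ContMDiff (𝓡 (2 * n + 1)) (𝓡 (n + 1)) ∞ p) {s : S} (hs : s ∈ U)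
    (w : EuclideanSpace ℝ (Fin (2 * n + 1))) :
    mfderiv (𝓡 (2 * n + 1)) (𝓡 (n + 1)).tangent (liftToTangent p V) s w =
      ((mfderiv (𝓡 (2 * n + 1)) (𝓡 (n + 1)) p s w,
        fderiv ℝ (g.frameInChart p s 0) (extChartAt (𝓡 (2 * n + 1)) s s) w) :
        EuclideanSpace ℝ (Fin (n + 1)) × EuclideanSpace ℝ (Fin (n + 1))) := by
  have h1 := ((hg.contMDiffAt_lift hU hp hs).mdifferentiableAt (by simp)).mfderiv
  rw [ModelWithCorners.range_eq_univ, fderivWithin_univ] at h1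
  have hw : writtenInExtChartAt (𝓡 (2 * n + 1)) (𝓡 (n + 1)).tangent s (liftToTangent p V)
      =ᶠ[nhds (extChartAt (𝓡 (2 * n + 1)) s s)]
      fun y => (mapInChart (K := 2 * n + 1) (P := n + 1) p s y, g.frameInChart p s 0 y) := by
    filter_upwards [eventually_chart_domain hp hU hs] with y ⟨hy, hyU, hpy⟩
    exact (extChartAt_tangentBundle_apply (liftToTangent p V s)
      (liftToTangent p V ((extChartAt (𝓡 (2 * n + 1)) s).symm y)) hpy).trans
      (Prod.ext rfl (hg.mfderiv_field hp hy hyU hpy))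
  rw [hw.fderiv_eq, (((contDiffAt_mapInChart hp s).differentiableAt (by simp)).hasFDerivAt.prodMk
    ((hg.contDiffAt_frameInChart hU hp hs 0).differentiableAt (by simp)).hasFDerivAt).fderiv] at h1
  refine (congrArg (fun L => L w) h1).trans ?_
  exact congrArg (fun z => (z, fderiv ℝ (g.frameInChart p s 0)
    (extChartAt (𝓡 (2 * n + 1)) s s) w)) (fderiv_mapInChart_self hp s w)

end FinslerForms

/-! ### Immersion, transversality and the Hilbert form -/

namespace FinslerForms

variable {n : ℕ} {S : Type*} [TopologicalSpace S]
  [ChartedSpace (EuclideanSpace ℝ (Fin (2 * n + 1))) S] [IsManifold (𝓡 (2 * n + 1)) ∞ S]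
  {M : Type*} [TopologicalSpace M] [ChartedSpace (EuclideanSpace ℝ (Fin (n + 1))) M]
  [IsManifold (𝓡 (n + 1)) ∞ M]
  {g : FinslerForms n (2 * n + 1) S} {p : S → M} {V : ∀ s, TangentSpace (𝓡 (n + 1)) (p s)}
  {U : Set S}

/-- The image under `p` of the `a`-th dual vector at `s`. -/
noncomputable def frameAt (g : FinslerForms n (2 * n + 1) S) (p : S → M) (s : S)
    (a : Fin (n + 1)) : EuclideanSpace ℝ (Fin (n + 1)) :=
  g.frameInChart p s a (extChartAt (𝓡 (2 * n + 1)) s s)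

theorem IsFrameOn.mfderiv_eq_sum (hg : g.IsFrameOn p V U)
    (hp : ContMDiff (𝓡 (2 * n + 1)) (𝓡 (n + 1)) ∞ p) {s : S} (hs : s ∈ U)
    (w : EuclideanSpace ℝ (Fin (2 * n + 1))) :
    (mfderiv (𝓡 (2 * n + 1)) (𝓡 (n + 1)) p s w : EuclideanSpace ℝ (Fin (n + 1))) =
      ∑ a, g.omega a s w • g.frameAt p s a := by
  have h := hg.fderiv_mapInChart_eq_sum hp (mem_extChartAt_target (I := 𝓡 (2 * n + 1)) s)
    (by simpa using hs) (by simp)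
  refine (fderiv_mapInChart_self hp s w).symm.trans ?_
  rw [h]
  simp only [_root_.sum_apply, ContinuousLinearMap.smulRight_apply]
  exact Finset.sum_congr rfl fun a _ => congrArg (· • _) ((g.omega a).inChart_self s w)

theorem IsFrameOn.frameAt_zero (hg : g.IsFrameOn p V U)
    (hp : ContMDiff (𝓡 (2 * n + 1)) (𝓡 (n + 1)) ∞ p) {s : S} (hs : s ∈ U) :
    g.frameAt p s 0 = V s := by
  have h := hg.mfderiv_field hp (mem_extChartAt_target (I := 𝓡 (2 * n + 1)) s)
    (by simpa using hs) (by simp)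
  refine h.symm.trans ?_
  let V' (z : S) : EuclideanSpace ℝ (Fin (n + 1)) := V z
  let D (z : M) : EuclideanSpace ℝ (Fin (n + 1)) →L[ℝ] EuclideanSpace ℝ (Fin (n + 1)) :=
    mfderiv (𝓡 (n + 1)) 𝓘(ℝ, EuclideanSpace ℝ (Fin (n + 1))) (extChartAt (𝓡 (n + 1)) (p s)) z
  have h1 : D (p s) = ContinuousLinearMap.id ℝ _ :=
    mfderiv_extChartAt_self (I := 𝓡 (n + 1)) (x := p s)
  change D (p _) (V' _) = V' s
  rw [extChartAt_to_inv, h1]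
  rfl

omit [IsManifold (𝓡 (n + 1)) ∞ M] in
theorem IsFrameOn.exists_coframe_eq (hg : g.IsFrameOn p V U) {s : S} (hs : s ∈ U)
    (c : Fin (n + 1) → ℝ) (t : Fin n → ℝ) : ∃ w : EuclideanSpace ℝ (Fin (2 * n + 1)),
      (∀ a, g.omega a s w = c a) ∧ ∀ i, g.theta i s w = t i := by
  obtain ⟨w, hw⟩ := hg.finsler.coframe_surjective hs (Sum.elim c t)
  exact ⟨w, fun a => congrFun hw (Sum.inl a), fun i => congrFun hw (Sum.inr i)⟩

omit [IsManifold (𝓡 (n + 1)) ∞ M] in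
theorem IsFrameOn.eq_zero (hg : g.IsFrameOn p V U) {s : S} (hs : s ∈ U)
    (w : EuclideanSpace ℝ (Fin (2 * n + 1))) (h1 : ∀ a, g.omega a s w = 0)
    (h2 : ∀ i, g.theta i s w = 0) : w = 0 := by
  have h := isInvertible_of_surjective_of_dim (hg.finsler.coframe_surjective hs)
  refine h.injective (a₁ := w) (a₂ := 0) (Eq.trans ?_ (map_zero (g.coframe s)).symm)
  ext (a | i)
  exacts [h1 a, h2 i]

/-- The covector dual to the indicatrix. -/
theorem IsFrameOn.exists_covector (hg : g.IsFrameOn p V U)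
    (hp : ContMDiff (𝓡 (2 * n + 1)) (𝓡 (n + 1)) ∞ p)
    (hsurj : ∀ s, Function.Surjective (mfderiv (𝓡 (2 * n + 1)) (𝓡 (n + 1)) p s)) {s : S}
    (hs : s ∈ U) : ∃ l : EuclideanSpace ℝ (Fin (n + 1)) →L[ℝ] ℝ,
      (∀ w : EuclideanSpace ℝ (Fin (2 * n + 1)),
        l (mfderiv (𝓡 (2 * n + 1)) (𝓡 (n + 1)) p s w) = g.omega 0 s w) ∧
      ∀ a, l (g.frameAt p s a) = if a = 0 then 1 else 0 := by
  let D : EuclideanSpace ℝ (Fin (2 * n + 1)) →L[ℝ] EuclideanSpace ℝ (Fin (n + 1)) :=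
    mfderiv (𝓡 (2 * n + 1)) (𝓡 (n + 1)) p s
  let om (a : Fin (n + 1)) : EuclideanSpace ℝ (Fin (2 * n + 1)) →L[ℝ] ℝ := g.omega a s
  -- Since `ω_0` vanishes on the kernel of `dp`, composing it with any linear right inverse of `dp`
  -- gives its factor through `dp`.
  obtain ⟨R, hR⟩ := D.toLinearMap.exists_rightInverse_of_surjective
    (LinearMap.range_eq_top.2 (hsurj s))
  have hDR : ∀ v, D (R v) = v := fun v => congrArg (fun L => L v) hR
  have hl : ∀ w, om 0 (R (D w)) = om 0 w := by
    intro w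
    have h : D (R (D w) - w) = 0 := by rw [map_sub, hDR, sub_self]
    have h' : om 0 (R (D w) - w) = 0 := (hg.ker_iff s hs _).1 h 0
    rwa [map_sub, sub_eq_zero] at h'
  refine ⟨LinearMap.toContinuousLinearMap ((om 0).toLinearMap ∘ₗ R), hl, fun a => ?_⟩
  obtain ⟨w, hw, -⟩ := hg.exists_coframe_eq hs (Pi.single a 1) 0
  have hD : D w = g.frameAt p s a := by
    refine (hg.mfderiv_eq_sum hp hs w).trans ?_
    simp only [hw, Pi.single_apply, ite_smul, one_smul, zero_smul, Finset.sum_ite_eq',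
      Finset.mem_univ, if_true]
    rfl
  rw [← hD]
  exact (hl w).trans ((hw 0).trans (by simp [Pi.single_apply, eq_comm]))

theorem IsFrameOn.frameAt_linearIndependent (hg : g.IsFrameOn p V U)
    (hp : ContMDiff (𝓡 (2 * n + 1)) (𝓡 (n + 1)) ∞ p) {s : S} (hs : s ∈ U)
    {c : Fin (n + 1) → ℝ} (hc : ∑ a, c a • g.frameAt p s a = 0) (a : Fin (n + 1)) : c a = 0 := by
  obtain ⟨w, hw, -⟩ := hg.exists_coframe_eq hs c 0
  rw [← hw a]
  refine (hg.ker_iff s hs w).1 ((hg.mfderiv_eq_sum hp hs w).trans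
    ((Finset.sum_congr rfl fun a _ => ?_).trans hc)) a
  exact congrArg (· • g.frameAt p s a) (hw a)

theorem IsFrameOn.fderiv_frame_zero (hg : g.IsFrameOn p V U) (hU : IsOpen U)
    (hp : ContMDiff (𝓡 (2 * n + 1)) (𝓡 (n + 1)) ∞ p) {s : S} (hs : s ∈ U)
    {w : EuclideanSpace ℝ (Fin (2 * n + 1))} (hw : ∀ a, g.omega a s w = 0) :
    fderiv ℝ (g.frameInChart p s 0) (extChartAt (𝓡 (2 * n + 1)) s s) w =
      - ∑ i : Fin n, g.theta i s w • g.frameAt p s i.succ := by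
  have h := ((hg.eventually_fderiv_frameInChart hU hp hs).self_of_nhds w
    fun a => ((g.omega a).inChart_self s w).trans (hw a)).1
  rw [h]
  exact congrArg _ (Finset.sum_congr rfl fun i _ =>
    congrArg (· • _) ((g.theta i).inChart_self s w))

/-- On vectors tangent to the fibers of `p` the lift has derivative `-θ_{0i} P_i`, and the `θ_{0i}`
take arbitrary values on such vectors. -/
theorem IsFrameOn.mem_indicatrixTangent_iff (hg : g.IsFrameOn p V U) (hU : IsOpen U)
    (hp : ContMDiff (𝓡 (2 * n + 1)) (𝓡 (n + 1)) ∞ p) {s : S} (hs : s ∈ U)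
    (v : EuclideanSpace ℝ (Fin (n + 1))) :
    v ∈ indicatrixTangent (liftToTangent p V) s ↔
      ∃ c : Fin n → ℝ, v = ∑ i, c i • g.frameAt p s i.succ := by
  have key : v ∈ indicatrixTangent (liftToTangent p V) s ↔
      ∃ w : EuclideanSpace ℝ (Fin (2 * n + 1)),
        (∀ a, g.omega a s w = 0) ∧ - ∑ i : Fin n, g.theta i s w • g.frameAt p s i.succ = v := by
    have h1 : v ∈ indicatrixTangent (liftToTangent p V) s ↔
        ∃ w : EuclideanSpace ℝ (Fin (2 * n + 1)),
          ((mfderiv (𝓡 (2 * n + 1)) (𝓡 (n + 1)) p s w,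
            fderiv ℝ (g.frameInChart p s 0) (extChartAt (𝓡 (2 * n + 1)) s s) w) :
            EuclideanSpace ℝ (Fin (n + 1)) × EuclideanSpace ℝ (Fin (n + 1))) = (0, v) := by
      refine exists_congr fun w => ?_
      exact ⟨fun h => (hg.mfderiv_lift hU hp hs w).symm.trans
          (Eq.trans h (verticalLift_apply (liftToTangent p V s) v)),
        fun h => (hg.mfderiv_lift hU hp hs w).trans
          (h.trans (verticalLift_apply (liftToTangent p V s) v).symm)⟩
    rw [h1]
    refine exists_congr fun w => ?_
    refine Prod.mk_inj.trans ?_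
    constructor
    · rintro ⟨hw, hv⟩
      have hw' := (hg.ker_iff s hs w).1 hw
      exact ⟨hw', (hg.fderiv_frame_zero hU hp hs hw').symm.trans hv⟩
    · rintro ⟨hw, hv⟩
      exact ⟨(hg.ker_iff s hs w).2 hw, (hg.fderiv_frame_zero hU hp hs hw).trans hv⟩
  rw [key]
  constructor
  · rintro ⟨w, -, rfl⟩
    exact ⟨fun i => - g.theta i s w, by simp⟩
  · rintro ⟨c, rfl⟩
    obtain ⟨w, hw0, hw⟩ := hg.exists_coframe_eq hs 0 (fun i => - c i)
    exact ⟨w, hw0, by simp [hw]⟩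

/-- A vector in the kernel is killed by `dp`, hence by all `ω_a`; then `θ_{0i} P_i` vanishes, and
independence of the `P_i` kills the `θ_{0i}` as well. -/
theorem IsFrameOn.immersion (hg : g.IsFrameOn p V U) (hU : IsOpen U)
    (hp : ContMDiff (𝓡 (2 * n + 1)) (𝓡 (n + 1)) ∞ p) {s : S} (hs : s ∈ U) :
    Function.Injective (mfderiv (𝓡 (2 * n + 1)) (𝓡 (n + 1)).tangent (liftToTangent p V) s) := by
  rw [injective_iff_map_eq_zero]
  intro (w : EuclideanSpace ℝ (Fin (2 * n + 1))) h
  have h := (hg.mfderiv_lift hU hp hs w).symm.trans h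
  obtain ⟨h1, h2⟩ := Prod.ext_iff.1 h
  have h3 := (hg.ker_iff s hs w).1 h1
  have h4 := (hg.fderiv_frame_zero hU hp hs h3).symm.trans h2
  refine hg.eq_zero hs w h3 fun i => ?_
  refine hg.frameAt_linearIndependent hp hs (c := Fin.cases 0 fun i => g.theta i s w) ?_ i.succ
  rw [Fin.sum_univ_succ]
  have h5 := neg_eq_zero.1 h4
  simpa using h5

theorem IsFrameOn.radiallyTransverse (hg : g.IsFrameOn p V U) (hU : IsOpen U)
    (hp : ContMDiff (𝓡 (2 * n + 1)) (𝓡 (n + 1)) ∞ p) {s : S} (hs : s ∈ U) :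
    verticalLift (liftToTangent p V s) (liftToTangent p V s).snd ∉
      Set.range (mfderiv (𝓡 (2 * n + 1)) (𝓡 (n + 1)).tangent (liftToTangent p V) s) := by
  intro h
  obtain ⟨c, hc⟩ := (hg.mem_indicatrixTangent_iff hU hp hs (V s)).1 h
  rw [← hg.frameAt_zero hp hs] at hc
  -- If the radial vector `P_0` were `∑ c_i P_i`, this would be a relation in the frame with
  -- coefficient `1` on `P_0`.
  have h0 := hg.frameAt_linearIndependent hp hs (c := Fin.cases 1 fun i => - c i)
    (by rw [Fin.sum_univ_succ]; simp [← hc]) 0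
  exact one_ne_zero (α := ℝ) h0

/-- The factor of `ω_0` through `dp` is `1` on `P_0`, the vector part of `ι`, and `0` on the `P_i`,
which span the tangent hyperplane. It is therefore `u*`. -/
theorem IsFrameOn.isHilbertFormAt (hg : g.IsFrameOn p V U) (hU : IsOpen U)
    (hp : ContMDiff (𝓡 (2 * n + 1)) (𝓡 (n + 1)) ∞ p)
    (hsurj : ∀ s, Function.Surjective (mfderiv (𝓡 (2 * n + 1)) (𝓡 (n + 1)) p s)) {s : S}
    (hs : s ∈ U) : IsHilbertFormAt (liftToTangent p V) s (g.omega 0 s) := by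
  obtain ⟨l, hl, hlP⟩ := hg.exists_covector hp hsurj hs
  refine ⟨l, ⟨?_, ?_⟩, fun w => (hl w).symm⟩
  · refine Submodule.ext fun (v : EuclideanSpace ℝ (Fin (n + 1))) => ?_
    refine Iff.trans ?_ (hg.mem_indicatrixTangent_iff hU hp hs v).symm
    change l v = 0 ↔ _
    constructor
    · intro hv
      obtain ⟨w, rfl⟩ := hsurj s v
      refine ⟨fun i => g.omega i.succ s w, (hg.mfderiv_eq_sum hp hs w).trans ?_⟩
      have h0 : (g.omega 0 s w : ℝ) = 0 := (hl w).symm.trans hv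
      rw [Fin.sum_univ_succ, h0, zero_smul, zero_add]
    · rintro ⟨c, rfl⟩
      simp [hlP]
  · have h := hlP 0
    rw [hg.frameAt_zero hp hs, if_pos rfl] at h
    exact h

end FinslerForms

theorem mfderiv_curve_apply_one {N : ℕ} {X : Type*} [TopologicalSpace X]
    [ChartedSpace (EuclideanSpace ℝ (Fin N)) X] {c : ℝ → X} {t : ℝ}
    (hc : MDifferentiableAt 𝓘(ℝ) (𝓡 N) c t) :
    mfderiv 𝓘(ℝ) (𝓡 N) c t (1 : ℝ) = deriv (fun z => extChartAt (𝓡 N) (c t) (c z)) t := by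
  have h := hc.mfderiv
  rw [ModelWithCorners.range_eq_univ, fderivWithin_univ] at h
  exact congrArg (fun L => L 1) h

/-! ### Convexity of the indicatrices -/

namespace FinslerForms

variable {n : ℕ} {S : Type*} [TopologicalSpace S]
  [ChartedSpace (EuclideanSpace ℝ (Fin (2 * n + 1))) S] [IsManifold (𝓡 (2 * n + 1)) ∞ S]
  {M : Type*} [TopologicalSpace M] [ChartedSpace (EuclideanSpace ℝ (Fin (n + 1))) M]
  [IsManifold (𝓡 (n + 1)) ∞ M]
  {g : FinslerForms n (2 * n + 1) S} {p : S → M} {V : ∀ s, TangentSpace (𝓡 (n + 1)) (p s)}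
  {U : Set S}

/-- The acceleration of a curve in a fiber, relative to the tangent hyperplane of the indicatrix. -/
theorem IsFrameOn.covector_iteratedDeriv_two (hg : g.IsFrameOn p V U) (hU : IsOpen U)
    (hp : ContMDiff (𝓡 (2 * n + 1)) (𝓡 (n + 1)) ∞ p) {c : ℝ → S}
    (hc : ContMDiff 𝓘(ℝ) (𝓡 (2 * n + 1)) ∞ c) (hcp : ∀ t, p (c t) = p (c 0)) (hs : c 0 ∈ U)
    (l : EuclideanSpace ℝ (Fin (n + 1)) →L[ℝ] ℝ) (hl0 : l (g.frameAt p (c 0) 0) = 1)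
    (hl : ∀ i : Fin n, l (g.frameAt p (c 0) i.succ) = 0) :
    (∀ a, g.omega a (c 0) (mfderiv 𝓘(ℝ) (𝓡 (2 * n + 1)) c 0 (1 : ℝ)) = 0) ∧
    l (iteratedDeriv (F := EuclideanSpace ℝ (Fin (n + 1))) 2 (fun t => V (c t)) 0) =
      - ∑ i, (g.theta i (c 0) (mfderiv 𝓘(ℝ) (𝓡 (2 * n + 1)) c 0 (1 : ℝ))) ^ 2 := by
  set s := c 0 with hsdef
  let γ : ℝ → EuclideanSpace ℝ (Fin (2 * n + 1)) := fun t => extChartAt (𝓡 (2 * n + 1)) s (c t)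
  have hγ : ContDiffAt ℝ ∞ γ 0 := OneForm.contDiffAt_extChartAt_comp (hc 0)
  have hγd : mfderiv 𝓘(ℝ) (𝓡 (2 * n + 1)) c 0 (1 : ℝ) = deriv γ 0 :=
    mfderiv_curve_apply_one ((hc 0).mdifferentiableAt (by simp))
  have hγ1 : ∀ᶠ t in nhds 0, DifferentiableAt ℝ γ t := by
    filter_upwards [(hγ.of_le (ENat.LEInfty.out : (1 : WithTop ℕ∞) ≤ ∞)).eventually (by simp)]
      with t ht using ht.differentiableAt (by simp)
  have hγ2 : DifferentiableAt ℝ (deriv γ) 0 := by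
    have h1 : DifferentiableAt ℝ (fderiv ℝ γ) 0 :=
      (hγ.fderiv_right (m := 1) (by norm_cast)).differentiableAt (by simp)
    exact h1.clm_apply (differentiableAt_const 1)
  have hsrc : ∀ᶠ t in nhds 0, c t ∈ (extChartAt (𝓡 (2 * n + 1)) s).source :=
    hc.continuous.continuousAt.eventually (extChartAt_source_mem_nhds (I := 𝓡 (2 * n + 1)) s)
  have hdom := hγ.continuousAt.eventually (eventually_chart_domain hp hU hs)
  have hfr := hγ.continuousAt.eventually (hg.eventually_fderiv_frameInChart hU hp hs)
  have hP : ∀ a, ∀ᶠ t in nhds 0, DifferentiableAt ℝ (g.frameInChart p s a) (γ t) := by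
    intro a
    filter_upwards [hγ.continuousAt.eventually (((hg.contDiffAt_frameInChart hU hp hs a).of_le
      (ENat.LEInfty.out : (1 : WithTop ℕ∞) ≤ ∞)).eventually (by simp))]
      with t ht using ht.differentiableAt (by simp)
  have hq : ∀ᶠ t in nhds 0,
      DifferentiableAt ℝ (mapInChart (K := 2 * n + 1) (P := n + 1) p s) (γ t) := by
    filter_upwards [hγ.continuousAt.eventually (((contDiffAt_mapInChart hp s).of_le
      (ENat.LEInfty.out : (1 : WithTop ℕ∞) ≤ ∞)).eventually (by simp))]
      with t ht using ht.differentiableAt (by simp)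
  have hconst : ∀ᶠ t in nhds 0, mapInChart (K := 2 * n + 1) (P := n + 1) p s (γ t) =
      extChartAt (𝓡 (n + 1)) (p s) (p s) := by
    filter_upwards [hsrc] with t ht
    change extChartAt (𝓡 (n + 1)) (p s) (p ((extChartAt (𝓡 (2 * n + 1)) s).symm
      (extChartAt (𝓡 (2 * n + 1)) s (c t)))) = _
    rw [(extChartAt (𝓡 (2 * n + 1)) s).left_inv ht, hcp t]
  -- As `p ∘ c` is constant, the velocity is killed by `dp`. This is needed for all times near `0`,
  -- because the resulting formula for the first derivative is differentiated again.
  have hvert : ∀ᶠ t in nhds 0, ∀ a, (g.omega a).inChart s (γ t) (deriv γ t) = 0 := by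
    filter_upwards [hconst.eventually_nhds, hdom, hγ1, hq] with t ht ⟨hy, hyU, hpy⟩ hγt hqt
    rw [← hg.fderiv_mapInChart_eq_zero_iff hp hy hyU hpy]
    have h1 := hqt.hasFDerivAt.comp_hasDerivAt t hγt.hasDerivAt
    have h2 : HasDerivAt (mapInChart (K := 2 * n + 1) (P := n + 1) p s ∘ γ) 0 t :=
      (hasDerivAt_const t (extChartAt (𝓡 (n + 1)) (p s) (p s))).congr_of_eventuallyEq ht
    exact h1.unique h2
  let V' (z : S) : EuclideanSpace ℝ (Fin (n + 1)) := V z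
  -- The base point does not move and is the centre of the chart of `M`, whose differential there is
  -- the identity. So `V (c t)` equals its local expression.
  have hV : ∀ᶠ t in nhds 0, V' (c t) = g.frameInChart p s 0 (γ t) := by
    filter_upwards [hdom, hsrc] with t ⟨hy, hyU, hpy⟩ ht
    have h1 := hg.mfderiv_field hp hy hyU hpy
    let D (z : M) : EuclideanSpace ℝ (Fin (n + 1)) →L[ℝ] EuclideanSpace ℝ (Fin (n + 1)) :=
      mfderiv (𝓡 (n + 1)) 𝓘(ℝ, EuclideanSpace ℝ (Fin (n + 1))) (extChartAt (𝓡 (n + 1)) (p s)) z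
    have hD : D (p s) = ContinuousLinearMap.id ℝ _ :=
      mfderiv_extChartAt_self (I := 𝓡 (n + 1)) (x := p s)
    change D (p ((extChartAt (𝓡 (2 * n + 1)) s).symm (extChartAt (𝓡 (2 * n + 1)) s (c t))))
      (V' ((extChartAt (𝓡 (2 * n + 1)) s).symm (extChartAt (𝓡 (2 * n + 1)) s (c t)))) = _ at h1
    rw [(extChartAt (𝓡 (2 * n + 1)) s).left_inv ht, hcp t, hD] at h1
    exact h1
  let A (i : Fin n) (t : ℝ) : ℝ := (g.theta i).inChart s (γ t) (deriv γ t)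
  have hd1 : deriv (fun t => V' (c t)) =ᶠ[nhds 0]
      fun t => - ∑ i, A i t • g.frameInChart p s i.succ (γ t) := by
    filter_upwards [hV.eventually_nhds, hγ1, hP 0, hfr, hvert] with t ht hγt hPt hfrt hvt
    rw [Filter.EventuallyEq.deriv_eq ht, ← (hfrt _ hvt).1]
    exact (hPt.hasFDerivAt.comp_hasDerivAt t hγt.hasDerivAt).deriv
  have hA : ∀ i, DifferentiableAt ℝ (A i) 0 := by
    intro i
    have h1 : (g.theta i).SmoothAt s := (OneForm.smoothOn_iff hU).1 (hg.finsler.smooth_theta i) s hs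
    have h2 : DifferentiableAt ℝ ((g.theta i).inChart s) (γ 0) := h1.differentiableAt (by simp)
    exact (h2.comp (0 : ℝ) hγ1.self_of_nhds).clm_apply hγ2
  have hA0 : ∀ i, A i 0 = g.theta i s (deriv γ 0) := fun i => (g.theta i).inChart_self s _
  rw [hγd]
  refine ⟨fun a => ((g.omega a).inChart_self s _).symm.trans (hvert.self_of_nhds a), ?_⟩
  have hd2 : iteratedDeriv 2 (fun t => V' (c t)) 0 = - ∑ i,
      (A i 0 • fderiv ℝ (g.frameInChart p s i.succ) (γ 0) (deriv γ 0) +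
        deriv (A i) 0 • g.frameInChart p s i.succ (γ 0)) := by
    rw [iteratedDeriv_succ, iteratedDeriv_one, hd1.deriv_eq]
    refine HasDerivAt.deriv (HasDerivAt.fun_neg (HasDerivAt.fun_sum fun i _ => ?_))
    exact (hA i).hasDerivAt.smul ((hP i.succ).self_of_nhds.hasFDerivAt.comp_hasDerivAt (0 : ℝ)
      hγ1.self_of_nhds.hasDerivAt)
  have hl' : ∀ i : Fin n, l (g.frameInChart p s i.succ (γ 0)) = 0 := hl
  have hl0' : l (g.frameInChart p s 0 (γ 0)) = 1 := hl0
  change l (iteratedDeriv 2 (fun t => V' (c t)) 0) = _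
  rw [hd2, map_neg, map_sum]
  refine congrArg _ (Finset.sum_congr rfl fun i _ => ?_)
  -- Of the derivative of `P_i` along the curve, `l` keeps only the coefficient `θ_{0i}(c')` of
  -- `P_0`; the factor `A i 0` is the same number, whence the square.
  obtain ⟨b, hb⟩ := (hfr.self_of_nhds _ hvert.self_of_nhds).2 i
  refine Eq.trans ?_ (congrArg (· ^ 2) (hA0 i))
  rw [hb]
  simp only [map_add, map_smul, map_sum, hl', hl0', smul_eq_mul, mul_zero, add_zero,
    Finset.sum_const_zero, mul_one]
  exact (sq _).symm

/-- A projection `p : S → M` and vectors `V` along it, locally compatible with forms that satisfy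
the Finsler structure equations, define a generalized Finsler structure. -/
theorem isGeneralizedFinslerStructure_of_isFrameOn [ConnectedSpace S]
    (hp : ContMDiff (𝓡 (2 * n + 1)) (𝓡 (n + 1)) ∞ p)
    (hsurj : ∀ s, Function.Surjective (mfderiv (𝓡 (2 * n + 1)) (𝓡 (n + 1)) p s))
    (hfib : ∀ m, IsPreconnected {s | p s = m})
    (hframe : ∀ s, ∃ (g : FinslerForms n (2 * n + 1) S) (U : Set S),
      IsOpen U ∧ s ∈ U ∧ g.IsFrameOn p V U) :
    IsGeneralizedFinslerStructure (liftToTangent p V) where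
  connected := inferInstance
  smooth s := by
    obtain ⟨g, U, hU, hs, hg⟩ := hframe s
    exact hg.contMDiffAt_lift hU hp hs
  immersion s := by
    obtain ⟨g, U, hU, hs, hg⟩ := hframe s
    exact hg.immersion hU hp hs
  radiallyTransverse s := by
    obtain ⟨g, U, hU, hs, hg⟩ := hframe s
    exact hg.radiallyTransverse hU hp hs
  submersion := hsurj
  fibers := hfib
  convex c hc hcp hc' l hl := by
    obtain ⟨g, U, hU, hs, hg⟩ := hframe (c 0)
    let l' : EuclideanSpace ℝ (Fin (n + 1)) →L[ℝ] ℝ := l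
    have hl0 : l' (g.frameAt p (c 0) 0) = 1 := by
      rw [hg.frameAt_zero hp hs]
      exact hl.2
    have hli : ∀ i : Fin n, l' (g.frameAt p (c 0) i.succ) = 0 := by
      intro i
      have h : g.frameAt p (c 0) i.succ ∈ indicatrixTangent (liftToTangent p V) (c 0) :=
        (hg.mem_indicatrixTangent_iff hU hp hs _).2 ⟨Pi.single i 1, by simp [Pi.single_apply]⟩
      rw [← hl.1] at h
      exact h
    obtain ⟨h1, h2⟩ := hg.covector_iteratedDeriv_two hU hp hc hcp hs l' hl0 hli
    -- If the sum were zero, all `θ_{0i}` would vanish on the velocity; the `ω_a` vanish there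
    -- already, so the velocity would be zero.
    refine lt_of_eq_of_lt h2 (neg_lt_zero.2 ?_)
    refine lt_of_le_of_ne (Finset.sum_nonneg fun i _ => sq_nonneg _) fun h => hc' ?_
    have h3 := (Finset.sum_eq_zero_iff_of_nonneg fun i _ => sq_nonneg _).1 h.symm
    exact hg.eq_zero hs _ h1 fun i => pow_eq_zero_iff two_ne_zero |>.1 (h3 i (Finset.mem_univ i))

theorem IsFrameOn.isAdaptedOn (hg : g.IsFrameOn p V U) (hU : IsOpen U)
    (hp : ContMDiff (𝓡 (2 * n + 1)) (𝓡 (n + 1)) ∞ p)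
    (hsurj : ∀ s, Function.Surjective (mfderiv (𝓡 (2 * n + 1)) (𝓡 (n + 1)) p s)) :
    IsAdaptedOn (liftToTangent p V) g U :=
  ⟨hg.finsler, fun _ hs => hg.isHilbertFormAt hU hp hsurj hs,
    fun s hs w hw i => (hg.ker_iff s hs w).1 hw i.succ⟩

end FinslerForms

/-! ### Factoring through surjections, and the lift of `ψ` to the coframe bundle -/

theorem exists_clm_comp_eq_of_ker_le {E F V : Type*} [NormedAddCommGroup E] [NormedSpace ℝ E]
    [NormedAddCommGroup F] [NormedSpace ℝ F] [FiniteDimensional ℝ F] [NormedAddCommGroup V]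
    [NormedSpace ℝ V] {D : E →L[ℝ] F} (hD : Function.Surjective D) {L : E →L[ℝ] V}
    (hL : ∀ v, D v = 0 → L v = 0) : ∃ B : F →L[ℝ] V, ∀ v, B (D v) = L v := by
  obtain ⟨R, hR⟩ := D.toLinearMap.exists_rightInverse_of_surjective (LinearMap.range_eq_top.2 hD)
  refine ⟨LinearMap.toContinuousLinearMap (L.toLinearMap ∘ₗ R), fun v => ?_⟩
  have h : D (R (D v) - v) = 0 := by
    rw [map_sub, sub_eq_zero]
    exact congrArg (fun L => L (D v)) hR
  have h' := hL _ h
  rw [map_sub, sub_eq_zero] at h'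
  exact h'

/-- A linear factor through a smooth family of surjections is smooth. -/
theorem contDiffAt_of_comp_eq {E E' F V : Type*} [NormedAddCommGroup E] [NormedSpace ℝ E]
    [NormedAddCommGroup E'] [NormedSpace ℝ E']
    [NormedAddCommGroup F] [NormedSpace ℝ F] [FiniteDimensional ℝ F] [CompleteSpace F]
    [NormedAddCommGroup V] [NormedSpace ℝ V]
    {D : E' → E →L[ℝ] F} {L : E' → E →L[ℝ] V} {B : E' → F →L[ℝ] V} {z₀ : E'}
    (hD : ContDiffAt ℝ ∞ D z₀) (hL : ContDiffAt ℝ ∞ L z₀) (hsurj : Function.Surjective (D z₀))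
    (hB : ∀ᶠ z in nhds z₀, (B z).comp (D z) = L z) : ContDiffAt ℝ ∞ B z₀ := by
  -- A right inverse `R` at the single point `z₀` suffices: `D z ∘ R` stays invertible nearby, and
  -- `B z = L z ∘ R ∘ (D z ∘ R)⁻¹` there.
  obtain ⟨R, hR⟩ := (D z₀).toLinearMap.exists_rightInverse_of_surjective
    (LinearMap.range_eq_top.2 hsurj)
  let R' : F →L[ℝ] E := LinearMap.toContinuousLinearMap R
  have hA : ContDiffAt ℝ ∞ (fun z => (D z).comp R') z₀ := hD.clm_comp contDiffAt_const
  have hA0 : (D z₀).comp R' = (ContinuousLinearEquiv.refl ℝ F : F →L[ℝ] F) := by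
    ext v
    exact congrArg (fun L => L v) hR
  have hinv0 : ((D z₀).comp R').IsInvertible := ⟨_, hA0.symm⟩
  have hinv : ∀ᶠ z in nhds z₀, ((D z).comp R').IsInvertible := by
    refine hA.continuousAt.eventually ?_
    change ∀ᶠ y in nhds ((D z₀).comp R'), y.IsInvertible
    rw [hA0]
    exact ContinuousLinearEquiv.nhds (ContinuousLinearEquiv.refl ℝ F)
  have h := (hL.clm_comp (contDiffAt_const (c := R'))).clm_comp
    ((hinv0.contDiffAt_map_inverse (n := ∞)).comp z₀ hA)
  refine h.congr_of_eventuallyEq ?_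
  filter_upwards [hinv, hB] with z hz hBz
  obtain ⟨A, hAz⟩ := hz
  rw [← hBz]
  ext v
  simp only [Function.comp_apply, ContinuousLinearMap.comp_apply]
  rw [← hAz, ContinuousLinearMap.inverse_equiv]
  have h2 : D z (R' (A.symm v)) = A (A.symm v) := congrArg (fun L => L (A.symm v)) hAz.symm
  simp [h2]

section CoframeLift

variable {n N : ℕ} {X : Type*} [TopologicalSpace X] [ChartedSpace (EuclideanSpace ℝ (Fin N)) X]
  [IsManifold (𝓡 N) ∞ X]
  {S : Type*} [TopologicalSpace S] [ChartedSpace (EuclideanSpace ℝ (Fin (2 * n + 1))) S]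
  [IsManifold (𝓡 (2 * n + 1)) ∞ S]

omit [IsManifold (𝓡 (2 * n + 1)) ∞ S] in
theorem CoframeBundle.mk_congr {a b : S} (h : a = b)
    {A B : EuclideanSpace ℝ (Fin (2 * n + 1)) →L[ℝ] CoframeValue n} (hAB : A = B) :
    (⟨a, A⟩ : CoframeBundle n S) = ⟨b, B⟩ := by
  subst h hAB
  rfl

/-- The lift of `ψ : X → S` to the coframe bundle of `S` through which the coframe on `X` factors. -/
theorem FinslerForms.IsFinslerOn.exists_coframe_lift {f : FinslerForms n N X}
    (hf : f.IsFinslerOn Set.univ) {ψ : X → S}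
    (hψ : Manifold.IsSubmersion (𝓡 N) (𝓡 (2 * n + 1)) ∞ ψ)
    (hψ_leaf : ∀ (x : X) (v : TangentSpace (𝓡 N) x),
      mfderiv (𝓡 N) (𝓡 (2 * n + 1)) ψ x v = 0 →
        (∀ a, f.omega a x v = 0) ∧ ∀ i, f.theta i x v = 0) :
    ∃ φ : X → CoframeBundle n S,
      ContMDiff (𝓡 N) (coframeModel n) ∞ φ ∧
      (∀ x, (φ x).proj = ψ x) ∧
      (∀ (x : X) (v : TangentSpace (𝓡 N) x),
          tautologicalForm (φ x) (mfderiv (𝓡 N) (coframeModel n) φ x v) = f.coframe x v) ∧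
      ∀ (U : Set S) (σ : S → X), IsOpen U → ContMDiffOn (𝓡 (2 * n + 1)) (𝓡 N) ∞ σ U →
        (∀ s ∈ U, ψ (σ s) = s) → ∀ s ∈ U, φ (σ s) = (f.pullback σ).toSection s := by
  let Dψ (x : X) : EuclideanSpace ℝ (Fin N) →L[ℝ] EuclideanSpace ℝ (Fin (2 * n + 1)) :=
    mfderiv (𝓡 N) (𝓡 (2 * n + 1)) ψ x
  let cof (x : X) : EuclideanSpace ℝ (Fin N) →L[ℝ] CoframeValue n := f.coframe x
  -- The coframe kills the kernel of `dψ`, so it factors through `dψ`. The factor is the coframe of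
  -- `S` that `φ` assigns to `x`.
  have hB : ∀ x, ∃ B : EuclideanSpace ℝ (Fin (2 * n + 1)) →L[ℝ] CoframeValue n,
      ∀ v, B (Dψ x v) = cof x v := by
    refine fun x => exists_clm_comp_eq_of_ker_le (hψ.mfderiv_surjective x) fun v hv => ?_
    obtain ⟨h1, h2⟩ := hψ_leaf x v hv
    ext (a | i)
    exacts [h1 a, h2 i]
  choose B hB using hB
  let φ : X → CoframeBundle n S := fun x => ⟨ψ x, B x⟩
  have hφ : ContMDiff (𝓡 N) (coframeModel n) ∞ φ := by
    intro x₀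
    rw [contMDiffAt_hom_trivial_iff]
    refine ⟨hψ.contMDiff x₀, ?_⟩
    let T (y : EuclideanSpace ℝ (Fin (2 * n + 1))) :
        EuclideanSpace ℝ (Fin (2 * n + 1)) →L[ℝ] EuclideanSpace ℝ (Fin (2 * n + 1)) :=
      mfderiv 𝓘(ℝ, EuclideanSpace ℝ (Fin (2 * n + 1))) (𝓡 (2 * n + 1))
        (extChartAt (𝓡 (2 * n + 1)) (ψ x₀)).symm y
    let b (x : X) : EuclideanSpace ℝ (Fin (2 * n + 1)) →L[ℝ] CoframeValue n :=
      (B x).comp (T (extChartAt (𝓡 (2 * n + 1)) (ψ x₀) (ψ x)))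
    change ContMDiffAt (𝓡 N) 𝓘(ℝ, EuclideanSpace ℝ (Fin (2 * n + 1)) →L[ℝ] CoframeValue n) ∞ b x₀
    have hb : ContDiffAt ℝ ∞ (fun z => b ((extChartAt (𝓡 N) x₀).symm z))
        (extChartAt (𝓡 N) x₀ x₀) := by
      refine contDiffAt_of_comp_eq
        (D := fderiv ℝ (mapInChart (K := N) (P := 2 * n + 1) ψ x₀)) (L := f.coframeInChart x₀)
        ((contDiffAt_mapInChart hψ.contMDiff x₀).fderiv_right (by simp))
        (hf.contDiffAt_coframeInChart isOpen_univ trivial) ?_ ?_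
      · intro w
        obtain ⟨v, hv⟩ := hψ.mfderiv_surjective x₀ w
        exact ⟨v, (fderiv_mapInChart_self hψ.contMDiff x₀ v).trans hv⟩
      · filter_upwards [eventually_mem_target_and_symm_mem (N := N) (x := x₀)
          ((isOpen_extChartAt_source (I := 𝓡 (2 * n + 1)) (ψ x₀)).preimage hψ.contMDiff.continuous)
          (mem_extChartAt_source (I := 𝓡 (2 * n + 1)) (ψ x₀))] with z ⟨hz, hzs⟩
        ext1 v
        rw [ContinuousLinearMap.comp_apply, fderiv_mapInChart hψ.contMDiff hz hzs,
          f.coframeInChart_apply]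
        refine Eq.trans ?_ (hB _ _)
        exact congrArg (B _) (mfderiv_extChartAt_symm_apply_mfderiv hzs _)
    rw [← contMDiffAt_iff_contDiffAt] at hb
    refine (hb.comp x₀ (contMDiffAt_extChartAt (n := ∞) (I := 𝓡 N) (x := x₀))
      ).congr_of_eventuallyEq ?_
    filter_upwards [extChartAt_source_mem_nhds (I := 𝓡 N) x₀] with x hx
    exact (congrArg b ((extChartAt (𝓡 N) x₀).left_inv hx)).symm
  refine ⟨φ, hφ, fun _ => rfl, fun x (v : EuclideanSpace ℝ (Fin N)) => ?_, ?_⟩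
  · have h1 := mfderiv_comp x ((Bundle.contMDiff_proj (n := ∞) (IB := 𝓡 (2 * n + 1))
      (F := EuclideanSpace ℝ (Fin (2 * n + 1)) →L[ℝ] CoframeValue n)
      (fun u : S => TangentSpace (𝓡 (2 * n + 1)) u →L[ℝ] Trivial S (CoframeValue n) u)
      (φ x)).mdifferentiableAt (by simp)) ((hφ x).mdifferentiableAt (by simp))
    let ev (L : EuclideanSpace ℝ (Fin N) →L[ℝ] EuclideanSpace ℝ (Fin (2 * n + 1))) :
      CoframeValue n := B x (L v)
    exact (congrArg ev h1).symm.trans (hB x v)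
  · intro U σ hU hσ hsec s hs
    refine CoframeBundle.mk_congr (hsec s hs) ?_
    ext1 w
    have h1 := mfderiv_apply_mfderiv_section hψ.contMDiff hU hσ hsec hs w
    refine (congrArg (B (σ s)) h1).symm.trans ((hB _ _).trans ?_)
    ext (a | i) <;> rfl

end CoframeLift

/-! ### Cartan's lemma and uniqueness of the connection forms -/

section CartanLemma

variable {n : ℕ} {E : Type*} [AddCommGroup E] [Module ℝ E]

/-- A trilinear array that is skew in the first two indices and symmetric in the last two
vanishes. -/
theorem eq_zero_of_skew_of_symm {ι : Type*} {b : ι → ι → ι → ℝ} (h1 : ∀ i j k, b i j k = - b j i k)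
    (h2 : ∀ i j k, b i j k = b i k j) (i j k : ι) : b i j k = 0 := by
  -- The six relations form the cycle `b_ijk = -b_jik = -b_jki = b_kji = b_kij = -b_ikj = -b_ijk`.
  have e1 := h1 i j k
  have e2 := h2 j i k
  have e3 := h1 j k i
  have e4 := h2 k j i
  have e5 := h1 k i j
  have e6 := h2 i k j
  linarith

/-- Uniqueness of the skew-symmetric forms in the Finsler structure equations. -/
theorem skew_forms_eq_zero_of_structure {η θ : Fin n → E →ₗ[ℝ] ℝ} {c : Fin n → Fin n → E →ₗ[ℝ] ℝ}
    {J : Fin n → Fin n → Fin n → ℝ} {e : Fin n → E} (hηe : ∀ i j, η i (e j) = if i = j then 1 else 0)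
    (hθe : ∀ i j, θ i (e j) = 0) (hc : ∀ i j, c i j = - c j i) (hJ : ∀ i j k, J i j k = J j i k)
    (h : ∀ i v w, ∑ j, (c i j v * η j w - c i j w * η j v) +
      ∑ j, ∑ k, J i j k * (θ k v * η j w - θ k w * η j v) = 0) (i j : Fin n) (v : E) :
    c i j v = 0 := by
  -- Absorbing the torsion turns the hypothesis into `∑ γ_ij ∧ η_j = 0`. By Cartan's lemma the
  -- `γ_ij` are combinations of the `η_l` with coefficients symmetric in `j, l`.
  let γ (i j : Fin n) (v : E) : ℝ := c i j v + ∑ k, J i j k * θ k v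
  have hγe : ∀ i j l, γ i j (e l) = c i j (e l) := fun i j l => by simp [γ, hθe]
  have hγ : ∀ i l v, γ i l v = ∑ j, c i j (e l) * η j v := by
    intro i l v
    have h1 := h i v (e l)
    simp only [hηe, hθe, mul_ite, mul_one, mul_zero, zero_mul, sub_zero, Finset.sum_sub_distrib,
      Finset.sum_ite_irrel, Finset.sum_const_zero, Finset.sum_ite_eq', Finset.mem_univ,
      if_true] at h1
    change c i l v + _ = _
    linarith
  have h3 : ∀ i l m, c i l (e m) = c i m (e l) := by
    intro i l m
    rw [← hγe, hγ]
    simp [hηe]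
  have h4 : ∀ i l m, c i l (e m) = 0 := fun i l m => eq_zero_of_skew_of_symm
    (b := fun i l m => c i l (e m)) (fun i j k => by rw [hc i j]; rfl) h3 i l m
  have h5 : ∀ i j, c i j v = - ∑ k, J i j k * θ k v := by
    intro i j
    have := hγ i j v
    simp only [h4, zero_mul, Finset.sum_const_zero] at this
    exact eq_neg_of_add_eq_zero_left this
  -- Here `c` is skew in `i, j`, while `∑ J_ijk θ_k` is symmetric; being opposite to each other,
  -- both vanish.
  have h6 := h5 i j
  have h7 := h5 j i
  have h8 : c i j v = - c j i v := by rw [hc i j]; rfl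
  simp only [hJ j i] at h7
  linarith

end CartanLemma

/-! ### First-order comparison of families of 1-forms -/

section FamiliesOfForms

variable {n : ℕ} {E : Type*} [NormedAddCommGroup E] [NormedSpace ℝ E]

/-- The exterior derivative of `∑ A_j β_j` on vectors annihilated by all the `β_j`. -/
theorem skew_fderiv_sum_smul {α : E → E →L[ℝ] ℝ} {β : Fin n → E → E →L[ℝ] ℝ} {A : Fin n → E → ℝ}
    {y : E} (hβ : ∀ j, DifferentiableAt ℝ (β j) y) (hA : ∀ j, DifferentiableAt ℝ (A j) y)
    (hα : α =ᶠ[nhds y] fun z => ∑ j, A j z • β j z) {v w : E} (hv : ∀ j, β j y v = 0)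
    (hw : ∀ j, β j y w = 0) :
    fderiv ℝ α y v w - fderiv ℝ α y w v =
      ∑ j, A j y * (fderiv ℝ (β j) y v w - fderiv ℝ (β j) y w v) := by
  have h1 := HasFDerivAt.fun_sum (u := Finset.univ) fun j _ =>
    (hA j).hasFDerivAt.smul (hβ j).hasFDerivAt
  have h2 : HasFDerivAt (fun z => ∑ j, A j z • β j z) _ y := h1
  rw [hα.fderiv_eq, h2.fderiv, ← sub_eq_zero]
  simp [hv, hw, ← Finset.sum_sub_distrib, mul_sub]

/-- Two families of forms with the same sum of squares that agree at a point differ to first order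
by an infinitesimal rotation. -/
theorem fderiv_sub_eq_rotation {α β : Fin n → E → E →L[ℝ] ℝ} {y : E}
    (hα : ∀ j, DifferentiableAt ℝ (α j) y) (hβ : ∀ j, DifferentiableAt ℝ (β j) y)
    (heq : ∀ j, α j y = β j y)
    (hsq : ∀ v, ∀ᶠ z in nhds y, ∑ j, (α j z v) ^ 2 = ∑ j, (β j z v) ^ 2) {e : Fin n → E}
    (he : ∀ i j, β i y (e j) = if i = j then 1 else 0) (w : E) :
    (∀ i j, fderiv ℝ (α i) y w (e j) - fderiv ℝ (β i) y w (e j) =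
      -(fderiv ℝ (α j) y w (e i) - fderiv ℝ (β j) y w (e i))) ∧
    ∀ i v, fderiv ℝ (α i) y w v - fderiv ℝ (β i) y w v =
      ∑ j, (fderiv ℝ (α i) y w (e j) - fderiv ℝ (β i) y w (e j)) * β j y v := by
  let D (i : Fin n) : E →L[ℝ] ℝ := fderiv ℝ (α i) y w - fderiv ℝ (β i) y w
  have hderiv : ∀ (α : Fin n → E → E →L[ℝ] ℝ) (_ : ∀ j, DifferentiableAt ℝ (α j) y) (v : E),
      fderiv ℝ (fun z => ∑ j, (α j z v) ^ 2) y w = ∑ j, 2 * (α j y v * fderiv ℝ (α j) y w v) := by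
    intro α hα v
    have h1 : ∀ j, HasFDerivAt (fun z => α j z v) ((fderiv ℝ (α j) y).flip v) y := by
      intro j
      have := (hα j).hasFDerivAt.clm_apply (hasFDerivAt_const v y)
      simpa using this
    have h2 := HasFDerivAt.fun_sum (u := Finset.univ) fun j _ => (h1 j).pow 2
    rw [h2.fderiv]
    simp [mul_assoc]
  -- The derivative along `w` of the equality of sums of squares. Polarized and evaluated on the
  -- dual vectors `e`, it makes the matrix `D i (e j)` skew.
  have hq : ∀ v, ∑ j, β j y v * D j v = 0 := by
    intro v
    have h1 := Filter.EventuallyEq.fderiv_eq (𝕜 := ℝ) (hsq v)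
    have h2 := congrArg (fun L => L w) h1
    simp only [hderiv α hα, hderiv β hβ, heq, ← Finset.mul_sum] at h2
    have h3 := mul_left_cancel₀ two_ne_zero h2
    rw [← sub_eq_zero, ← Finset.sum_sub_distrib] at h3
    rw [← h3]
    exact Finset.sum_congr rfl fun j _ => by simp only [D, _root_.sub_apply]; ring
  have hpol : ∀ v v', ∑ j, (β j y v * D j v' + β j y v' * D j v) = 0 := by
    intro v v'
    have h1 := hq (v + v')
    simp only [map_add] at h1
    have h2 : ∑ j, (β j y v + β j y v') * (D j v + D j v') =
        ∑ j, β j y v * D j v + ∑ j, β j y v' * D j v' +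
          ∑ j, (β j y v * D j v' + β j y v' * D j v) := by
      rw [← Finset.sum_add_distrib, ← Finset.sum_add_distrib]
      exact Finset.sum_congr rfl fun j _ => by ring
    rw [h2, hq, hq] at h1
    linarith
  have hk : ∀ k v, D k v = - ∑ j, β j y v * D j (e k) := by
    intro k v
    have h1 := hpol (e k) v
    simp only [he, Finset.sum_add_distrib, ite_mul, one_mul, zero_mul, Finset.sum_ite_eq',
      Finset.mem_univ, if_true] at h1
    exact eq_neg_of_add_eq_zero_left h1
  have hskew : ∀ i j, D i (e j) = - D j (e i) := by
    intro i j
    rw [hk i (e j)]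
    simp [he]
  refine ⟨hskew, fun i v => ?_⟩
  change D i v = ∑ j, D i (e j) * β j y v
  rw [hk, ← Finset.sum_neg_distrib]
  exact Finset.sum_congr rfl fun j _ => by rw [hskew i j]; ring

end FamiliesOfForms

theorem OneForm.d_eq_of_eqOn {N : ℕ} {X : Type*} [TopologicalSpace X]
    [ChartedSpace (EuclideanSpace ℝ (Fin N)) X] [IsManifold (𝓡 N) ∞ X] {α β : OneForm N X}
    {U : Set X} (hU : IsOpen U) (hα : α.SmoothOn U) (hβ : β.SmoothOn U) (h : ∀ x ∈ U, α x = β x)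
    {x : X} (hx : x ∈ U) (v w : TangentSpace (𝓡 N) x) : α.d x v w = β.d x v w := by
  have he : α.inChart x =ᶠ[nhds (extChartAt (𝓡 N) x x)] β.inChart x := by
    filter_upwards [eventually_mem_target_and_symm_mem hU hx] with y hy
    let T (L : EuclideanSpace ℝ (Fin N) →L[ℝ] ℝ) : EuclideanSpace ℝ (Fin N) →L[ℝ] ℝ :=
      L.comp (mfderiv 𝓘(ℝ, EuclideanSpace ℝ (Fin N)) (𝓡 N) (extChartAt (𝓡 N) x).symm y)
    exact congrArg T (h _ hy.2)
  rw [d_eq ((smoothOn_iff hU).1 hα x hx), d_eq ((smoothOn_iff hU).1 hβ x hx), he.fderiv_eq]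

/-! ### Uniqueness of `u*` and of the Hilbert form -/

section DualCovector

variable {n : ℕ} {M : Type*} [TopologicalSpace M]
  [ChartedSpace (EuclideanSpace ℝ (Fin (n + 1))) M] [IsManifold (𝓡 (n + 1)) ∞ M]
  {S : Type*} [TopologicalSpace S] [ChartedSpace (EuclideanSpace ℝ (Fin (2 * n + 1))) S]

/-- A covector is determined by its kernel and its value at one vector outside it, here `ι u`. -/
theorem IsDualCovector.unique {ι : S → TangentBundle (𝓡 (n + 1)) M} {u : S}
    {l l' : TangentSpace (𝓡 (n + 1)) (ι u).proj →L[ℝ] ℝ} (hl : IsDualCovector ι u l)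
    (hl' : IsDualCovector ι u l') : l = l' := by
  ext v
  have h1 : v - l v • (ι u).snd ∈ LinearMap.ker l.toLinearMap := by
    rw [LinearMap.mem_ker]
    change l (v - l v • (ι u).snd) = 0
    rw [map_sub, map_smul, hl.2, smul_eq_mul, mul_one, sub_self]
  rw [hl.1, ← hl'.1, LinearMap.mem_ker] at h1
  change l' (v - l v • (ι u).snd) = 0 at h1
  rw [map_sub, map_smul, hl'.2, smul_eq_mul, mul_one, sub_eq_zero] at h1
  exact h1.symm

theorem IsHilbertFormAt.unique {ι : S → TangentBundle (𝓡 (n + 1)) M} {u : S}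
    {α β : TangentSpace (𝓡 (2 * n + 1)) u →L[ℝ] ℝ} (hα : IsHilbertFormAt ι u α)
    (hβ : IsHilbertFormAt ι u β) : α = β := by
  obtain ⟨l, hl, hlα⟩ := hα
  obtain ⟨l', hl', hlβ⟩ := hβ
  have h := hl.unique hl'
  subst h
  ext w
  rw [hlα, hlβ]

end DualCovector

/-! ### Orthogonality of the change between two adapted coframings -/

namespace FinslerForms

variable {n : ℕ} {S : Type*} [TopologicalSpace S]
  [ChartedSpace (EuclideanSpace ℝ (Fin (2 * n + 1))) S] [IsManifold (𝓡 (2 * n + 1)) ∞ S]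

/-- If the Reeb dual of `ω_0` is the same, the forms `ω_i` of two solutions of the structure
equations are related by a matrix. -/
theorem IsFinslerOn.omega_succ_eq_sum {f g : FinslerForms n (2 * n + 1) S} {U : Set S}
    (hU : IsOpen U) (hf : f.IsFinslerOn U) (hg : g.IsFinslerOn U)
    (h0 : ∀ s ∈ U, f.omega 0 s = g.omega 0 s)
    (hvert : ∀ s ∈ U, ∀ w : TangentSpace (𝓡 (2 * n + 1)) s,
      (∀ a, g.omega a s w = 0) → ∀ a, f.omega a s w = 0) {s : S} (hs : s ∈ U)
    {h e : Fin n → EuclideanSpace ℝ (Fin (2 * n + 1))} (hh : ∀ a k, g.omega a s (h k) = 0)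
    (hhθ : ∀ j k, g.theta j s (h k) = if j = k then 1 else 0)
    (he : ∀ j k : Fin n, g.omega j.succ s (e k) = if j = k then 1 else 0)
    (w : EuclideanSpace ℝ (Fin (2 * n + 1))) :
    (∀ k : Fin n, g.omega k.succ s w = ∑ j : Fin n, f.theta j s (h k) * f.omega j.succ s w) ∧
      ∀ i : Fin n, f.omega i.succ s w = ∑ j : Fin n, f.omega i.succ s (e j) * g.omega j.succ s w := by
  let fo (a : Fin (n + 1)) : EuclideanSpace ℝ (Fin (2 * n + 1)) →L[ℝ] ℝ := f.omega a s
  let go (a : Fin (n + 1)) : EuclideanSpace ℝ (Fin (2 * n + 1)) →L[ℝ] ℝ := g.omega a s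
  let ft (i : Fin n) : EuclideanSpace ℝ (Fin (2 * n + 1)) →L[ℝ] ℝ := f.theta i s
  have h1 : ∀ (w : EuclideanSpace ℝ (Fin (2 * n + 1))) k,
      go k.succ w = ∑ j : Fin n, ft j (h k) * fo j.succ w := by
    intro w k
    have hd := OneForm.d_eq_of_eqOn hU (hf.smooth_omega 0) (hg.smooth_omega 0) h0 hs (h k) w
    have hd' := neg_inj.1 (((hf.structureEquations s hs).d_omega_zero
      (hvert s hs _ fun a => hh a k) w).symm.trans
      (hd.trans ((hg.structureEquations s hs).d_omega_zero (fun a => hh a k) w)))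
    refine Eq.trans ?_ hd'.symm
    simp only [hhθ, ite_mul, one_mul, zero_mul, Finset.sum_ite_eq', Finset.mem_univ, if_true]
    rfl
  -- Evaluating the relation just found on the `e l` gives `T A = 1`. The matrices are square, so
  -- also `A T = 1`, and the `f.omega i.succ` vanish wherever the `g.omega k.succ` do.
  let T : Matrix (Fin n) (Fin n) ℝ := fun k j => ft j (h k)
  let A : Matrix (Fin n) (Fin n) ℝ := fun i l => fo i.succ (e l)
  have hTA : T * A = 1 := by
    ext k l
    rw [Matrix.mul_apply, Matrix.one_apply]
    exact (h1 (e l) k).symm.trans (he k l)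
  have hAT : A * T = 1 := mul_eq_one_comm.1 hTA
  have h2 : ∀ (w : EuclideanSpace ℝ (Fin (2 * n + 1))), (∀ k : Fin n, go k.succ w = 0) →
      ∀ i : Fin n, fo i.succ w = 0 := by
    intro w hw
    have h3 : T.mulVec (fun i => fo i.succ w) = 0 := by
      ext k
      exact (h1 w k).symm.trans (hw k)
    have h4 : (A * T).mulVec (fun i => fo i.succ w) = 0 := by
      rw [← Matrix.mulVec_mulVec, h3, Matrix.mulVec_zero]
    rw [hAT, Matrix.one_mulVec] at h4
    exact congrFun h4
  refine ⟨h1 w, fun i => ?_⟩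
  have h5 := h2 (w - ∑ j : Fin n, go j.succ w • e j) (fun k => by
    have he' : ∀ j k : Fin n, go j.succ (e k) = if j = k then 1 else 0 := he
    simp [map_sub, map_sum, he']) i
  rw [map_sub, sub_eq_zero, map_sum] at h5
  refine h5.trans (Finset.sum_congr rfl fun j _ => ?_)
  rw [map_smul, smul_eq_mul, mul_comm]
  rfl

/-- The quadratic form `∑ ω_i²` is determined by `ω_0` and the foliation `ω_a = 0`. -/
theorem IsFinslerOn.sum_sq_eq {f g : FinslerForms n (2 * n + 1) S} {U : Set S}
    (hU : IsOpen U) (hf : f.IsFinslerOn U) (hg : g.IsFinslerOn U)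
    (h0 : ∀ s ∈ U, f.omega 0 s = g.omega 0 s)
    (hvert : ∀ s ∈ U, ∀ w : TangentSpace (𝓡 (2 * n + 1)) s,
      (∀ a, g.omega a s w = 0) → ∀ a, f.omega a s w = 0) {s : S} (hs : s ∈ U)
    (w : EuclideanSpace ℝ (Fin (2 * n + 1))) :
    ∑ i : Fin n, (f.omega i.succ s w) ^ 2 = ∑ i : Fin n, (g.omega i.succ s w) ^ 2 := by
  let y₀ := extChartAt (𝓡 (2 * n + 1)) s s
  have hdom := eventually_mem_target_and_symm_mem (N := 2 * n + 1) hU hs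
  have hC : ∀ᶠ y in nhds y₀, ∀ b, g.coframeInChart s y (g.dualInChart s b y) = Pi.single b 1 := by
    filter_upwards [hdom] with y hy b
    exact coframeInChart_dualInChart (hg.isInvertible_coframeInChart s hy.1 hy.2) b
  have hrel : ∀ᶠ y in nhds y₀, ∀ (i : Fin n) (w : EuclideanSpace ℝ (Fin (2 * n + 1))),
      (∀ k : Fin n, (g.omega k.succ).inChart s y w = ∑ j : Fin n,
        (f.theta j).inChart s y (g.dualInChart s (Sum.inr k) y) * (f.omega j.succ).inChart s y w) ∧
      (f.omega i.succ).inChart s y w = ∑ j : Fin n, (f.omega i.succ).inChart s y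
        (g.dualInChart s (Sum.inl j.succ) y) * (g.omega j.succ).inChart s y w := by
    filter_upwards [hdom, hC] with y hy hCy i w
    let B : EuclideanSpace ℝ (Fin (2 * n + 1)) →L[ℝ] EuclideanSpace ℝ (Fin (2 * n + 1)) :=
      mfderiv 𝓘(ℝ, EuclideanSpace ℝ (Fin (2 * n + 1))) (𝓡 (2 * n + 1))
        (extChartAt (𝓡 (2 * n + 1)) s).symm y
    have h := hf.omega_succ_eq_sum hU hg h0 hvert hy.2
      (h := fun k => B (g.dualInChart s (Sum.inr k) y))
      (e := fun k => B (g.dualInChart s (Sum.inl k.succ) y))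
      (fun a k => (congrFun (hCy (Sum.inr k)) (Sum.inl a)).trans (by simp))
      (fun j k => (congrFun (hCy (Sum.inr k)) (Sum.inr j)).trans (by simp [Pi.single_apply]))
      (fun j k => (congrFun (hCy (Sum.inl k.succ)) (Sum.inl j.succ)).trans
        (by simp [Pi.single_apply])) (B w)
    exact ⟨h.1, h.2 i⟩
  have hsm : ∀ {k : FinslerForms n (2 * n + 1) S} (_ : k.IsFinslerOn U) (a : Fin (n + 1)),
      DifferentiableAt ℝ ((k.omega a).inChart s) y₀ := fun hk a =>
    ContDiffAt.differentiableAt ((OneForm.smoothOn_iff hU).1 (hk.smooth_omega a) s hs) (by simp)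
  let A (i j : Fin n) (y : EuclideanSpace ℝ (Fin (2 * n + 1))) : ℝ :=
    (f.omega i.succ).inChart s y (g.dualInChart s (Sum.inl j.succ) y)
  have hA : ∀ i j, DifferentiableAt ℝ (A i j) y₀ := fun i j => (hsm hf i.succ).clm_apply
    ((hg.contDiffAt_dualInChart hU hs _).differentiableAt (by simp))
  have hself : ∀ (α : OneForm (2 * n + 1) S) v, α s v = α.inChart s y₀ v :=
    fun α v => (α.inChart_self s v).symm
  let h (k : Fin n) := g.dualInChart s (Sum.inr k) y₀
  let e₀ := g.dualInChart s (Sum.inl 0) y₀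
  have hC0 := hC.self_of_nhds
  have hgh : ∀ a k, (g.omega a).inChart s y₀ (h k) = 0 := fun a k =>
    (congrFun (hC0 (Sum.inr k)) (Sum.inl a)).trans (by simp)
  have hge : ∀ i : Fin n, (g.omega i.succ).inChart s y₀ e₀ = 0 := fun i =>
    (congrFun (hC0 (Sum.inl 0)) (Sum.inl i.succ)).trans (by simp)
  have hge0 : g.omega 0 s e₀ = 1 := (hself _ _).trans
    ((congrFun (hC0 (Sum.inl 0)) (Sum.inl 0)).trans (by simp))
  have hfe : ∀ i : Fin n, f.omega i.succ s e₀ = 0 := fun i => (hself _ _).trans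
    (((hrel.self_of_nhds i e₀).2).trans (by simp [hge]))
  -- Contract `df.ω_i` with `h k` and with the vector dual to `ω_0`. The equations of `f` give
  -- `f.theta i` on `h k`; expanding `f.ω_i = ∑ A_ij g.ω_j` and using the equations of `g` gives
  -- `A_ik`. So the inverse of `A` is its transpose.
  have hTA : ∀ i k, (f.theta i).inChart s y₀ (h k) = A i k y₀ := by
    intro i k
    have h1 := skew_fderiv_sum_smul (α := (f.omega i.succ).inChart s)
      (β := fun j : Fin n => (g.omega j.succ).inChart s) (A := A i) (fun j => hsm hg _) (hA i)
      (by
        filter_upwards [hrel] with y hy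
        ext v
        simp only [_root_.sum_apply, _root_.smul_apply, smul_eq_mul]
        exact (hy i v).2) (v := h k) (w := e₀) (fun j => hgh _ k) hge
    have hdeq : ∀ {α : OneForm (2 * n + 1) S}, α.SmoothOn U → ∀ v w : EuclideanSpace ℝ _,
        fderiv ℝ (α.inChart s) y₀ v w - fderiv ℝ (α.inChart s) y₀ w v = α.d s v w :=
      fun hα v w => (OneForm.d_eq ((OneForm.smoothOn_iff hU).1 hα s hs) v w).symm
    have hghs : ∀ a, g.omega a s (h k) = 0 := fun a => (hself _ _).trans (hgh a k)
    have h2 : ∀ j, (g.theta j).inChart s y₀ (h k) = if j = k then 1 else 0 := fun j =>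
      (congrFun (hC0 (Sum.inr k)) (Sum.inr j)).trans (by simp [Pi.single_apply])
    have hf0 : f.omega 0 s e₀ = 1 := (congrArg (fun L => L e₀) (h0 s hs)).trans hge0
    rw [hdeq (hf.smooth_omega _), (hf.structureEquations s hs).d_omega_succ
      (hvert s hs _ hghs) i hfe, hf0, mul_one] at h1
    have h3 : ∀ j : Fin n, fderiv ℝ ((g.omega j.succ).inChart s) y₀ (h k) e₀ -
        fderiv ℝ ((g.omega j.succ).inChart s) y₀ e₀ (h k) = if j = k then 1 else 0 := by
      intro j
      rw [hdeq (hg.smooth_omega _), (hg.structureEquations s hs).d_omega_succ hghs j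
        (fun i => (hself _ _).trans (hge i)), hge0, mul_one]
      exact (hself _ _).trans (h2 j)
    refine (hself _ _).symm.trans (h1.trans ?_)
    simp [h3]
  have h1 : ∀ k : Fin n, (g.omega k.succ).inChart s y₀ w =
      ∑ j : Fin n, A j k y₀ * (f.omega j.succ).inChart s y₀ w := by
    intro k
    refine ((hrel.self_of_nhds k w).1 k).trans (Finset.sum_congr rfl fun j _ => ?_)
    rw [← hTA j k]
  have h2 : ∀ i : Fin n, (f.omega i.succ).inChart s y₀ w =
      ∑ j : Fin n, A i j y₀ * (g.omega j.succ).inChart s y₀ w :=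
    fun i => (hrel.self_of_nhds i w).2
  refine ((Finset.sum_congr rfl fun i _ => congrArg (· ^ 2) (hself (f.omega i.succ) w)).trans
    ?_).trans (Finset.sum_congr rfl fun i _ => congrArg (· ^ 2) (hself (g.omega i.succ) w)).symm
  calc ∑ i : Fin n, ((f.omega i.succ).inChart s y₀ w) ^ 2
      = ∑ i : Fin n, (f.omega i.succ).inChart s y₀ w *
          ∑ j : Fin n, A i j y₀ * (g.omega j.succ).inChart s y₀ w :=
        Finset.sum_congr rfl fun i _ => by rw [← h2, sq]
    _ = ∑ j : Fin n, (g.omega j.succ).inChart s y₀ w *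
          ∑ i : Fin n, A i j y₀ * (f.omega i.succ).inChart s y₀ w := by
        simp only [Finset.mul_sum]
        rw [Finset.sum_comm]
        exact Finset.sum_congr rfl fun i _ => Finset.sum_congr rfl fun j _ => by ring
    _ = ∑ i : Fin n, ((g.omega i.succ).inChart s y₀ w) ^ 2 :=
        Finset.sum_congr rfl fun i _ => by rw [← h1, sq]

end FinslerForms

/-! ### Dependence of the connection forms on the 1-jet of the coframing -/

namespace FinslerForms

variable {n : ℕ} {S : Type*} [TopologicalSpace S]
  [ChartedSpace (EuclideanSpace ℝ (Fin (2 * n + 1))) S] [IsManifold (𝓡 (2 * n + 1)) ∞ S]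

/-- How the connection forms depend on the 1-jet of the coframe at a point. -/
theorem IsFinslerOn.conn_eq_sub {f g : FinslerForms n (2 * n + 1) S} {U : Set S}
    (hU : IsOpen U) (hf : f.IsFinslerOn U) (hg : g.IsFinslerOn U)
    (hsq : ∀ s ∈ U, ∀ w : TangentSpace (𝓡 (2 * n + 1)) s,
      ∑ i : Fin n, (f.omega i.succ s w) ^ 2 = ∑ i : Fin n, (g.omega i.succ s w) ^ 2)
    {s : S} (hs : s ∈ U) (hfg : f.coframe s = g.coframe s) (i j : Fin n)
    (w : EuclideanSpace ℝ (Fin (2 * n + 1))) :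
    f.conn i j s w = g.conn i j s w -
      (fderiv ℝ (f.coframeInChart s) (extChartAt (𝓡 (2 * n + 1)) s s) w -
        fderiv ℝ (g.coframeInChart s) (extChartAt (𝓡 (2 * n + 1)) s s) w)
        (g.dualInChart s (Sum.inl j.succ) (extChartAt (𝓡 (2 * n + 1)) s s)) (Sum.inl i.succ) := by
  set y₀ := extChartAt (𝓡 (2 * n + 1)) s s with hy₀
  have hdom := eventually_mem_target_and_symm_mem (N := 2 * n + 1) hU hs
  have hsm : ∀ {k : FinslerForms n (2 * n + 1) S} (_ : k.IsFinslerOn U) (a : Fin (n + 1)),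
      DifferentiableAt ℝ ((k.omega a).inChart s) y₀ := fun hk a =>
    ContDiffAt.differentiableAt ((OneForm.smoothOn_iff hU).1 (hk.smooth_omega a) s hs) (by simp)
  have hdC : ∀ {k : FinslerForms n (2 * n + 1) S} (_ : k.IsFinslerOn U) (a : Fin (n + 1))
      (v w : EuclideanSpace ℝ (Fin (2 * n + 1))),
      fderiv ℝ (k.coframeInChart s) y₀ w v (Sum.inl a) =
        fderiv ℝ ((k.omega a).inChart s) y₀ w v := by
    intro k hk a v w
    have h1 : DifferentiableAt ℝ (k.coframeInChart s) y₀ :=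
      (hk.contDiffAt_coframeInChart hU hs).differentiableAt (by simp)
    have h2 := ((ContinuousLinearMap.compL ℝ (EuclideanSpace ℝ (Fin (2 * n + 1)))
      (CoframeValue n) ℝ (ContinuousLinearMap.proj (Sum.inl a))).hasFDerivAt).comp y₀ h1.hasFDerivAt
    have h3 : HasFDerivAt ((k.omega a).inChart s) _ y₀ := h2
    rw [h3.fderiv]
    rfl
  let e (j : Fin n) := g.dualInChart s (Sum.inl j.succ) y₀
  have hC0 : ∀ b, g.coframeInChart s y₀ (g.dualInChart s b y₀) = Pi.single b 1 := fun b =>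
    coframeInChart_dualInChart (hg.isInvertible_coframeInChart s hdom.self_of_nhds.1
      hdom.self_of_nhds.2) b
  have hge : ∀ i j : Fin n, (g.omega i.succ).inChart s y₀ (e j) = if i = j then 1 else 0 :=
    fun i j => (congrFun (hC0 (Sum.inl j.succ)) (Sum.inl i.succ)).trans (by simp [Pi.single_apply])
  have hθe : ∀ i j : Fin n, (g.theta i).inChart s y₀ (e j) = 0 :=
    fun i j => (congrFun (hC0 (Sum.inl j.succ)) (Sum.inr i)).trans (by simp)
  have hcf : ∀ v : EuclideanSpace ℝ (Fin (2 * n + 1)),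
      f.coframeInChart s y₀ v = g.coframeInChart s y₀ v := fun v =>
    (f.coframeInChart_self s v).trans ((congrArg (fun L => L v) hfg).trans
      (g.coframeInChart_self s v).symm)
  have hω : ∀ a v, (f.omega a).inChart s y₀ v = (g.omega a).inChart s y₀ v :=
    fun a v => congrFun (hcf v) (Sum.inl a)
  have hθ : ∀ i v, (f.theta i).inChart s y₀ v = (g.theta i).inChart s y₀ v :=
    fun i v => congrFun (hcf v) (Sum.inr i)
  -- The coframings agree at `s` and share `∑ ω_i²` near `s`, so their first derivatives differ by
  -- the skew matrix of forms called `a` below.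
  have hrot := fderiv_sub_eq_rotation (α := fun j : Fin n => (f.omega j.succ).inChart s)
    (β := fun j : Fin n => (g.omega j.succ).inChart s) (fun j => hsm hf _) (fun j => hsm hg _)
    (fun j => ContinuousLinearMap.ext (hω _)) (fun v => by
      filter_upwards [hdom] with z hz using hsq _ hz.2 _) (e := e) hge
  let a (i j : Fin n) : EuclideanSpace ℝ (Fin (2 * n + 1)) →ₗ[ℝ] ℝ :=
    (((fderiv ℝ ((f.omega i.succ).inChart s) y₀).flip (e j)) -
      ((fderiv ℝ ((g.omega i.succ).inChart s) y₀).flip (e j))).toLinearMap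
  have ha : ∀ i j w, a i j w = fderiv ℝ ((f.omega i.succ).inChart s) y₀ w (e j) -
    fderiv ℝ ((g.omega i.succ).inChart s) y₀ w (e j) := fun i j w => rfl
  let om (i : Fin n) : EuclideanSpace ℝ (Fin (2 * n + 1)) →ₗ[ℝ] ℝ :=
    ((g.omega i.succ).inChart s y₀).toLinearMap
  let th (i : Fin n) : EuclideanSpace ℝ (Fin (2 * n + 1)) →ₗ[ℝ] ℝ :=
    ((g.theta i).inChart s y₀).toLinearMap
  let fc (i j : Fin n) : EuclideanSpace ℝ (Fin (2 * n + 1)) →ₗ[ℝ] ℝ :=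
    ((f.conn i j).inChart s y₀).toLinearMap
  let gc (i j : Fin n) : EuclideanSpace ℝ (Fin (2 * n + 1)) →ₗ[ℝ] ℝ :=
    ((g.conn i j).inChart s y₀).toLinearMap
  have hself : ∀ (α : OneForm (2 * n + 1) S) v, α s v = α.inChart s y₀ v :=
    fun α v => (α.inChart_self s v).symm
  have hskew : ∀ {k : FinslerForms n (2 * n + 1) S} (_ : k.IsFinslerOn U) (i j : Fin n)
      (v : EuclideanSpace ℝ (Fin (2 * n + 1))),
      (k.conn i j).inChart s y₀ v = - (k.conn j i).inChart s y₀ v := by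
    intro k hk i j v
    have h1 := congrArg (fun L => L v) (hk.conn_skew s hs i j)
    exact (hself _ _).symm.trans (h1.trans (congrArg Neg.neg (hself _ _)))
  have hstr : ∀ {k : FinslerForms n (2 * n + 1) S} (_ : k.IsFinslerOn U) (i : Fin n)
      (v w : EuclideanSpace ℝ (Fin (2 * n + 1))),
      fderiv ℝ ((k.omega i.succ).inChart s) y₀ v w - fderiv ℝ ((k.omega i.succ).inChart s) y₀ w v =
      ((k.theta i).inChart s y₀ v * (k.omega 0).inChart s y₀ w -
        (k.theta i).inChart s y₀ w * (k.omega 0).inChart s y₀ v)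
      - ∑ j : Fin n, ((k.conn i j).inChart s y₀ v * (k.omega j.succ).inChart s y₀ w -
        (k.conn i j).inChart s y₀ w * (k.omega j.succ).inChart s y₀ v)
      - ∑ j : Fin n, ∑ l : Fin n, k.tor i j l s *
        ((k.theta l).inChart s y₀ v * (k.omega j.succ).inChart s y₀ w -
        (k.theta l).inChart s y₀ w * (k.omega j.succ).inChart s y₀ v) := by
    intro k hk i v w
    refine (OneForm.d_eq ((OneForm.smoothOn_iff hU).1 (hk.smooth_omega i.succ) s hs) v w).symm.trans
      (((hk.structureEquations s hs).2 i v w).trans ?_)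
    simp only [OneForm.wedge]
    congr 1
    · congr 1
      · exact congrArg₂ (· - ·) (congrArg₂ (· * ·) (hself _ v) (hself _ w))
          (congrArg₂ (· * ·) (hself _ w) (hself _ v))
      · exact Finset.sum_congr rfl fun j _ => congrArg₂ (· - ·)
          (congrArg₂ (· * ·) (hself _ v) (hself _ w)) (congrArg₂ (· * ·) (hself _ w) (hself _ v))
    · exact Finset.sum_congr rfl fun j _ => Finset.sum_congr rfl fun l _ => congrArg _
        (congrArg₂ (· - ·)
          (congrArg₂ (· * ·) (hself _ v) (hself _ w)) (congrArg₂ (· * ·) (hself _ w) (hself _ v)))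
  -- Subtracting the two systems of structure equations at `s` shows that the skew forms `fc - gc +
  -- a` solve the homogeneous system with torsion `f.tor - g.tor`; uniqueness makes them zero.
  have key := skew_forms_eq_zero_of_structure (η := om) (θ := th)
    (c := fun i j => fc i j - gc i j + a i j) (J := fun i j k => f.tor i j k s - g.tor i j k s)
    (e := e) hge hθe (fun i j => by
      ext v
      have h1 := hskew hf i j v
      have h2 := hskew hg i j v
      have h3 := (hrot v).1 i j
      simp only [LinearMap.add_apply, LinearMap.sub_apply, LinearMap.neg_apply, ha, fc, gc,
        ContinuousLinearMap.coe_coe]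
      linarith) (fun i j k => by rw [hf.tor_symm s hs, hg.tor_symm s hs]) (fun i v w => by
      have h1 := hstr hf i v w
      have h2 := hstr hg i v w
      simp only [hω, hθ] at h1
      have h3 := (hrot v).2 i w
      have h4 := (hrot w).2 i v
      have h5 : ∑ j, ((fc i j - gc i j + a i j) v * om j w - (fc i j - gc i j + a i j) w * om j v) =
          ∑ j, (fc i j v * om j w - fc i j w * om j v) -
          ∑ j, (gc i j v * om j w - gc i j w * om j v) +
          (∑ j, a i j v * om j w - ∑ j, a i j w * om j v) := by
        rw [← Finset.sum_sub_distrib, ← Finset.sum_sub_distrib, ← Finset.sum_add_distrib]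
        refine Finset.sum_congr rfl fun j _ => ?_
        simp only [LinearMap.add_apply, LinearMap.sub_apply]
        ring
      have h6 : ∑ j, ∑ k, (f.tor i j k s - g.tor i j k s) * (th k v * om j w - th k w * om j v) =
          ∑ j, ∑ k, f.tor i j k s * (th k v * om j w - th k w * om j v) -
          ∑ j, ∑ k, g.tor i j k s * (th k v * om j w - th k w * om j v) := by
        simp only [← Finset.sum_sub_distrib, sub_mul]
      change _ = ∑ j, a i j v * om j w at h3
      change _ = ∑ j, a i j w * om j v at h4
      change _ = _ - ∑ j, (fc i j v * om j w - fc i j w * om j v) -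
        ∑ j, ∑ k, f.tor i j k s * (th k v * om j w - th k w * om j v) at h1
      change _ = _ - ∑ j, (gc i j v * om j w - gc i j w * om j v) -
        ∑ j, ∑ k, g.tor i j k s * (th k v * om j w - th k w * om j v) at h2
      rw [h5, h6]
      linarith) i j w
  have h1 : f.conn i j s w = fc i j w := hself _ _
  have h2 : g.conn i j s w = gc i j w := hself _ _
  refine h1.trans (Eq.trans ?_ (congrArg (· - _) h2.symm))
  simp only [_root_.sub_apply, Pi.sub_apply, hdC hf, hdC hg]
  rw [← ha i j w]
  simp only [LinearMap.add_apply, LinearMap.sub_apply] at key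
  linarith

end FinslerForms

/-! ### The connection forms on the canonical `O(n)`-structure -/

section CoframeBundleCharts

variable {n : ℕ} {S : Type*} [TopologicalSpace S]
  [ChartedSpace (EuclideanSpace ℝ (Fin (2 * n + 1))) S] [IsManifold (𝓡 (2 * n + 1)) ∞ S]

theorem extChartAt_coframeBundle_apply (p q : CoframeBundle n S)
    (hq : q.proj ∈ (extChartAt (𝓡 (2 * n + 1)) p.proj).source) :
    extChartAt (coframeModel n) p q = (extChartAt (𝓡 (2 * n + 1)) p.proj q.proj,
      (q.snd : EuclideanSpace ℝ (Fin (2 * n + 1)) →L[ℝ] CoframeValue n).comp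
        (mfderiv 𝓘(ℝ, EuclideanSpace ℝ (Fin (2 * n + 1))) (𝓡 (2 * n + 1))
          (extChartAt (𝓡 (2 * n + 1)) p.proj).symm (extChartAt (𝓡 (2 * n + 1)) p.proj q.proj) :
          EuclideanSpace ℝ (Fin (2 * n + 1)) →L[ℝ] EuclideanSpace ℝ (Fin (2 * n + 1)))) := by
  rw [extChartAt_source] at hq
  rw [FiberBundle.extChartAt]
  ext1
  · simp [hom_trivializationAt_apply]
  · ext v
    simp [hom_trivializationAt_apply, ContinuousLinearMap.inCoordinates,
      TangentBundle.symmL_trivializationAt hq]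
    rfl

namespace FinslerForms

theorem IsFinslerOn.contMDiffAt_toSection {f : FinslerForms n (2 * n + 1) S} {U : Set S}
    (hf : f.IsFinslerOn U) (hU : IsOpen U) {s : S} (hs : s ∈ U) :
    ContMDiffAt (𝓡 (2 * n + 1)) (coframeModel n) ∞ f.toSection s := by
  refine (contMDiffAt_hom_section_iff (V := CoframeValue n) (fun x => f.coframe x) s).2 ?_
  refine (hf.contDiffAt_coframeInChart hU hs).congr_of_eventuallyEq
    (Filter.Eventually.of_forall fun y => ?_)
  ext1 v
  exact (f.coframeInChart_apply s y v).symm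

/-- The second component is the derivative that occurs in `conn_eq_sub`: the tangent vector of a
section carries all of the 1-jet of the coframing on which its connection forms depend. -/
theorem IsFinslerOn.mfderiv_toSection {f : FinslerForms n (2 * n + 1) S} {U : Set S}
    (hf : f.IsFinslerOn U) (hU : IsOpen U) {s : S} (hs : s ∈ U)
    (w : EuclideanSpace ℝ (Fin (2 * n + 1))) :
    mfderiv (𝓡 (2 * n + 1)) (coframeModel n) f.toSection s w =
      ((w, fderiv ℝ (f.coframeInChart s) (extChartAt (𝓡 (2 * n + 1)) s s) w) :
        EuclideanSpace ℝ (Fin (2 * n + 1)) ×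
          (EuclideanSpace ℝ (Fin (2 * n + 1)) →L[ℝ] CoframeValue n)) := by
  have h1 := ((hf.contMDiffAt_toSection hU hs).mdifferentiableAt (by simp)).mfderiv
  rw [ModelWithCorners.range_eq_univ, fderivWithin_univ] at h1
  have hw : writtenInExtChartAt (𝓡 (2 * n + 1)) (coframeModel n) s f.toSection
      =ᶠ[nhds (extChartAt (𝓡 (2 * n + 1)) s s)] fun y => (y, f.coframeInChart s y) := by
    filter_upwards [extChartAt_target_mem_nhds_self s
      (mem_extChartAt_target (I := 𝓡 (2 * n + 1)) s)] with y hy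
    have hyr : extChartAt (𝓡 (2 * n + 1)) s ((extChartAt (𝓡 (2 * n + 1)) s).symm y) = y :=
      (extChartAt (𝓡 (2 * n + 1)) s).right_inv hy
    refine (extChartAt_coframeBundle_apply (f.toSection s)
      (f.toSection ((extChartAt (𝓡 (2 * n + 1)) s).symm y))
      ((extChartAt (𝓡 (2 * n + 1)) s).map_target hy)).trans (Prod.ext hyr ?_)
    ext1 v
    let T (z : EuclideanSpace ℝ (Fin (2 * n + 1))) :
        EuclideanSpace ℝ (Fin (2 * n + 1)) →L[ℝ] EuclideanSpace ℝ (Fin (2 * n + 1)) :=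
      mfderiv 𝓘(ℝ, EuclideanSpace ℝ (Fin (2 * n + 1))) (𝓡 (2 * n + 1))
        (extChartAt (𝓡 (2 * n + 1)) s).symm z
    refine Eq.trans ?_ (f.coframeInChart_apply s y v).symm
    exact congrArg (fun z => f.coframe ((extChartAt (𝓡 (2 * n + 1)) s).symm y) (T z v)) hyr
  have h2 : HasFDerivAt (fun y => (y, f.coframeInChart s y))
      ((ContinuousLinearMap.id ℝ _).prod
        (fderiv ℝ (f.coframeInChart s) (extChartAt (𝓡 (2 * n + 1)) s s)))
      (extChartAt (𝓡 (2 * n + 1)) s s) :=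
    (hasFDerivAt_id _).prodMk
      ((hf.contDiffAt_coframeInChart hU hs).differentiableAt (by simp)).hasFDerivAt
  rw [hw.fderiv_eq, h2.fderiv] at h1
  exact congrArg (fun L => L w) h1

/-- The value at the point `⟨s, g.coframe s⟩` of the connection form `θ_{ij}` on the canonical
`O(n)`-structure, computed from the adapted coframing `g`. -/
noncomputable def connectionFormAt (g : FinslerForms n (2 * n + 1) S) (s : S) (i j : Fin n) :
    EuclideanSpace ℝ (Fin (2 * n + 1)) ×
      (EuclideanSpace ℝ (Fin (2 * n + 1)) →L[ℝ] CoframeValue n) →L[ℝ] ℝ :=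
  let y₀ := extChartAt (𝓡 (2 * n + 1)) s s
  let c : EuclideanSpace ℝ (Fin (2 * n + 1)) →L[ℝ] ℝ := g.conn i j s
  let ev : (EuclideanSpace ℝ (Fin (2 * n + 1)) →L[ℝ] CoframeValue n) →L[ℝ] ℝ :=
    (ContinuousLinearMap.proj (R := ℝ) (φ := fun _ : Fin (n + 1) ⊕ Fin n => ℝ)
      (Sum.inl i.succ)).comp
      (ContinuousLinearMap.apply ℝ (CoframeValue n) (g.dualInChart s (Sum.inl j.succ) y₀))
  c.comp (ContinuousLinearMap.fst ℝ _ _) - ev.comp (ContinuousLinearMap.snd ℝ _ _ -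
    (fderiv ℝ (g.coframeInChart s) y₀).comp (ContinuousLinearMap.fst ℝ _ _))

omit [IsManifold (𝓡 (2 * n + 1)) ∞ S] in
theorem connectionFormAt_apply (g : FinslerForms n (2 * n + 1) S) (s : S) (i j : Fin n)
    (w : EuclideanSpace ℝ (Fin (2 * n + 1)))
    (A : EuclideanSpace ℝ (Fin (2 * n + 1)) →L[ℝ] CoframeValue n) :
    g.connectionFormAt s i j (w, A) = g.conn i j s w -
      (A - fderiv ℝ (g.coframeInChart s) (extChartAt (𝓡 (2 * n + 1)) s s) w)
        (g.dualInChart s (Sum.inl j.succ) (extChartAt (𝓡 (2 * n + 1)) s s)) (Sum.inl i.succ) := rfl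

end FinslerForms

open Classical in
/-- The connection forms on the canonical `O(n)`-structure, extended by zero. -/
noncomputable def structureConnectionForm {M : Type*} [TopologicalSpace M]
    [ChartedSpace (EuclideanSpace ℝ (Fin (n + 1))) M] [IsManifold (𝓡 (n + 1)) ∞ M]
    (ι : S → TangentBundle (𝓡 (n + 1)) M) (i j : Fin n) (p : CoframeBundle n S) :
    TangentSpace (coframeModel n) p →L[ℝ] ℝ :=
  if h : ∃ (f : FinslerForms n (2 * n + 1) S) (U : Set S),
    IsOpen U ∧ p.proj ∈ U ∧ IsAdaptedOn ι f U ∧ f.toSection p.proj = p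
  then h.choose.connectionFormAt p.proj i j else 0

variable {M : Type*} [TopologicalSpace M] [ChartedSpace (EuclideanSpace ℝ (Fin (n + 1))) M]
  [IsManifold (𝓡 (n + 1)) ∞ M]

theorem FinslerForms.IsFinslerOn.mono {f : FinslerForms n (2 * n + 1) S} {U U' : Set S}
    (hf : f.IsFinslerOn U) (h : U' ⊆ U) : f.IsFinslerOn U' where
  smooth_omega a := (hf.smooth_omega a).mono h
  smooth_theta i := (hf.smooth_theta i).mono h
  smooth_conn i j := (hf.smooth_conn i j).mono h
  smooth_tor i j k := (hf.smooth_tor i j k).mono h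
  linearIndependent x hx := hf.linearIndependent x (h hx)
  conn_skew x hx := hf.conn_skew x (h hx)
  tor_symm x hx := hf.tor_symm x (h hx)
  structureEquations x hx := hf.structureEquations x (h hx)

variable {p : S → M} {V : ∀ s, TangentSpace (𝓡 (n + 1)) (p s)}

/-- All adapted coframings induce the same quadratic form `∑ ω_i²`. -/
theorem IsAdaptedOn.sum_sq_eq {f g : FinslerForms n (2 * n + 1) S} {U U' : Set S}
    (hf : IsAdaptedOn (FinslerForms.liftToTangent p V) f U) (hU : IsOpen U)
    (hg : g.IsFrameOn p V U') (hU' : IsOpen U')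
    (hp : ContMDiff (𝓡 (2 * n + 1)) (𝓡 (n + 1)) ∞ p)
    (hsurj : ∀ s, Function.Surjective (mfderiv (𝓡 (2 * n + 1)) (𝓡 (n + 1)) p s)) {s : S}
    (hs : s ∈ U) (hs' : s ∈ U') (w : EuclideanSpace ℝ (Fin (2 * n + 1))) :
    ∑ i : Fin n, (f.omega i.succ s w) ^ 2 = ∑ i : Fin n, (g.omega i.succ s w) ^ 2 := by
  have h0 : ∀ s ∈ U ∩ U', f.omega 0 s = g.omega 0 s := fun s hs =>
    (hf.hilbert s hs.1).unique ((hg.isAdaptedOn hU' hp hsurj).hilbert s hs.2)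
  refine (hf.finsler.mono Set.inter_subset_left).sum_sq_eq (hU.inter hU')
    (hg.finsler.mono Set.inter_subset_right) h0 ?_ ⟨hs, hs'⟩ w
  intro s hs w hw a
  refine Fin.cases ?_ (fun i => ?_) a
  · rw [h0 s hs, hw]
  · exact hf.semibasic s hs.1 w ((hg.ker_iff s hs.2 w).2 hw) i

/-- The coframing chosen at a point of `F` and the one to be tested agree at that point, so
`conn_eq_sub` turns the form built from the former into the connection form of the latter. -/
theorem isConnectionForm_structureConnectionForm
    (hp : ContMDiff (𝓡 (2 * n + 1)) (𝓡 (n + 1)) ∞ p)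
    (hsurj : ∀ s, Function.Surjective (mfderiv (𝓡 (2 * n + 1)) (𝓡 (n + 1)) p s))
    (hframe : ∀ s, ∃ (g : FinslerForms n (2 * n + 1) S) (U : Set S),
      IsOpen U ∧ s ∈ U ∧ g.IsFrameOn p V U) :
    IsConnectionForm (FinslerForms.liftToTangent p V)
      (structureConnectionForm (FinslerForms.liftToTangent p V)) := by
  intro U f hU hf s hs i j w
  have h : ∃ (g : FinslerForms n (2 * n + 1) S) (U : Set S), IsOpen U ∧ s ∈ U ∧
      IsAdaptedOn (FinslerForms.liftToTangent p V) g U ∧ g.toSection s = f.toSection s :=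
    ⟨f, U, hU, hs, hf, rfl⟩
  let g := h.choose
  obtain ⟨U', hU', hs', hg, hfg⟩ := h.choose_spec
  have hfg' : f.coframe s = g.coframe s :=
    eq_of_heq (Bundle.TotalSpace.mk.inj hfg).2.symm
  -- A coframing coming from the frames, with which the `∑ ω_i²` of both `f` and `g` are compared.
  obtain ⟨k, W, hW, hsW, hk⟩ := hframe s
  have h1 : structureConnectionForm (FinslerForms.liftToTangent p V) i j (f.toSection s) =
      g.connectionFormAt s i j := dif_pos h
  refine (congrArg₂ (fun (L : EuclideanSpace ℝ (Fin (2 * n + 1)) ×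
      (EuclideanSpace ℝ (Fin (2 * n + 1)) →L[ℝ] CoframeValue n) →L[ℝ] ℝ) z => L z) h1
    (hf.finsler.mfderiv_toSection hU hs w)).trans ?_
  refine (g.connectionFormAt_apply s i j _ _).trans ?_
  have hUW := hU.inter (hU'.inter hW)
  refine (FinslerForms.IsFinslerOn.conn_eq_sub hUW (hf.finsler.mono Set.inter_subset_left)
    (hg.finsler.mono (Set.inter_subset_right.trans Set.inter_subset_left)) ?_ ⟨hs, hs', hsW⟩ hfg'
    i j w).symm
  intro z hz w
  exact (hf.sum_sq_eq hU hk hW hp hsurj hz.1 hz.2.2 w).trans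
    (hg.sum_sq_eq hU' hk hW hp hsurj hz.2.1 hz.2.2 w).symm

end CoframeBundleCharts

/-! ### Pullback of the connection forms to `X` -/

section CanonicalStructure

variable {n N : ℕ} {X : Type*} [TopologicalSpace X] [ChartedSpace (EuclideanSpace ℝ (Fin N)) X]
  {M : Type*} [TopologicalSpace M] [ChartedSpace (EuclideanSpace ℝ (Fin (n + 1))) M]
  [IsManifold (𝓡 (n + 1)) ∞ M]
  {S : Type*} [TopologicalSpace S] [ChartedSpace (EuclideanSpace ℝ (Fin (2 * n + 1))) S]
  [IsManifold (𝓡 (2 * n + 1)) ∞ S]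

/-- The values of `Θ` are prescribed only on vectors tangent to adapted coframings. A vector that
`dψ` does not kill is tangent to a section of `ψ`, and `φ` carries that section to an adapted
coframing. -/
theorem IsConnectionForm.apply_mfderiv_of_ne_zero {ι : S → TangentBundle (𝓡 (n + 1)) M}
    {Θ : Fin n → Fin n → ∀ p : CoframeBundle n S, TangentSpace (coframeModel n) p →L[ℝ] ℝ}
    (hΘ : IsConnectionForm ι Θ) {f : FinslerForms n N X} {ψ : X → S}
    (hψ : Manifold.IsSubmersion (𝓡 N) (𝓡 (2 * n + 1)) ∞ ψ) {φ : X → CoframeBundle n S}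
    (hφ : ContMDiff (𝓡 N) (coframeModel n) ∞ φ)
    (hsec : ∀ (U : Set S) (σ : S → X), IsOpen U → ContMDiffOn (𝓡 (2 * n + 1)) (𝓡 N) ∞ σ U →
      (∀ s ∈ U, ψ (σ s) = s) → IsAdaptedOn ι (f.pullback σ) U ∧
        ∀ s ∈ U, φ (σ s) = (f.pullback σ).toSection s)
    (i j : Fin n) (x : X) (v : EuclideanSpace ℝ (Fin N))
    (hv : (mfderiv (𝓡 N) (𝓡 (2 * n + 1)) ψ x v : EuclideanSpace ℝ (Fin (2 * n + 1))) ≠ 0) :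
    Θ i j (φ x) (mfderiv (𝓡 N) (coframeModel n) φ x v) = f.conn i j x v := by
  obtain ⟨U, σ, hU, hxU, hσ, hσx, hψσ, hσv⟩ := hψ.exists_section x v
  have hσv := hσv hv
  obtain ⟨had, hφσ⟩ := hsec U σ hU hσ hψσ
  let w : EuclideanSpace ℝ (Fin (2 * n + 1)) := mfderiv (𝓡 N) (𝓡 (2 * n + 1)) ψ x v
  have h1 := hΘ U _ hU had (ψ x) hxU i j w
  let c (z : X) : EuclideanSpace ℝ (Fin N) →L[ℝ] ℝ := f.conn i j z
  let Dσ : EuclideanSpace ℝ (Fin (2 * n + 1)) →L[ℝ] EuclideanSpace ℝ (Fin N) :=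
    mfderiv (𝓡 (2 * n + 1)) (𝓡 N) σ (ψ x)
  let F := EuclideanSpace ℝ (Fin (2 * n + 1)) ×
    (EuclideanSpace ℝ (Fin (2 * n + 1)) →L[ℝ] CoframeValue n)
  let Dφ (z : X) : EuclideanSpace ℝ (Fin N) →L[ℝ] F := mfderiv (𝓡 N) (coframeModel n) φ z
  let T (p : CoframeBundle n S) : F →L[ℝ] ℝ := Θ i j p
  have h2 : mfderiv (𝓡 (2 * n + 1)) (coframeModel n) (f.pullback σ).toSection (ψ x) w =
      Dφ (σ (ψ x)) (Dσ w) := by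
    have he : (f.pullback σ).toSection =ᶠ[nhds (ψ x)] φ ∘ σ := by
      filter_upwards [hU.mem_nhds hxU] with s hs using (hφσ s hs).symm
    have h3 := mfderiv_comp (ψ x) ((hφ _).mdifferentiableAt (by simp))
      ((hσ.contMDiffAt (hU.mem_nhds hxU)).mdifferentiableAt (by simp))
    let ev (L : EuclideanSpace ℝ (Fin (2 * n + 1)) →L[ℝ] F) : F := L w
    exact (congrArg ev he.mfderiv_eq).trans (congrArg ev h3)
  have h4 : (f.pullback σ).toSection (ψ x) = φ x := (hφσ _ hxU).symm.trans (congrArg φ hσx)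
  have hDσ : Dσ w = v := hσv
  have h5 : T ((f.pullback σ).toSection (ψ x)) (Dφ (σ (ψ x)) (Dσ w)) = c (σ (ψ x)) (Dσ w) :=
    (congrArg (T _) h2).symm.trans h1
  rw [h4, hσx, hDσ] at h5
  exact h5

/-- A nonzero vertical vector is tangent to no section, but it is the difference of `v + h` and `h`,
neither of which is vertical when `h` is not; linearity does the rest. -/
theorem IsConnectionForm.apply_mfderiv {ι : S → TangentBundle (𝓡 (n + 1)) M}
    {Θ : Fin n → Fin n → ∀ p : CoframeBundle n S, TangentSpace (coframeModel n) p →L[ℝ] ℝ}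
    (hΘ : IsConnectionForm ι Θ) {f : FinslerForms n N X} {ψ : X → S}
    (hψ : Manifold.IsSubmersion (𝓡 N) (𝓡 (2 * n + 1)) ∞ ψ) {φ : X → CoframeBundle n S}
    (hφ : ContMDiff (𝓡 N) (coframeModel n) ∞ φ)
    (hsec : ∀ (U : Set S) (σ : S → X), IsOpen U → ContMDiffOn (𝓡 (2 * n + 1)) (𝓡 N) ∞ σ U →
      (∀ s ∈ U, ψ (σ s) = s) → IsAdaptedOn ι (f.pullback σ) U ∧
        ∀ s ∈ U, φ (σ s) = (f.pullback σ).toSection s)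
    (i j : Fin n) (x : X) (v : EuclideanSpace ℝ (Fin N)) :
    Θ i j (φ x) (mfderiv (𝓡 N) (coframeModel n) φ x v) = f.conn i j x v := by
  have key := hΘ.apply_mfderiv_of_ne_zero hψ hφ hsec i j x
  let Dψ : EuclideanSpace ℝ (Fin N) →L[ℝ] EuclideanSpace ℝ (Fin (2 * n + 1)) :=
    mfderiv (𝓡 N) (𝓡 (2 * n + 1)) ψ x
  let F := EuclideanSpace ℝ (Fin (2 * n + 1)) ×
    (EuclideanSpace ℝ (Fin (2 * n + 1)) →L[ℝ] CoframeValue n)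
  let L : EuclideanSpace ℝ (Fin N) →L[ℝ] ℝ :=
    ContinuousLinearMap.comp (M₂ := F) (Θ i j (φ x)) (mfderiv (𝓡 N) (coframeModel n) φ x)
  let c : EuclideanSpace ℝ (Fin N) →L[ℝ] ℝ := f.conn i j x
  change ∀ v, Dψ v ≠ 0 → L v = c v at key
  change L v = c v
  by_cases hv : Dψ v = 0
  -- The dimension `2n + 1` is positive even for `n = 0`, so `S` has nonzero tangent vectors.
  · obtain ⟨u, hu⟩ : ∃ u : EuclideanSpace ℝ (Fin (2 * n + 1)), u ≠ 0 := exists_ne 0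
    obtain ⟨h, hh⟩ : ∃ h : EuclideanSpace ℝ (Fin N), Dψ h = u := hψ.mfderiv_surjective x u
    have h1 : Dψ h ≠ 0 := fun h0 => hu (hh.symm.trans h0)
    have h2 := key h h1
    have h3 := key (v + h) (by rwa [map_add, hv, zero_add])
    rw [map_add, map_add, h2] at h3
    exact add_right_cancel h3
  · exact key v hv

end CanonicalStructure

/-! ### The reconstruction theorem -/

theorem mainTheorem10 (n N : ℕ) (hN : 2 * n + 1 ≤ N)
    {X : Type*} [TopologicalSpace X] [T2Space X] [SecondCountableTopology X]
    [ChartedSpace (EuclideanSpace ℝ (Fin N)) X] [IsManifold (𝓡 N) ∞ X]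
    {M : Type*} [TopologicalSpace M] [T2Space M] [SecondCountableTopology M]
    [ChartedSpace (EuclideanSpace ℝ (Fin (n + 1))) M] [IsManifold (𝓡 (n + 1)) ∞ M]
    {S : Type*} [TopologicalSpace S] [T2Space S] [SecondCountableTopology S] [ConnectedSpace S]
    [ChartedSpace (EuclideanSpace ℝ (Fin (2 * n + 1))) S] [IsManifold (𝓡 (2 * n + 1)) ∞ S]
    (f : FinslerForms n N X) (hf : f.IsFinslerOn Set.univ)
    (htor : ∀ i j k x, f.tor i j k x = f.tor i k j x)
    (τ : X → M) (hτ : Manifold.IsSubmersion (𝓡 N) (𝓡 (n + 1)) ∞ τ)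
    (hτ_conn : ∀ m, IsPreconnected (τ ⁻¹' {m}))
    (hτ_leaf : ∀ (x : X) (v : TangentSpace (𝓡 N) x),
      mfderiv (𝓡 N) (𝓡 (n + 1)) τ x v = 0 ↔ ∀ a, f.omega a x v = 0)
    (ψ : X → S) (hψ : Manifold.IsSubmersion (𝓡 N) (𝓡 (2 * n + 1)) ∞ ψ)
    (hψ_conn : ∀ s, IsConnected (ψ ⁻¹' {s}))
    (hψ_leaf : ∀ (x : X) (v : TangentSpace (𝓡 N) x),
      mfderiv (𝓡 N) (𝓡 (2 * n + 1)) ψ x v = 0 ↔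
        (∀ a, f.omega a x v = 0) ∧ ∀ i, f.theta i x v = 0) :
    ∃ ι : S → TangentBundle (𝓡 (n + 1)) M,
      IsGeneralizedFinslerStructure ι ∧
      (∀ x, (ι (ψ x)).proj = τ x) ∧
      ∃ φ : X → CoframeBundle n S,
        ContMDiff (𝓡 N) (coframeModel n) ∞ φ ∧
        (∀ x, φ x ∈ structureBundle ι) ∧
        (∀ x, (φ x).proj = ψ x) ∧
        (∀ (x : X) (v : TangentSpace (𝓡 N) x),
          tautologicalForm (φ x) (mfderiv (𝓡 N) (coframeModel n) φ x v) = f.coframe x v) ∧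
        (∃ Θ, IsConnectionForm ι Θ) ∧
        ∀ Θ, IsConnectionForm ι Θ → ∀ (i j : Fin n) (x : X) (v : TangentSpace (𝓡 N) x),
          Θ i j (φ x) (mfderiv (𝓡 N) (coframeModel n) φ x v) = f.conn i j x v := by
  have hψ_leaf' : ∀ (x : X) (v : TangentSpace (𝓡 N) x),
      mfderiv (𝓡 N) (𝓡 (2 * n + 1)) ψ x v = 0 →
        (∀ a, f.omega a x v = 0) ∧ ∀ i, f.theta i x v = 0 := fun x v => (hψ_leaf x v).1
  obtain ⟨p, hp, hpτ⟩ := hψ.exists_descent hψ_conn hτ.contMDiff fun x v hv =>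
    (hτ_leaf x v).2 (hψ_leaf' x v hv).1
  have hdp := mfderiv_descent hψ.contMDiff hp hpτ
  have hker : ∀ (x : X) (v : TangentSpace (𝓡 N) x),
      mfderiv (𝓡 (2 * n + 1)) (𝓡 (n + 1)) p (ψ x) (mfderiv (𝓡 N) (𝓡 (2 * n + 1)) ψ x v) = 0 ↔
        ∀ a, f.omega a x v = 0 := by
    intro x v
    refine Iff.trans ?_ (hτ_leaf x v)
    exact ⟨fun h => (hdp x v).symm.trans h, fun h => (hdp x v).trans h⟩
  obtain ⟨V, hV⟩ := hf.exists_field hψ hψ_conn hψ_leaf' fun x v => (hker x v).2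
  have hψ_surj : Function.Surjective ψ := fun s => (hψ_conn s).nonempty
  have hsurj : ∀ s, Function.Surjective (mfderiv (𝓡 (2 * n + 1)) (𝓡 (n + 1)) p s) := by
    intro s w
    obtain ⟨x, rfl⟩ := hψ_surj s
    obtain ⟨v, hv⟩ := hτ.mfderiv_surjective x (w : EuclideanSpace ℝ (Fin (n + 1)))
    exact ⟨mfderiv (𝓡 N) (𝓡 (2 * n + 1)) ψ x v, (hdp x v).trans hv⟩
  have hfib : ∀ m, IsPreconnected {s | p s = m} := by
    intro m
    -- Since `ψ` is onto, the fibers of `p` are the images of those of `τ`, and images of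
    -- preconnected sets are preconnected.
    have h : {s | p s = m} = ψ '' (τ ⁻¹' {m}) := by
      ext s
      constructor
      · rintro rfl
        obtain ⟨x, rfl⟩ := hψ_surj s
        exact ⟨x, (hpτ x).symm, rfl⟩
      · rintro ⟨x, hx, rfl⟩
        exact (hpτ x).trans hx
    rw [h]
    exact (hτ_conn m).image ψ hψ.contMDiff.continuous.continuousOn
  have hfr : ∀ (U : Set S) (σ : S → X), IsOpen U → ContMDiffOn (𝓡 (2 * n + 1)) (𝓡 N) ∞ σ U →
      (∀ s ∈ U, ψ (σ s) = s) → (f.pullback σ).IsFrameOn p V U := fun U σ hU hσ hsec =>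
    hf.pullback_isFrameOn hψ.contMDiff hψ_leaf' hker hV hU hσ hsec
  have hframe : ∀ s, ∃ (g : FinslerForms n (2 * n + 1) S) (U : Set S),
      IsOpen U ∧ s ∈ U ∧ g.IsFrameOn p V U := by
    intro s
    obtain ⟨x, rfl⟩ := hψ_surj s
    obtain ⟨U, σ, hU, hx, hσ, -, hsec, -⟩ := hψ.exists_section x 0
    exact ⟨f.pullback σ, U, hU, hx, hfr U σ hU hσ hsec⟩
  obtain ⟨φ, hφ, hφψ, hφt, hφσ⟩ := hf.exists_coframe_lift hψ hψ_leaf'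
  refine ⟨FinslerForms.liftToTangent p V,
    FinslerForms.isGeneralizedFinslerStructure_of_isFrameOn hp hsurj hfib hframe, hpτ,
    φ, hφ, ?_, hφψ, hφt, ⟨_, isConnectionForm_structureConnectionForm hp hsurj hframe⟩, ?_⟩
  · intro x
    obtain ⟨U, σ, hU, hx, hσ, hσx, hsec, -⟩ := hψ.exists_section x 0
    have h : φ x = (f.pullback σ).toSection (ψ x) :=
      (congrArg φ hσx).symm.trans (hφσ U σ hU hσ hsec _ hx)
    rw [h]
    exact ⟨U, f.pullback σ, hU, hx, (hfr U σ hU hσ hsec).isAdaptedOn hU hp hsurj, rfl⟩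
  · intro Θ hΘ i j x v
    exact hΘ.apply_mfderiv hψ hφ (fun U σ hU hσ hsec =>
      ⟨(hfr U σ hU hσ hsec).isAdaptedOn hU hp hsurj, hφσ U σ hU hσ hsec⟩) i j x v
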